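/- Let $\Bbbk$ be an algebraically closed field of characteristic $p>0$, with Frobenius $\operatorname{Frob}(\lambda)=\lambda^p$. **Conventions.** An LSM category is a $\Bbbk$-linear symmetric monoidal category with bilinear tensor product. A *tensor category* is an essentially small abelian LSM category in which all objects have finite length and have monoidal duals, and with $\Bbbk\to\operatorname{End}(\mathbf 1)$ an isomorphism. For a field endomorphism $\varphi$ of $\Bbbk$, a $\varphi$-LSM functor is a symmetric (strong) monoidal functor $F$ that is additive on morphisms and satisfies $F(\lambda f)=\varphi(\lambda)F(f)$ for $\lambda\in\Bbbk$; for $\varphi=\mathrm{id}$ we say LSM functor. A *tensor functor* is an exact LSM functor between tensor categories. For tensor categories $\mathcal C,\mathcal D$, the Deligne product $\mathcal C\boxtimes\mathcal D$ is a tensor category with tensor functors $-\boxtimes\mathbf 1:\mathcal C\to\mathcal C\boxtimes\mathcal D$ and $\mathbf 1\boxtimes-:\mathcal D\to\mathcal C\boxtimes\mathcal D$ such that the bifunctor $X\boxtimes Y:=(X\boxtimes\mathbf 1)\otimes(\mathbf 1\boxtimes Y)$ is universal: for every $\Bbbk$-linear abelian category $\mathcal E$, restriction along it is an equivalence from right exact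 $\Bbbk$-linear functors $\mathcal C\boxtimes\mathcal D\to\mathcal E$ to bilinear bifunctors $\mathcal C\times\mathcal D\to\mathcal E$ that are right exact in each variable. For a finite group $G$, $\operatorname{Rep}G$ is the category of finite-dimensional representations over $\Bbbk$, and $\mathcal C\boxtimes\operatorname{Rep}G$ is the tensor category of $G$-representations in $\mathcal C$; here $X\boxtimes\mathbf 1$ is $X$ with trivial action, and $\mathbf 1\boxtimes U$ is the sum of $\dim U$ copies of $\mathbf 1$ with the action on $U$. For a tensor functor $F:\mathcal C\to\mathcal D$, $F\boxtimes\mathcal V:\mathcal C\boxtimes\mathcal V\to\mathcal D\boxtimes\mathcal V$ is the tensor functor which restricts, up to monoidal isomorphism, to $X\mapsto F(X)\boxtimes\mathbf 1$ on $\mathcal C$ and to $\mathbf 1\boxtimes-$ on $\mathcal V$. For a (not necessarily exact) LSM functor $\Theta:\operatorname{Rep}G\to\mathcal V$, $\mathcal C\boxtimes\Theta:\mathcal C\boxtimes\operatorname{Rep}G\to\mathcal C\boxtimes\mathcal V$ is the LSM functor which restricts, up to monoidal isomorphism, to $-\boxtimes\mathbf 1$ on $\mathcal C$ and to $U\mapsto\mathbf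 1\boxtimes\Theta(U)$ on $\operatorname{Rep}G$. For a subgroup $G$ of the group of permutations of a finite set $W$, a *$\mathbf V$-functor* is an LSM functor $\Theta:\operatorname{Rep}G\to\mathcal V$ to a tensor category $\mathcal V$ such that $\Theta(\operatorname{Ind}_H^G\mathbf 1)=0$ for every subgroup $H<G$ that does not act transitively on $W$. An *$\mathbf O^i\{\mathcal V\}$-functor* is a family of $\operatorname{Frob}^i$-LSM functors $\Phi_{\mathcal C}:\mathcal C\to\mathcal C\boxtimes\mathcal V$, one for every tensor category $\mathcal C$ over $\Bbbk$, such that for every tensor functor $F:\mathcal C\to\mathcal D$ there is a monoidal natural isomorphism $(F\boxtimes\mathcal V)\circ\Phi_{\mathcal C}\cong\Phi_{\mathcal D}\circ F$. **Theorem.** Let $i\ge 1$, let $G<S_{p^i}$ be a permutation group and let $\Theta:\operatorname{Rep}G\to\mathcal V$ be a $\mathbf V$-functor. For every tensor category $\mathcal C$ consider the symmetric monoidal functor $$\Phi_{\mathcal C}:\ \mathcal C\xrightarrow{X\mapsto X^{\otimes p^i}}\mathcal C\boxtimes\operatorname{Rep}S_{p^i}\xrightarrow{\mathcal C\boxtimes\operatorname{Res}}\mathcal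 C\boxtimes\operatorname{Rep}G\xrightarrow{\mathcal C\boxtimes\Theta}\mathcal C\boxtimes\mathcal V,$$ where $S_{p^i}$ acts on $X^{\otimes p^i}$ through the braiding. Then every $\Phi_{\mathcal C}$ is additive and $\operatorname{Frob}^i$-linear, and the family $(\Phi_{\mathcal C})_{\mathcal C}$ is an $\mathbf O^i\{\mathcal V\}$-functor. -/

import Mathlib

universe w v u

open CategoryTheory MonoidalCategory Limits

namespace OFun

set_option linter.unusedSectionVars false
set_option linter.unusedSimpArgs false
set_option linter.style.longLine false

section Power
variable {C : Type w} [Category.{v} C] [MonoidalCategory C]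

/-- The tensor power `X ⊗ (X ⊗ (⋯ ⊗ 𝟙))` with `n` factors `X`. -/
@[reducible] def tpow (X : C) : ℕ → C
  | 0 => 𝟙_ C
  | n + 1 => X ⊗ tpow X n

/-- The morphism `f ⊗ ⋯ ⊗ f` of tensor powers. -/
def tpowMap {X Y : C} (f : X ⟶ Y) : (n : ℕ) → (tpow X n ⟶ tpow Y n)
  | 0 => 𝟙 _
  | n + 1 => f ⊗ₘ tpowMap f n

lemma tpowMap_id (X : C) (n : ℕ) : tpowMap (𝟙 X) n = 𝟙 _ := by
  induction n with
  | zero => rfl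
  | succ n ih => simp [tpowMap, ih]

lemma tpowMap_comp {X Y Z : C} (f : X ⟶ Y) (g : Y ⟶ Z) (n : ℕ) :
    tpowMap (f ≫ g) n = tpowMap f n ≫ tpowMap g n := by
  induction n with
  | zero => simp [tpowMap]
  | succ n ih => simp [tpowMap, ih]

variable [SymmetricCategory C]

/-- The braiding of the first two factors of `X ⊗ X ⊗ Z`. -/
def swapFirst (X Z : C) : X ⊗ (X ⊗ Z) ⟶ X ⊗ (X ⊗ Z) :=
  (α_ X X Z).inv ≫ (β_ X X).hom ▷ Z ≫ (α_ X X Z).hom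

lemma swapFirst_swapFirst (X Z : C) : swapFirst X Z ≫ swapFirst X Z = 𝟙 _ := by
  simp [swapFirst, ← comp_whiskerRight_assoc]

lemma swapFirst_natural (X : C) {Z W : C} (f : Z ⟶ W) :
    X ◁ X ◁ f ≫ swapFirst X W = swapFirst X Z ≫ X ◁ X ◁ f := by
  simp only [swapFirst, associator_inv_naturality_right_assoc, whisker_exchange_assoc,
    associator_naturality_right, Category.assoc]

lemma swapFirst_braid (X Z : C) :
    swapFirst X (X ⊗ Z) ≫ X ◁ swapFirst X Z ≫ swapFirst X (X ⊗ Z) =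
      X ◁ swapFirst X Z ≫ swapFirst X (X ⊗ Z) ≫ X ◁ swapFirst X Z := by
  have h2 := BraidedCategory.yang_baxter' X X X
  have h3 := congrArg (fun t => 𝟙 (X ⊗ X ⊗ X ⊗ Z) ⊗≫ (t ▷ Z) ⊗≫ 𝟙 (X ⊗ X ⊗ X ⊗ Z)) h2
  simp only [swapFirst]
  calc _ = 𝟙 (X ⊗ X ⊗ X ⊗ Z) ⊗≫
        (β_ X X).hom ▷ (X ⊗ Z) ⊗≫ (X ◁ (β_ X X).hom) ▷ Z ⊗≫ ((β_ X X).hom) ▷ (X ⊗ Z) ⊗≫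
          𝟙 (X ⊗ X ⊗ X ⊗ Z) := by monoidal
    _ = _ := by
      refine Eq.trans ?_ (h3.trans ?_)
      · monoidal
      · monoidal

/-- The composite of adjacent braidings that moves the factor in position `j` to the front
and keeps the order of the other factors. -/
def toFront (X : C) : {n : ℕ} → Fin (n + 1) → (tpow X (n + 1) ⟶ tpow X (n + 1))
  | 0, _ => 𝟙 _
  | n + 1, j => Fin.cases (𝟙 _) (fun i => X ◁ toFront X i ≫ swapFirst X (tpow X n)) j

lemma toFront_zero (X : C) {n : ℕ} : toFront X (0 : Fin (n + 1)) = 𝟙 _ := by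
  cases n <;> rfl

lemma toFront_succ (X : C) {n : ℕ} (i : Fin (n + 1)) :
    toFront X i.succ = X ◁ toFront X i ≫ swapFirst X (tpow X n) := rfl

lemma toFront_toFront (X : C) : ∀ {n : ℕ} (q : Fin (n + 2)) (a : Fin (n + 1)),
    toFront X q ≫ X ◁ toFront X a ≫ swapFirst X (tpow X n) =
      toFront X (q.succAbove a) ≫ X ◁ toFront X (a.predAbove q) := by
  intro n
  induction n with
  | zero =>
    intro q a
    obtain rfl : a = 0 := Fin.fin_one_eq_zero a
    cases q using Fin.cases with
    | zero =>
      rw [Fin.zero_succAbove, toFront_succ]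
      simp [toFront_zero]
    | succ q =>
      obtain rfl : q = 0 := Fin.fin_one_eq_zero q
      simp only [Fin.succ_succAbove_zero, Fin.predAbove_zero_succ, toFront_succ, toFront_zero,
        whiskerLeft_id, Category.id_comp, Category.comp_id, swapFirst_swapFirst]
  | succ n ih =>
    intro q a
    cases q using Fin.cases with
    | zero => simp [toFront_zero, toFront_succ]
    | succ q =>
      cases a using Fin.cases with
      | zero => simp [toFront_zero, toFront_succ, swapFirst_swapFirst, tpow]
      | succ a =>
        have h := congrArg (fun t => X ◁ t) (ih q a)
        simp only [whiskerLeft_comp] at h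
        rw [Fin.succ_succAbove_succ, Fin.succ_predAbove_succ]
        simp only [toFront_succ, whiskerLeft_comp, Category.assoc]
        rw [← reassoc_of% (swapFirst_natural X (toFront X a)),
          ← reassoc_of% (swapFirst_natural X (toFront X (a.predAbove q)))]
        erw [← reassoc_of% h]
        erw [swapFirst_braid]

/-- The permutation of `n` letters obtained from `σ` by deleting `p` from the source and `σ p` from
the target, and renumbering in order. -/
def removeAt {n : ℕ} (σ : Equiv.Perm (Fin (n + 1))) (p : Fin (n + 1)) : Equiv.Perm (Fin n) :=
  (finSuccAboveEquiv p).trans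
    ((σ.subtypeEquiv (q := fun x => x ≠ σ p) (by simp)).trans (finSuccAboveEquiv (σ p)).symm)

lemma removeAt_apply {n : ℕ} (σ : Equiv.Perm (Fin (n + 1))) (p : Fin (n + 1)) (j : Fin n) :
    (σ p).succAbove (removeAt σ p j) = σ (p.succAbove j) := by
  have h : finSuccAboveEquiv (σ p) (removeAt σ p j) =
      (σ.subtypeEquiv (p := fun x => x ≠ p) (q := fun x => x ≠ σ p) (by simp))
      (finSuccAboveEquiv p j) := by
    simp only [removeAt, Equiv.trans_apply, Equiv.apply_symm_apply]
  exact congrArg Subtype.val h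

lemma removeAt_mul {n : ℕ} (σ τ : Equiv.Perm (Fin (n + 1))) (p : Fin (n + 1)) :
    removeAt (τ * σ) p = removeAt τ (σ p) * removeAt σ p := by
  ext j : 1
  apply (τ (σ p)).succAbove_right_injective
  rw [Equiv.Perm.mul_apply, removeAt_apply, removeAt_apply]
  exact removeAt_apply (τ * σ) p j

lemma removeAt_one {n : ℕ} (p : Fin (n + 1)) : removeAt 1 p = 1 := by
  ext j : 1
  exact p.succAbove_right_injective (removeAt_apply 1 p j)

/-- The braiding action of the symmetric group on the tensor power: `σ` moves the factor in
position `j` to position `σ j`. -/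
def permMap (X : C) : {n : ℕ} → Equiv.Perm (Fin n) → (tpow X n ⟶ tpow X n)
  | 0, _ => 𝟙 _
  | _ + 1, σ => toFront X (σ⁻¹ 0) ≫ X ◁ permMap X (removeAt σ (σ⁻¹ 0))

lemma permMap_succ (X : C) {n : ℕ} (σ : Equiv.Perm (Fin (n + 1))) :
    permMap X σ = toFront X (σ⁻¹ 0) ≫ X ◁ permMap X (removeAt σ (σ⁻¹ 0)) := rfl

lemma permMap_toFront (X : C) : ∀ {n : ℕ} (σ : Equiv.Perm (Fin (n + 1))) (p : Fin (n + 1)),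
    permMap X σ ≫ toFront X (σ p) = toFront X p ≫ X ◁ permMap X (removeAt σ p) := by
  intro n
  induction n with
  | zero =>
    intro σ p
    simp [permMap, toFront, tpow]
  | succ n ih =>
    intro σ p
    by_cases hp : p = σ⁻¹ 0
    · subst hp
      have hz : σ (σ⁻¹ 0) = 0 := by simp
      rw [hz, toFront_zero, Category.comp_id, permMap_succ]
    · obtain ⟨r, hr⟩ := Fin.exists_succAbove_eq hp
      set q := σ⁻¹ 0 with hq
      have hσq : σ q = 0 := by simp [hq]
      have hs : σ p = (removeAt σ q r).succ := by
        rw [← hr, ← removeAt_apply, hσq, Fin.zero_succAbove]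
      set q' := r.predAbove q with hq'
      have hpq : p.succAbove q' = q := by
        rw [← hr, hq', Fin.succAbove_succAbove_predAbove]
      have h0 : (removeAt σ p)⁻¹ 0 = q' := by
        rw [Equiv.Perm.inv_eq_iff_eq]
        apply (σ p).succAbove_right_injective
        rw [removeAt_apply, hpq, hσq, hs]
        simp
      have hrem : removeAt (removeAt σ p) q' = removeAt (removeAt σ q) r := by
        ext j : 1
        apply (removeAt σ p q').succAbove_right_injective
        apply (σ p).succAbove_right_injective
        rw [removeAt_apply, removeAt_apply]
        have e1 : p.succAbove (q'.succAbove j) = q.succAbove (r.succAbove j) := by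
          rw [← hr, hq', Fin.succAbove_succAbove_succAbove_predAbove]
        rw [e1, ← removeAt_apply σ q, ← removeAt_apply (removeAt σ q) r]
        have e2 := Fin.succAbove_succAbove_succAbove_predAbove (σ q) (removeAt σ q r)
          (removeAt (removeAt σ q) r j)
        rw [removeAt_apply, hr] at e2
        rw [← e2]
        congr 2
        rw [hσq]
        have : removeAt σ p q' = 0 := by rw [← h0]; simp
        rw [this]
        simp
      rw [permMap_succ, ← hq, hs, toFront_succ]
      have hih := congrArg (fun t => X ◁ t) (ih (removeAt σ q) r)
      simp only [whiskerLeft_comp] at hih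
      rw [Category.assoc, reassoc_of% hih]
      rw [permMap_succ X (removeAt σ p), h0, hrem, whiskerLeft_comp]
      have := toFront_toFront X q r
      rw [hr, ← hq'] at this
      erw [← reassoc_of% this]
      erw [swapFirst_natural]

lemma permMap_one (X : C) : ∀ {n : ℕ}, permMap X (1 : Equiv.Perm (Fin n)) = 𝟙 _ := by
  intro n
  induction n with
  | zero => rfl
  | succ n ih => simp [permMap, removeAt_one, ih, toFront_zero, tpow]

lemma permMap_mul (X : C) : ∀ {n : ℕ} (τ σ : Equiv.Perm (Fin n)),
    permMap X (τ * σ) = permMap X σ ≫ permMap X τ := by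
  intro n
  induction n with
  | zero => intro τ σ; simp [permMap]
  | succ n ih =>
    intro τ σ
    obtain ⟨p, hp⟩ : ∃ p, τ (σ p) = 0 := ⟨σ⁻¹ (τ⁻¹ 0), by simp⟩
    have h1 : (τ * σ)⁻¹ 0 = p := by rw [Equiv.Perm.inv_eq_iff_eq]; exact hp.symm
    have h2 : τ⁻¹ 0 = σ p := by rw [Equiv.Perm.inv_eq_iff_eq]; exact hp.symm
    rw [permMap_succ, permMap_succ X τ, h1, h2, reassoc_of% permMap_toFront X σ p, removeAt_mul, ih, whiskerLeft_comp]


lemma swapFirst_tpowMap {X Y Z W : C} (f : X ⟶ Y) (g : Z ⟶ W) :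
    (f ⊗ₘ f ⊗ₘ g) ≫ swapFirst Y W = swapFirst X Z ≫ (f ⊗ₘ f ⊗ₘ g) := by
  have h : ((f ⊗ₘ f) ⊗ₘ g) ≫ (β_ Y Y).hom ▷ W = (β_ X X).hom ▷ Z ≫ ((f ⊗ₘ f) ⊗ₘ g) := by
    rw [tensorHom_comp_whiskerRight, BraidedCategory.braiding_naturality,
      whiskerRight_comp_tensorHom]
  simp only [swapFirst, Category.assoc]
  rw [associator_inv_naturality_assoc, reassoc_of% h, associator_naturality]

lemma toFront_natural {X Y : C} (f : X ⟶ Y) : ∀ {n : ℕ} (j : Fin (n + 1)),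
    tpowMap f (n + 1) ≫ toFront Y j = toFront X j ≫ tpowMap f (n + 1) := by
  intro n
  induction n with
  | zero => intro j; simp [toFront]
  | succ n ih =>
    intro j
    cases j using Fin.cases with
    | zero => simp [toFront_zero]
    | succ j =>
      have h1 : tpowMap f (n + 2) ≫ Y ◁ toFront Y j = X ◁ toFront X j ≫ tpowMap f (n + 2) := by
        rw [tpowMap, tensorHom_comp_whiskerLeft, ih, whiskerLeft_comp_tensorHom]
      have h2 : tpowMap f (n + 2) ≫ swapFirst Y (tpow Y n) =
          swapFirst X (tpow X n) ≫ tpowMap f (n + 2) := swapFirst_tpowMap f _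
      rw [toFront_succ, toFront_succ, reassoc_of% h1, h2, Category.assoc]

lemma permMap_natural {X Y : C} (f : X ⟶ Y) : ∀ {n : ℕ} (σ : Equiv.Perm (Fin n)),
    tpowMap f n ≫ permMap Y σ = permMap X σ ≫ tpowMap f n := by
  intro n
  induction n with
  | zero => intro σ; simp [permMap]
  | succ n ih =>
    intro σ
    rw [permMap_succ, permMap_succ, reassoc_of% toFront_natural, Category.assoc]
    congr 1
    simp only [tpowMap]
    rw [tensorHom_comp_whiskerLeft, whiskerLeft_comp_tensorHom, ih]

/-- The isomorphism of `X ⊗ ⋯ ⊗ X ⊗ Y ⊗ ⋯ ⊗ Y` with `(X ⊗ Y) ⊗ ⋯ ⊗ (X ⊗ Y)` given by shuffling factors. -/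
def tpowμ (X Y : C) : (n : ℕ) → (tpow X n ⊗ tpow Y n ≅ tpow (X ⊗ Y) n)
  | 0 => λ_ (𝟙_ C)
  | n + 1 => ⟨tensorμ X (tpow X n) Y (tpow Y n), tensorδ X (tpow X n) Y (tpow Y n),
      tensorμ_tensorδ .., tensorδ_tensorμ ..⟩ ≪≫ whiskerLeftIso (X ⊗ Y) (tpowμ X Y n)

/-- The isomorphism of the unit with its tensor power. -/
def tpowε : (n : ℕ) → (𝟙_ C ≅ tpow (𝟙_ C) n)
  | 0 => Iso.refl _
  | n + 1 => (λ_ (𝟙_ C)).symm ≪≫ whiskerLeftIso (𝟙_ C) (tpowε n)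

lemma tpowμ_succ (X Y : C) (n : ℕ) : (tpowμ X Y (n + 1)).hom =
  tensorμ X (tpow X n) Y (tpow Y n) ≫ (X ⊗ Y) ◁ (tpowμ X Y n).hom := rfl

lemma tpowμ_natural {X Y X' Y' : C} (f : X ⟶ X') (g : Y ⟶ Y') (n : ℕ) :
    (tpowMap f n ⊗ₘ tpowMap g n) ≫ (tpowμ X' Y' n).hom =
      (tpowμ X Y n).hom ≫ tpowMap (f ⊗ₘ g) n := by
  induction n with
  | zero => simp [tpowMap, tpowμ]
  | succ n ih =>
    rw [tpowμ_succ, tpowμ_succ]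
    simp only [tpowMap]
    rw [tensorμ_natural_assoc, Category.assoc, tensorHom_comp_whiskerLeft, ih,
      whiskerLeft_comp_tensorHom]

lemma tpowμ_assoc (X Y Z : C) (n : ℕ) :
    (tpowμ X Y n).hom ▷ tpow Z n ≫ (tpowμ (X ⊗ Y) Z n).hom ≫ tpowMap (α_ X Y Z).hom n =
      (α_ (tpow X n) (tpow Y n) (tpow Z n)).hom ≫ tpow X n ◁ (tpowμ Y Z n).hom ≫
        (tpowμ X (Y ⊗ Z) n).hom := by
  induction n with
  | zero =>
    change (λ_ (𝟙_ C)).hom ▷ 𝟙_ C ≫ (λ_ (𝟙_ C)).hom ≫ 𝟙 _ =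
      (α_ _ _ _).hom ≫ 𝟙_ C ◁ (λ_ (𝟙_ C)).hom ≫ (λ_ (𝟙_ C)).hom
    rw [Category.comp_id, leftUnitor_whiskerRight, Category.assoc, leftUnitor_naturality]
  | succ n ih =>
    simp only [tpowμ_succ, tpowMap, comp_whiskerRight, whiskerLeft_comp, Category.assoc]
    have e : ((X ⊗ Y) ◁ (tpowμ X Y n).hom) ▷ (Z ⊗ tpow Z n) ≫
        tensorμ (X ⊗ Y) (tpow (X ⊗ Y) n) Z (tpow Z n) =
        tensorμ (X ⊗ Y) (tpow X n ⊗ tpow Y n) Z (tpow Z n) ≫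
          ((X ⊗ Y) ⊗ Z) ◁ ((tpowμ X Y n).hom ▷ tpow Z n) := by
      have := tensorμ_natural_left (𝟙 (X ⊗ Y)) (tpowμ X Y n).hom Z (tpow Z n)
      simpa using this
    have e' : (X ⊗ tpow X n) ◁ ((Y ⊗ Z) ◁ (tpowμ Y Z n).hom) ≫
        tensorμ X (tpow X n) (Y ⊗ Z) (tpow (Y ⊗ Z) n) =
        tensorμ X (tpow X n) (Y ⊗ Z) (tpow Y n ⊗ tpow Z n) ≫
          (X ⊗ Y ⊗ Z) ◁ (tpow X n ◁ (tpowμ Y Z n).hom) := by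
      have := tensorμ_natural_right X (tpow X n) (𝟙 (Y ⊗ Z)) (tpowμ Y Z n).hom
      simpa using this
    rw [reassoc_of% e, reassoc_of% e', ← tensor_associativity_assoc]
    rw [whiskerLeft_comp_tensorHom, whiskerLeft_comp_tensorHom, ih]
    rw [tensorHom_comp_whiskerLeft_assoc, tensorHom_comp_whiskerLeft, Category.assoc]

lemma tpow_left (X : C) (n : ℕ) : (λ_ (tpow X n)).hom =
    (tpowε n).hom ▷ tpow X n ≫ (tpowμ (𝟙_ C) X n).hom ≫ tpowMap (λ_ X).hom n := by
  induction n with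
  | zero => simp [tpowMap, tpowμ, tpowε]
  | succ n ih =>
    have e : (𝟙_ C ◁ (tpowε n).hom) ▷ (X ⊗ tpow X n) ≫
        tensorμ (𝟙_ C) (tpow (𝟙_ C) n) X (tpow X n) =
        tensorμ (𝟙_ C) (𝟙_ C) X (tpow X n) ≫
          (𝟙_ C ⊗ X) ◁ ((tpowε n).hom ▷ tpow X n) := by
      have := tensorμ_natural_left (𝟙 (𝟙_ C)) (tpowε n).hom X (tpow X n)
      simpa using this
    rw [tensor_left_unitality, tpowμ_succ, tpowMap, tpowε]
    simp only [Iso.trans_hom, Iso.symm_hom, whiskerLeftIso_hom, comp_whiskerRight, Category.assoc]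
    rw [reassoc_of% e, whiskerLeft_comp_tensorHom, whiskerLeft_comp_tensorHom, ← ih]

lemma tpow_right (X : C) (n : ℕ) : (ρ_ (tpow X n)).hom =
    tpow X n ◁ (tpowε n).hom ≫ (tpowμ X (𝟙_ C) n).hom ≫ tpowMap (ρ_ X).hom n := by
  induction n with
  | zero => simp [tpowMap, tpowμ, tpowε, unitors_equal]
  | succ n ih =>
    have e : (X ⊗ tpow X n) ◁ (𝟙_ C ◁ (tpowε n).hom) ≫
        tensorμ X (tpow X n) (𝟙_ C) (tpow (𝟙_ C) n) =
        tensorμ X (tpow X n) (𝟙_ C) (𝟙_ C) ≫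
          (X ⊗ 𝟙_ C) ◁ (tpow X n ◁ (tpowε n).hom) := by
      have := tensorμ_natural_right X (tpow X n) (𝟙 (𝟙_ C)) (tpowε n).hom
      simpa using this
    rw [tensor_right_unitality, tpowμ_succ, tpowMap, tpowε]
    simp only [Iso.trans_hom, Iso.symm_hom, whiskerLeftIso_hom, whiskerLeft_comp, Category.assoc]
    rw [reassoc_of% e, whiskerLeft_comp_tensorHom, whiskerLeft_comp_tensorHom, ← ih]

lemma tensorμ_braiding (X₁ X₂ Y₁ Y₂ : C) :
    tensorμ X₁ X₂ Y₁ Y₂ ≫ ((β_ X₁ Y₁).hom ⊗ₘ (β_ X₂ Y₂).hom) =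
      (β_ (X₁ ⊗ X₂) (Y₁ ⊗ Y₂)).hom ≫ tensorμ Y₁ Y₂ X₁ X₂ := by
  have h : Y₁ ◁ (β_ X₁ Y₂).hom ▷ X₂ ≫ Y₁ ◁ (β_ Y₂ X₁).hom ▷ X₂ = 𝟙 _ := by
    rw [← whiskerLeft_comp, ← comp_whiskerRight, SymmetricCategory.symmetry]; simp
  simp only [tensorμ, BraidedCategory.braiding_tensor_left_hom,
    BraidedCategory.braiding_tensor_right_hom, MonoidalCategory.tensorHom_def]
  symm
  calc _ = 𝟙 _ ⊗≫ X₁ ◁ (β_ X₂ Y₁).hom ▷ Y₂ ⊗≫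
        ((β_ X₁ Y₁).hom ▷ (X₂ ⊗ Y₂) ≫ (Y₁ ⊗ X₁) ◁ (β_ X₂ Y₂).hom) ⊗≫
        (Y₁ ◁ (β_ X₁ Y₂).hom ▷ X₂ ≫ Y₁ ◁ (β_ Y₂ X₁).hom ▷ X₂) ⊗≫ 𝟙 _ := by monoidal
    _ = _ := by
      rw [h]
      monoidal

lemma tpow_braided (X Y : C) (n : ℕ) : (tpowμ X Y n).hom ≫ tpowMap (β_ X Y).hom n =
    (β_ (tpow X n) (tpow Y n)).hom ≫ (tpowμ Y X n).hom := by
  induction n with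
  | zero =>
    change (λ_ (𝟙_ C)).hom ≫ 𝟙 _ = (β_ (𝟙_ C) (𝟙_ C)).hom ≫ (λ_ (𝟙_ C)).hom
    rw [Category.comp_id, braiding_leftUnitor, unitors_equal]
  | succ n ih =>
    simp only [tpowμ_succ, tpowMap, Category.assoc]
    rw [whiskerLeft_comp_tensorHom, ih, ← reassoc_of% tensorμ_braiding, tensorHom_comp_whiskerLeft]

lemma swapFirst_tensorμ (X Y Z W : C) :
    (swapFirst X Z ⊗ₘ swapFirst Y W) ≫ tensorμ X (X ⊗ Z) Y (Y ⊗ W) ≫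
      (X ⊗ Y) ◁ tensorμ X Z Y W =
     tensorμ X (X ⊗ Z) Y (Y ⊗ W) ≫ (X ⊗ Y) ◁ tensorμ X Z Y W ≫ swapFirst (X ⊗ Y) (Z ⊗ W) := by
  have h1 : tensorμ X (X ⊗ Z) Y (Y ⊗ W) ≫ (X ⊗ Y) ◁ tensorμ X Z Y W =
      ((α_ X X Z).inv ⊗ₘ (α_ Y Y W).inv) ≫ tensorμ (X ⊗ X) Z (Y ⊗ Y) W ≫
        tensorμ X X Y Y ▷ (Z ⊗ W) ≫ (α_ _ _ _).hom := by
    rw [associator_monoidal, tensorHom_comp_tensorHom_assoc]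
    simp
  have h2 : ((β_ X X).hom ▷ Z ⊗ₘ (β_ Y Y).hom ▷ W) ≫ tensorμ (X ⊗ X) Z (Y ⊗ Y) W =
      tensorμ (X ⊗ X) Z (Y ⊗ Y) W ≫ ((β_ X X).hom ⊗ₘ (β_ Y Y).hom) ▷ (Z ⊗ W) := by
    simpa using tensorμ_natural (β_ X X).hom (𝟙 Z) (β_ Y Y).hom (𝟙 W)
  rw [h1, reassoc_of% h1]
  simp only [swapFirst]
  rw [Iso.hom_inv_id_assoc, tensorHom_comp_tensorHom_assoc]
  simp only [Category.assoc, Iso.hom_inv_id, Category.comp_id]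
  rw [← tensorHom_comp_tensorHom_assoc, reassoc_of% h2, ← comp_whiskerRight_assoc,
    ← SymmetricCategory.tensorμ_braid_swap, comp_whiskerRight_assoc]

lemma toFront_tpowμ (X Y : C) : ∀ {n : ℕ} (j : Fin (n + 1)),
    (toFront X j ⊗ₘ toFront Y j) ≫ (tpowμ X Y (n + 1)).hom =
      (tpowμ X Y (n + 1)).hom ≫ toFront (X ⊗ Y) j := by
  intro n
  induction n with
  | zero => intro j; simp [toFront]
  | succ n ih =>
    intro j
    cases j using Fin.cases with
    | zero => simp [toFront_zero]
    | succ j =>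
      have h1 : (X ◁ toFront X j ⊗ₘ Y ◁ toFront Y j) ≫ tensorμ X (tpow X (n + 1)) Y (tpow Y (n + 1))
          = tensorμ X (tpow X (n + 1)) Y (tpow Y (n + 1)) ≫
            (X ⊗ Y) ◁ (toFront X j ⊗ₘ toFront Y j) := by
        simpa using tensorμ_natural (𝟙 X) (toFront X j) (𝟙 Y) (toFront Y j)
      have h2 : (swapFirst X (tpow X n) ⊗ₘ swapFirst Y (tpow Y n)) ≫ (tpowμ X Y (n + 2)).hom =
          (tpowμ X Y (n + 2)).hom ≫ swapFirst (X ⊗ Y) (tpow (X ⊗ Y) n) := by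
        simp only [tpowμ_succ, whiskerLeft_comp, Category.assoc]
        rw [reassoc_of% swapFirst_tensorμ, swapFirst_natural]
      rw [toFront_succ, toFront_succ, toFront_succ, ← tensorHom_comp_tensorHom, Category.assoc,
        h2, tpowμ_succ, Category.assoc, reassoc_of% h1, ← whiskerLeft_comp_assoc, ih,
        whiskerLeft_comp_assoc, Category.assoc]

lemma permMap_tpowμ (X Y : C) : ∀ {n : ℕ} (σ : Equiv.Perm (Fin n)),
    (permMap X σ ⊗ₘ permMap Y σ) ≫ (tpowμ X Y n).hom =
      (tpowμ X Y n).hom ≫ permMap (X ⊗ Y) σ := by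
  intro n
  induction n with
  | zero => intro σ; simp [permMap]
  | succ n ih =>
    intro σ
    have h1 (τ : Equiv.Perm (Fin n)) : (X ◁ permMap X τ ⊗ₘ Y ◁ permMap Y τ) ≫
        tensorμ X (tpow X n) Y (tpow Y n) = tensorμ X (tpow X n) Y (tpow Y n) ≫
            (X ⊗ Y) ◁ (permMap X τ ⊗ₘ permMap Y τ) := by
      simpa using tensorμ_natural (𝟙 X) (permMap X τ) (𝟙 Y) (permMap Y τ)
    rw [permMap_succ, permMap_succ, permMap_succ, ← tensorHom_comp_tensorHom, Category.assoc,
      ← reassoc_of% toFront_tpowμ, tpowμ_succ, reassoc_of% h1, ← whiskerLeft_comp, ih,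
      whiskerLeft_comp, Category.assoc]

lemma swapFirst_unit (Z : C) :
    swapFirst (𝟙_ C) Z = 𝟙 _ := by
  have : (β_ (𝟙_ C) (𝟙_ C)).hom = 𝟙 _ := by
    rw [braiding_tensorUnit_left, unitors_equal, Iso.hom_inv_id]
  simp [swapFirst]

lemma toFront_unit : ∀ {n : ℕ} (j : Fin (n + 1)), toFront (𝟙_ C) j = 𝟙 _ := by
  intro n
  induction n with
  | zero => intro j; rfl
  | succ n ih =>
    intro j
    cases j using Fin.cases with
    | zero => rw [toFront_zero]
    | succ j => rw [toFront_succ, ih, swapFirst_unit]; simp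

lemma permMap_unit : ∀ {n : ℕ} (σ : Equiv.Perm (Fin n)), permMap (𝟙_ C) σ = 𝟙 _ := by
  intro n
  induction n with
  | zero => intro j; rfl
  | succ n ih => intro σ; rw [permMap_succ, ih, toFront_unit]; simp

/-- The tensor power as a representation of the symmetric group in `C`. -/
def tpowAction (X : C) (n : ℕ) : Action C (Equiv.Perm (Fin n)) where
  V := tpow X n
  ρ := 
    { toFun := fun σ => permMap X σ
      map_one' := permMap_one X
      map_mul' := permMap_mul X }

variable (C) in
/-- The (non-additive) tensor power functor to representations of the symmetric group in `C`. -/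
def powerFunctor (n : ℕ) : C ⥤ Action C (Equiv.Perm (Fin n)) where
  obj X := tpowAction X n
  map f := ⟨tpowMap f n, fun σ => (permMap_natural f σ).symm⟩
  map_id X := Action.Hom.ext (tpowMap_id X n)
  map_comp f g := Action.Hom.ext (tpowMap_comp f g n)


lemma powerFunctor_map_hom {X Y : C} (f : X ⟶ Y) (n : ℕ) :
  ((powerFunctor C n).map f).hom = tpowMap f n := rfl

/-- The symmetric monoidal structure of the tensor power functor, given by the shuffles `tpowμ`. -/
noncomputable instance powerFunctorMonoidal (n : ℕ) : (powerFunctor C n).Monoidal :=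
  Functor.CoreMonoidal.toMonoidal
    { εIso := Action.mkIso (tpowε n) (fun σ => by
        change 𝟙 _ ≫ _ = _ ≫ permMap (𝟙_ C) σ
        rw [permMap_unit]; simp)
      μIso := fun X Y => Action.mkIso (tpowμ X Y n) (fun σ => permMap_tpowμ X Y σ)
      μIso_hom_natural_left := fun f X => Action.Hom.ext (by
        have := tpowμ_natural f (𝟙 X) n
        rw [tpowMap_id, tensorHom_id, tensorHom_id] at this
        exact this)
      μIso_hom_natural_right := fun X f => Action.Hom.ext (by
        have := tpowμ_natural (𝟙 X) f n
        rw [tpowMap_id, id_tensorHom, id_tensorHom] at this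
        exact this)
      associativity := fun X Y Z => Action.Hom.ext (by
        simp only [Action.comp_hom, Action.whiskerRight_hom, Action.whiskerLeft_hom,
          Action.associator_hom_hom, powerFunctor_map_hom]
        exact tpowμ_assoc X Y Z n)
      left_unitality := fun X => Action.Hom.ext (by
        simp only [Action.comp_hom, Action.whiskerRight_hom, Action.whiskerLeft_hom,
          Action.leftUnitor_hom_hom, powerFunctor_map_hom]
        exact tpow_left X n)
      right_unitality := fun X => Action.Hom.ext (by
        simp only [Action.comp_hom, Action.whiskerRight_hom, Action.whiskerLeft_hom,
          Action.rightUnitor_hom_hom, powerFunctor_map_hom]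
        exact tpow_right X n) }

noncomputable instance (n : ℕ) : (powerFunctor C n).Braided where
  braided X Y := Action.Hom.ext (tpow_braided X Y n)

end Power

section Action
variable {C : Type w} [Category.{v} C] [MonoidalCategory C] [SymmetricCategory C]


lemma res_map_hom {G H : Type*} [Monoid G] [Monoid H] (f : G →* H) {X Y : Action C H}
    (p : X ⟶ Y) : ((Action.res C f).map p).hom = p.hom := rfl

noncomputable instance resMonoidal {G H : Type*} [Monoid G] [Monoid H] (f : G →* H) :
    (Action.res C f).Monoidal :=
  Functor.CoreMonoidal.toMonoidal
    { εIso := Action.mkIso (Iso.refl (𝟙_ C))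
        (fun g => (Category.comp_id (𝟙 (𝟙_ C))).trans (Category.id_comp (𝟙 (𝟙_ C))).symm)
      μIso := fun X Y => Action.mkIso (Iso.refl (X.V ⊗ Y.V))
        (fun g => (Category.comp_id (X.ρ (f g) ⊗ₘ Y.ρ (f g))).trans (Category.id_comp _).symm)
      μIso_hom_natural_left := fun p X => Action.Hom.ext
        ((Category.comp_id (p.hom ▷ X.V)).trans (Category.id_comp _).symm)
      μIso_hom_natural_right := fun X p => Action.Hom.ext
        ((Category.comp_id (X.V ◁ p.hom)).trans (Category.id_comp _).symm)
      associativity := fun X Y Z => Action.Hom.ext (by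
        simp only [Action.comp_hom, Action.whiskerRight_hom, Action.whiskerLeft_hom,
          Action.associator_hom_hom, res_map_hom]
        change 𝟙 (X.V ⊗ Y.V) ▷ Z.V ≫ 𝟙 ((X.V ⊗ Y.V) ⊗ Z.V) ≫ (α_ X.V Y.V Z.V).hom =
          (α_ X.V Y.V Z.V).hom ≫ X.V ◁ 𝟙 (Y.V ⊗ Z.V) ≫ 𝟙 (X.V ⊗ Y.V ⊗ Z.V)
        simp)
      left_unitality := fun X => Action.Hom.ext (by
        simp only [Action.comp_hom, Action.whiskerRight_hom, Action.leftUnitor_hom_hom, res_map_hom]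
        change (λ_ X.V).hom = 𝟙 (𝟙_ C) ▷ X.V ≫ 𝟙 (𝟙_ C ⊗ X.V) ≫ (λ_ X.V).hom
        simp)
      right_unitality := fun X => Action.Hom.ext (by
        simp only [Action.comp_hom, Action.whiskerLeft_hom, Action.rightUnitor_hom_hom, res_map_hom]
        change (ρ_ X.V).hom = X.V ◁ 𝟙 (𝟙_ C) ≫ 𝟙 (X.V ⊗ 𝟙_ C) ≫ (ρ_ X.V).hom
        simp) }

noncomputable instance resBraided {G H : Type*} [Monoid G] [Monoid H] (f : G →* H) :
    (Action.res C f).Braided where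
  braided X Y := Action.Hom.ext
    ((Category.id_comp (β_ X.V Y.V).hom).trans (Category.comp_id _).symm)

variable (C) in
/-- The functor `X ↦ X ⊠ 1` to representations of `G` in `C`: `X` with trivial action. -/
def trivFunctor (G : Type*) [Monoid G] : C ⥤ Action C G where
  obj X := Action.trivial G X
  map f := ⟨f, fun _ => (Category.id_comp f).trans (Category.comp_id f).symm⟩

noncomputable instance trivMonoidal (G : Type*) [Monoid G] :
    (trivFunctor C G).Monoidal :=
  Functor.CoreMonoidal.toMonoidal
    { εIso := Action.mkIso (Iso.refl (𝟙_ C))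
        (fun g => (Category.comp_id (𝟙 (𝟙_ C))).trans (Category.id_comp (𝟙 (𝟙_ C))).symm)
      μIso := fun X Y => Action.mkIso (Iso.refl (X ⊗ Y)) (fun g => by
        change (𝟙 X ⊗ₘ 𝟙 Y) ≫ 𝟙 (X ⊗ Y) = 𝟙 (X ⊗ Y) ≫ 𝟙 (X ⊗ Y)
        simp)
      μIso_hom_natural_left := fun p X => Action.Hom.ext
        ((Category.comp_id (p ▷ X)).trans (Category.id_comp _).symm)
      μIso_hom_natural_right := fun X p => Action.Hom.ext
        ((Category.comp_id (X ◁ p)).trans (Category.id_comp _).symm)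
      associativity := fun X Y Z => Action.Hom.ext (by
        simp only [Action.comp_hom, Action.whiskerRight_hom, Action.whiskerLeft_hom,
          Action.associator_hom_hom]
        change 𝟙 (X ⊗ Y) ▷ Z ≫ 𝟙 ((X ⊗ Y) ⊗ Z) ≫ (α_ X Y Z).hom =
          (α_ X Y Z).hom ≫ X ◁ 𝟙 (Y ⊗ Z) ≫ 𝟙 (X ⊗ Y ⊗ Z)
        simp)
      left_unitality := fun X => Action.Hom.ext (by
        simp only [Action.comp_hom, Action.whiskerRight_hom, Action.leftUnitor_hom_hom]
        change (λ_ X).hom = 𝟙 (𝟙_ C) ▷ X ≫ 𝟙 (𝟙_ C ⊗ X) ≫ (λ_ X).hom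
        simp)
      right_unitality := fun X => Action.Hom.ext (by
        simp only [Action.comp_hom, Action.whiskerLeft_hom, Action.rightUnitor_hom_hom]
        change (ρ_ X).hom = X ◁ 𝟙 (𝟙_ C) ≫ 𝟙 (X ⊗ 𝟙_ C) ≫ (ρ_ X).hom
        simp) }

end Action

section Unit
variable {k : Type u} [Field k] (D : Type w) [Category.{v} D] [Preadditive D] [Linear k D]
  [MonoidalCategory D] [HasFiniteBiproducts D] [MonoidalPreadditive D] [MonoidalLinear k D]

/-- The object `W ⊗ 𝟙` of `D` for a finite-dimensional vector space `W`: a sum of `dim W` copies of `𝟙`. -/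
noncomputable def unitObj (k : Type u) [Field k] (W : Type u) [AddCommGroup W] [Module k W] : D :=
  ⨁ fun _ : Fin (Module.finrank k W) => 𝟙_ D

variable {W W' W'' : Type u} [AddCommGroup W] [Module k W] [Module.Finite k W]
  [AddCommGroup W'] [Module k W'] [Module.Finite k W']
  [AddCommGroup W''] [Module k W''] [Module.Finite k W'']

variable (k W) in
/-- The inclusion of a summand. -/
noncomputable def unitι (i : Fin (Module.finrank k W)) : 𝟙_ D ⟶ unitObj D k W :=
  biproduct.ι (fun _ => 𝟙_ D) i

variable (k W) in
/-- The projection to a summand. -/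
noncomputable def unitπ (i : Fin (Module.finrank k W)) : unitObj D k W ⟶ 𝟙_ D :=
  biproduct.π (fun _ => 𝟙_ D) i

/-- The element `w` of `W` as a morphism from the unit to `W ⊗ 𝟙`. -/
noncomputable def elt : W →ₗ[k] (𝟙_ D ⟶ unitObj D k W) :=
  (Module.finBasis k W).constr k fun i => unitι k D W i

/-- The morphism `W ⊗ 𝟙 ⟶ X` determined by a linear map `W → Hom(𝟙, X)`. -/
noncomputable def eltDesc (X : D) (φ : W →ₗ[k] (𝟙_ D ⟶ X)) : unitObj D k W ⟶ X :=
  biproduct.desc fun i => φ (Module.finBasis k W i)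

variable {D}

lemma unitι_unitπ (i j : Fin (Module.finrank k W)) :
    unitι k D W i ≫ unitπ k D W j = if i = j then 𝟙 _ else 0 := by
  refine (biproduct.ι_π _ i j).trans ?_
  split_ifs with h
  · subst h; rfl
  · rfl

lemma sum_unitπ_unitι : ∑ i, unitπ k D W i ≫ unitι k D W i = 𝟙 _ :=
  biproduct.total

lemma elt_basis (i) : elt D (Module.finBasis k W i) = unitι k D W i :=
  (Module.finBasis k W).constr_basis k _ i

lemma unitι_eltDesc {X : D} (φ : W →ₗ[k] (𝟙_ D ⟶ X)) (i) :
    unitι k D W i ≫ eltDesc D X φ = φ (Module.finBasis k W i) :=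
  biproduct.ι_desc _ _

lemma elt_eltDesc {X : D} (φ : W →ₗ[k] (𝟙_ D ⟶ X)) (x : W) : elt D x ≫ eltDesc D X φ = φ x := by
  have : (Linear.rightComp k (𝟙_ D) (eltDesc D X φ)) ∘ₗ elt D = φ := by
    refine (Module.finBasis k W).ext fun i => ?_
    simp only [LinearMap.comp_apply, Linear.rightComp_apply, elt_basis, unitι_eltDesc]
  exact LinearMap.congr_fun this x

lemma unit_ext {X : D} {f g : unitObj D k W ⟶ X} (h : ∀ x : W, elt D x ≫ f = elt D x ≫ g) :
    f = g := by
  rw [← Category.id_comp f, ← Category.id_comp g, ← sum_unitπ_unitι, Preadditive.sum_comp,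
    Preadditive.sum_comp]
  refine Finset.sum_congr rfl fun i _ => ?_
  rw [Category.assoc, Category.assoc, ← elt_basis, h]

lemma unit_ext_left (A : D) {X : D} {f g : A ⊗ unitObj D k W ⟶ X}
    (h : ∀ x : W, A ◁ elt D x ≫ f = A ◁ elt D x ≫ g) : f = g := by
  rw [← Category.id_comp f, ← Category.id_comp g, ← whiskerLeft_id, ← sum_unitπ_unitι,
    whiskerLeft_sum, Preadditive.sum_comp, Preadditive.sum_comp]
  refine Finset.sum_congr rfl fun i _ => ?_
  rw [whiskerLeft_comp, Category.assoc, Category.assoc, ← elt_basis, h]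

lemma unit_ext_right (A : D) {X : D} {f g : unitObj D k W ⊗ A ⟶ X}
    (h : ∀ x : W, elt D x ▷ A ≫ f = elt D x ▷ A ≫ g) : f = g := by
  rw [← Category.id_comp f, ← Category.id_comp g, ← id_whiskerRight, ← sum_unitπ_unitι,
    sum_whiskerRight, Preadditive.sum_comp, Preadditive.sum_comp]
  refine Finset.sum_congr rfl fun i _ => ?_
  rw [comp_whiskerRight, Category.assoc, Category.assoc, ← elt_basis, h]

lemma unit_ext₂ {X : D} {f g : unitObj D k W ⊗ unitObj D k W' ⟶ X}
    (h : ∀ (x : W) (y : W'), (elt D x ⊗ₘ elt D y) ≫ f = (elt D x ⊗ₘ elt D y) ≫ g) : f = g := by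
  refine unit_ext_left _ fun y => unit_ext_right _ fun x => ?_
  simpa [MonoidalCategory.tensorHom_def] using h x y

lemma unit_ext₃ {X : D} {f g : (unitObj D k W ⊗ unitObj D k W') ⊗ unitObj D k W'' ⟶ X}
    (h : ∀ (x : W) (y : W') (z : W''), ((elt (k := k) D x ⊗ₘ elt (k := k) D y) ⊗ₘ elt (k := k) D z) ≫ f =
      ((elt (k := k) D x ⊗ₘ elt (k := k) D y) ⊗ₘ elt (k := k) D z) ≫ g) : f = g := by
  refine unit_ext_left (k := k) (W := W'') _ fun z => (cancel_epi (ρ_ _).inv).1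
    (unit_ext₂ (k := k) fun x y => ?_)
  have e : (elt (k := k) D x ⊗ₘ elt (k := k) D y) ≫ (ρ_ (unitObj D k W ⊗ unitObj D k W')).inv ≫
      (unitObj D k W ⊗ unitObj D k W') ◁ elt (k := k) D z =
      (ρ_ _).inv ≫ ((elt (k := k) D x ⊗ₘ elt (k := k) D y) ⊗ₘ elt (k := k) D z) := by
    rw [rightUnitor_inv_naturality_assoc, ← tensorHom_id]
    simp only [← id_tensorHom, tensorHom_comp_tensorHom, Category.comp_id, Category.id_comp]
  rw [reassoc_of% e, reassoc_of% e, h]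

open scoped TensorProduct

/-- The morphism `𝟙 ⟶ (W ⊗ 𝟙) ⊗ (W' ⊗ 𝟙)` given by a tensor in `W ⊗ W'`. -/
noncomputable def eltTensor : W ⊗[k] W' →ₗ[k] (𝟙_ D ⟶ unitObj D k W ⊗ unitObj D k W') :=
  TensorProduct.lift (LinearMap.mk₂ k (fun x y => (λ_ (𝟙_ D)).inv ≫ (elt D x ⊗ₘ elt D y))
    (by simp [MonoidalPreadditive.add_tensor]) (by simp [MonoidalCategory.tensorHom_def])
    (by simp [MonoidalPreadditive.tensor_add]) (by simp [MonoidalCategory.tensorHom_def]))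

/-- The inverse of the comparison morphism `unitμ`. -/
noncomputable def unitδ : unitObj D k (W ⊗[k] W') ⟶ unitObj D k W ⊗ unitObj D k W' :=
  eltDesc D _ eltTensor

lemma elt_unitδ (x : W) (y : W') : elt D (x ⊗ₜ[k] y) ≫ unitδ =
    (λ_ (𝟙_ D)).inv ≫ (elt D x ⊗ₘ elt D y) := by
  rw [unitδ, elt_eltDesc]; rfl


/-- The comparison `(W ⊗ 𝟙) ⊗ (W' ⊗ 𝟙) ⟶ (W ⊗ W') ⊗ 𝟙`, which sends `x ⊗ y` to `x ⊗ y`. -/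
noncomputable def unitμ : unitObj D k W ⊗ unitObj D k W' ⟶ unitObj D k (W ⊗[k] W') :=
  ∑ i, ∑ j, (unitπ k D W i ⊗ₘ unitπ k D W' j) ≫ (λ_ (𝟙_ D)).hom ≫
    elt D (Module.finBasis k W i ⊗ₜ[k] Module.finBasis k W' j)

lemma elt_unitπ (x : W) (i : Fin (Module.finrank k W)) :
    elt D x ≫ unitπ k D W i = (Module.finBasis k W).repr x i • 𝟙 (𝟙_ D) := by
  conv_lhs => rw [← (Module.finBasis k W).sum_repr x]
  simp only [map_sum, map_smul, elt_basis, Preadditive.sum_comp, Linear.smul_comp, unitι_unitπ]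
  simp

lemma elt_unitμ (x : W) (y : W') : (elt D x ⊗ₘ elt D y) ≫ unitμ =
    (λ_ (𝟙_ D)).hom ≫ elt D (x ⊗ₜ[k] y) := by
  have h : x ⊗ₜ[k] y = ∑ i, ∑ j, (Module.finBasis k W).repr x i •
      (Module.finBasis k W').repr y j • (Module.finBasis k W i ⊗ₜ[k] Module.finBasis k W' j) := by
    conv_lhs => rw [← (Module.finBasis k W).sum_repr x, ← (Module.finBasis k W').sum_repr y]
    rw [TensorProduct.sum_tmul]
    refine Finset.sum_congr rfl fun i _ => ?_
    rw [TensorProduct.tmul_sum]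
    refine Finset.sum_congr rfl fun j _ => ?_
    rw [TensorProduct.tmul_smul, ← TensorProduct.smul_tmul', smul_comm]
  have h2 (a b : k) : (a • 𝟙 (𝟙_ D) ⊗ₘ b • 𝟙 (𝟙_ D)) = a • b • 𝟙 (𝟙_ D ⊗ 𝟙_ D) := by
    simp [MonoidalCategory.tensorHom_def, smul_comm a b]
  rw [h]
  simp only [unitμ, Preadditive.comp_sum, tensorHom_comp_tensorHom_assoc, elt_unitπ, map_sum,
    map_smul, h2, Linear.smul_comp, Linear.comp_smul, Category.id_comp]

lemma unitμ_unitδ : unitμ ≫ unitδ = 𝟙 (unitObj D k W ⊗ unitObj D k W') := by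
  refine unit_ext₂ fun x y => ?_
  rw [reassoc_of% elt_unitμ, elt_unitδ]
  simp

lemma unitδ_unitμ : unitδ ≫ unitμ = 𝟙 (unitObj D k (W ⊗[k] W')) := by
  refine unit_ext fun z => ?_
  induction z with
  | zero => simp
  | add x y hx hy => rw [map_add, Preadditive.add_comp, hx, hy, Preadditive.add_comp]
  | tmul x y => rw [reassoc_of% elt_unitδ, elt_unitμ]; simp

/-- The morphism `f ⊗ 𝟙`. -/
noncomputable def unitMap (f : W →ₗ[k] W') : unitObj D k W ⟶ unitObj D k W' :=
  eltDesc D _ (elt D ∘ₗ f)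

lemma elt_unitMap (f : W →ₗ[k] W') (x : W) : elt D x ≫ unitMap f = elt D (f x) := by
  rw [unitMap, elt_eltDesc]; rfl

variable (D) in
/-- The scalar endomorphisms of the unit. -/
noncomputable def unitScalar : k →ₗ[k] (𝟙_ D ⟶ 𝟙_ D) := LinearMap.toSpanSingleton k _ (𝟙 _)

/-- The isomorphism `𝟙 ≅ k ⊗ 𝟙`. -/
noncomputable def unitε : 𝟙_ D ≅ unitObj D k k where
  hom := elt (k := k) D (1 : k)
  inv := eltDesc D _ (unitScalar D)
  hom_inv_id := by rw [elt_eltDesc]; simp [unitScalar]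
  inv_hom_id := unit_ext fun c => by
    rw [← Category.assoc, elt_eltDesc]
    simp [unitScalar, ← map_smul]

variable (D) in
/-- The canonical linear symmetric monoidal functor `W ↦ W ⊗ 𝟙` from finite-dimensional vector spaces to `D`. -/
noncomputable def unitFunctor (k : Type u) [Field k] [Linear k D] [MonoidalLinear k D] :
    FGModuleCat.{u} k ⥤ D where
  obj W := unitObj D k W
  map f := unitMap f.hom.hom
  map_id W := unit_ext fun x => by
    rw [elt_unitMap]; simp
  map_comp f g := unit_ext fun x => by
    rw [elt_unitMap, ← Category.assoc, elt_unitMap, elt_unitMap]; simp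

lemma unitμ_natural_left (f : W →ₗ[k] W') : unitMap f ▷ unitObj D k W'' ≫ unitμ =
    unitμ ≫ unitMap (f.rTensor W'') := unit_ext₂ fun x y => by
  rw [tensorHom_comp_whiskerRight_assoc, elt_unitMap, elt_unitμ, reassoc_of% elt_unitμ,
    elt_unitMap, LinearMap.rTensor_tmul]

lemma unitμ_natural_right (f : W →ₗ[k] W') : unitObj D k W'' ◁ unitMap f ≫ unitμ =
    unitμ ≫ unitMap (f.lTensor W'') := unit_ext₂ fun x y => by
  rw [tensorHom_comp_whiskerLeft_assoc, elt_unitMap, elt_unitμ, reassoc_of% elt_unitμ,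
    elt_unitMap, LinearMap.lTensor_tmul]

lemma unitμ_assoc : unitμ ▷ unitObj D k W'' ≫ unitμ ≫
      unitMap (TensorProduct.assoc k W W' W'').toLinearMap =
    (α_ _ _ _).hom ≫ unitObj D k W ◁ unitμ ≫ unitμ := unit_ext₃ (k := k) fun x y z => by
  rw [tensorHom_comp_whiskerRight_assoc, elt_unitμ, associator_naturality_assoc,
    tensorHom_comp_whiskerLeft_assoc, elt_unitμ, ← whiskerRight_comp_tensorHom_assoc,
    ← whiskerLeft_comp_tensorHom_assoc, reassoc_of% elt_unitμ, elt_unitμ, elt_unitMap,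
    LinearEquiv.coe_coe, TensorProduct.assoc_tmul]
  simp only [← Category.assoc]
  congr 1
  monoidal

lemma unitμ_left : (λ_ (unitObj D k W)).hom = elt (k := k) D (1 : k) ▷ _ ≫ unitμ ≫
    unitMap (TensorProduct.lid k W).toLinearMap := by
  rw [← cancel_epi (λ_ _).inv]
  refine unit_ext fun x => ?_
  have e : elt D x ≫ (λ_ _).inv ≫ elt (k := k) D (1 : k) ▷ unitObj D k W =
    (λ_ _).inv ≫ (elt (k := k) D (1 : k) ⊗ₘ elt D x) := by
    rw [MonoidalCategory.tensorHom_def', leftUnitor_inv_naturality_assoc]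
  rw [reassoc_of% e, reassoc_of% elt_unitμ, elt_unitMap]
  simp

lemma unitμ_right : (ρ_ (unitObj D k W)).hom = _ ◁ elt (k := k) D (1 : k) ≫ unitμ ≫
    unitMap (TensorProduct.rid k W).toLinearMap := by
  rw [← cancel_epi (ρ_ _).inv]
  refine unit_ext fun x => ?_
  have e : elt D x ≫ (ρ_ _).inv ≫ unitObj D k W ◁ elt (k := k) D (1 : k) =
    (ρ_ _).inv ≫ (elt D x ⊗ₘ elt (k := k) D (1 : k)) := by
    rw [MonoidalCategory.tensorHom_def, rightUnitor_inv_naturality_assoc]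
  rw [reassoc_of% e, reassoc_of% elt_unitμ, elt_unitMap, unitors_equal]
  simp

noncomputable instance : (unitFunctor D k).Monoidal :=
  Functor.CoreMonoidal.toMonoidal
    { εIso := unitε
      μIso := fun _ _ => ⟨unitμ, unitδ, unitμ_unitδ, unitδ_unitμ⟩
      μIso_hom_natural_left := fun f _ => unitμ_natural_left f.hom.hom
      μIso_hom_natural_right := fun _ f => unitμ_natural_right f.hom.hom
      associativity := fun _ _ _ => unitμ_assoc
      left_unitality := fun _ => unitμ_left
      right_unitality := fun _ => unitμ_right }

end Unit

section TensorCategories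

/-- A (symmetric) tensor category over `k`: a `k`-linear abelian symmetric monoidal category with
bilinear tensor product, essentially small, with objects of finite length, with `k = End(𝟙)`, in
which every object has a dual. -/
structure TensorCat (k : Type u) [Field k] where
  carrier : Type (u + 1)
  [category : Category.{u} carrier]
  [abelian : Abelian carrier]
  [linear : Linear k carrier]
  [monoidal : MonoidalCategory carrier]
  [symmetric : SymmetricCategory carrier]
  [monoidalPreadditive : MonoidalPreadditive carrier]
  [monoidalLinear : MonoidalLinear k carrier]
  [essentiallySmall : EssentiallySmall.{u} carrier]
  isNoetherianObject : ∀ X : carrier, IsNoetherianObject X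
  isArtinianObject : ∀ X : carrier, IsArtinianObject X
  bijective_unit : Function.Bijective fun c : k => c • 𝟙 (𝟙_ carrier)
  exists_dual : ∀ X : carrier, ∃ Y : carrier, Nonempty (ExactPairing X Y)

attribute [instance] TensorCat.category TensorCat.abelian TensorCat.linear TensorCat.monoidal
  TensorCat.symmetric TensorCat.monoidalPreadditive TensorCat.monoidalLinear
  TensorCat.essentiallySmall

variable {k : Type u} [Field k]

instance : CoeSort (TensorCat k) (Type (u + 1)) := ⟨TensorCat.carrier⟩

instance (C : TensorCat k) : HasFiniteBiproducts C := Abelian.hasFiniteBiproducts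

/-- `F` is additive and `φ`-linear on morphisms. -/
structure IsSemilinear {C : Type*} [Category* C] [Preadditive C] [Linear k C]
    {D : Type*} [Category* D] [Preadditive D] [Linear k D] (φ : k →+* k) (F : C ⥤ D) : Prop where
  map_add : ∀ {X Y : C} (f g : X ⟶ Y), F.map (f + g) = F.map f + F.map g
  map_smul : ∀ {X Y : C} (c : k) (f : X ⟶ Y), F.map (c • f) = φ c • F.map f

variable (k) in
/-- `F` is `k`-linear and right exact. -/
structure IsLinearRightExact {C : Type*} [Category* C] [Preadditive C] [Linear k C]
    {D : Type*} [Category* D] [Preadditive D] [Linear k D] (F : C ⥤ D) : Prop where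
  linear : IsSemilinear (RingHom.id k) F
  preservesFiniteColimits : PreservesFiniteColimits F

/-- A symmetric monoidal functor between tensor categories is a tensor functor if it is `k`-linear
and exact. -/
structure IsTensorFunctor {C D : TensorCat k} (F : C ⥤ D) [F.Braided] : Prop where
  linear : IsSemilinear (RingHom.id k) F
  preservesFiniteLimits : PreservesFiniteLimits F
  preservesFiniteColimits : PreservesFiniteColimits F

/-- The monoidal functors `F` and `G` are isomorphic by a monoidal natural isomorphism. -/
def MonoidalIso {C : Type*} [Category* C] [MonoidalCategory C] {D : Type*} [Category* D]
    [MonoidalCategory D] (F G : C ⥤ D) [F.Monoidal] [G.Monoidal] : Prop :=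
  ∃ e : F ≅ G, NatTrans.IsMonoidal e.hom

end TensorCategories

section Deligne
variable {k : Type u} [Field k]

variable (k) in
/-- A bifunctor that is `k`-linear and right exact in each variable. -/
structure IsBilinearRightExact {A B E : Type*} [Category* A] [Preadditive A] [Linear k A]
    [Category* B] [Preadditive B] [Linear k B] [Category* E] [Preadditive E] [Linear k E]
    (Ψ : A ⥤ B ⥤ E) : Prop where
  left : ∀ Y : B, IsLinearRightExact k (Ψ.flip.obj Y)
  right : ∀ X : A, IsLinearRightExact k (Ψ.obj X)

/-- The bifunctor `(X, Y) ↦ F X ⊗ G Y`. -/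
abbrev externalTensor {A B W : Type*} [Category* A] [Category* B] [Category* W]
    [MonoidalCategory W] (F : A ⥤ W) (G : B ⥤ W) : A ⥤ B ⥤ W :=
  F ⋙ curriedTensor W ⋙ (Functor.whiskeringLeft B W W).obj G

variable (k) in
/-- The universal property of the Deligne product of `k`-linear abelian categories: `Ω` is bilinear
and right exact in each variable and, for every `k`-linear abelian category `E`, restriction along
`Ω` is an equivalence (essentially surjective and fully faithful) from the category of right exact
`k`-linear functors `W ⥤ E` to that of bilinear bifunctors `A × B → E` that are right exact in
each variable. -/
structure IsDeligneProduct {A B W : Type (u + 1)} [Category.{u} A] [Preadditive A] [Linear k A]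
    [Category.{u} B] [Preadditive B] [Linear k B] [Category.{u} W] [Preadditive W] [Linear k W]
    (Ω : A ⥤ B ⥤ W) : Prop where
  isBilinearRightExact : IsBilinearRightExact k Ω
  exists_factor : ∀ (E : Type (u + 1)) [Category.{u} E] [Abelian E] [Linear k E]
    (Ψ : A ⥤ B ⥤ E), IsBilinearRightExact k Ψ →
      ∃ H : W ⥤ E, IsLinearRightExact k H ∧
        Nonempty (Ω ⋙ (Functor.whiskeringRight B W E).obj H ≅ Ψ)
  bijective_whisker : ∀ (E : Type (u + 1)) [Category.{u} E] [Abelian E] [Linear k E]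
    (H H' : W ⥤ E), IsLinearRightExact k H → IsLinearRightExact k H' →
      Function.Bijective fun η : H ⟶ H' =>
        Functor.whiskerLeft Ω ((Functor.whiskeringRight B W E).map η)

/-- A Deligne product `A ⊠ B` of tensor categories: a tensor category with tensor functors
`inl = (- ⊠ 𝟙)` and `inr = (𝟙 ⊠ -)`, such that `X ⊠ Y := (X ⊠ 𝟙) ⊗ (𝟙 ⊠ Y)` makes the underlying
category the Deligne product of the underlying abelian categories. -/
structure DeligneProduct (A B : TensorCat k) where
  cat : TensorCat k
  inl : A ⥤ cat
  inr : B ⥤ cat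
  [braided_inl : inl.Braided]
  [braided_inr : inr.Braided]
  isTensorFunctor_inl : IsTensorFunctor inl
  isTensorFunctor_inr : IsTensorFunctor inr
  isDeligneProduct : IsDeligneProduct k (externalTensor inl inr)

attribute [instance] DeligneProduct.braided_inl DeligneProduct.braided_inr

/-- `F ⊠ V : C ⊠ V ⥤ D ⊠ V` for a tensor functor `F`: the tensor functor whose restrictions along
`- ⊠ 𝟙` and `𝟙 ⊠ -` are `F ⊠ 𝟙` and `𝟙 ⊠ -`. -/
structure IsBoxOfTensorFunctor {C D V : TensorCat k} (P : DeligneProduct C V)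
    (Q : DeligneProduct D V) (F : C ⥤ D) [F.Braided] (S : P.cat ⥤ Q.cat) [S.Braided] :
    Prop where
  isTensorFunctor : IsTensorFunctor S
  restrict_left : MonoidalIso (P.inl ⋙ S) (F ⋙ Q.inl)
  restrict_right : MonoidalIso (P.inr ⋙ S) Q.inr

end Deligne

section VFunctors
variable {k : Type u} [Field k]

instance finite_ind {G : Type} [Group G] [Finite G] (H : Subgroup G) :
    Module.Finite k (Representation.IndV H.subtype (Representation.trivial k H k)) := by
  have : Module.Finite k (MonoidAlgebra k G) :=
    Module.Finite.equiv (MonoidAlgebra.coeffLinearEquiv k).symm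
  exact Module.Finite.of_surjective (Representation.Coinvariants.mk _)
    (Representation.Coinvariants.mk_surjective _)

variable (k) in
/-- The representation of `G` induced from the trivial representation of `H`. -/
noncomputable def indTrivial {G : Type} [Group G] [Finite G] (H : Subgroup G) : FDRep k G :=
  FDRep.of (Representation.ind H.subtype (Representation.trivial k H k))

/-- A linear symmetric monoidal functor on the representations of a permutation group
`G < Perm W`, with values in a tensor category, is a `V`-functor if it kills
the module induced from the trivial representation of each non-transitive subgroup. -/
structure IsVFunctor {W : Type} [Finite W] (G : Subgroup (Equiv.Perm W)) {V : TensorCat k}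
    (Θ : FDRep k G ⥤ V) [Θ.Braided] : Prop where
  linear : IsSemilinear (RingHom.id k) Θ
  isZero_obj : ∀ H : Subgroup G, ¬ MulAction.IsPretransitive H W → IsZero (Θ.obj (indTrivial k H))

/-- The functor `U ↦ 𝟙 ⊠ U` from representations of `G` to representations of `G` in `C`. -/
noncomputable abbrev unitRep (C : TensorCat k) (G : Type) [Group G] : FDRep k G ⥤ Action C G :=
  (unitFunctor C k).mapAction G

/-- `C ⊠ Θ : C ⊠ Rep G ⥤ C ⊠ V` for a linear symmetric monoidal functor `Θ : Rep G ⥤ V`, where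
`C ⊠ Rep G` is the category of representations of `G` in `C`: the linear symmetric monoidal
functor whose restrictions along `- ⊠ 𝟙` and `𝟙 ⊠ -` are `- ⊠ 𝟙` and `𝟙 ⊠ Θ`. -/
structure IsBoxOfLSMFunctor {C V : TensorCat k} {G : Type} [Group G] (Θ : FDRep k G ⥤ V)
    [Θ.Braided] (P : DeligneProduct C V) (T : Action C G ⥤ P.cat) [T.Braided] : Prop where
  linear : IsSemilinear (RingHom.id k) T
  restrict_left : MonoidalIso (trivFunctor C G ⋙ T) P.inl
  restrict_right : MonoidalIso (unitRep C G ⋙ T) (Θ ⋙ P.inr)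

end VFunctors

section OFunctors
variable {k : Type u} [Field k]

/-- The family of symmetric monoidal functors `Φ C : C ⥤ C ⊠ V`, for all tensor categories `C`,
is an `Oⁱ{V}`-functor: every `Φ C` is additive and `Frobⁱ`-linear, and the square formed by `Φ C`,
`Φ D`, `F` and `F ⊠ V` commutes up to monoidal isomorphism for every tensor functor `F : C ⥤ D`. -/
structure IsOFunctor (p i : ℕ) [ExpChar k p] {V : TensorCat k}
    (box : ∀ C : TensorCat k, DeligneProduct C V) (Φ : ∀ C : TensorCat k, C ⥤ (box C).cat)
    [∀ C, (Φ C).Braided] : Prop where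
  semilinear : ∀ C : TensorCat k, IsSemilinear (iterateFrobenius k p i) (Φ C)
  natural : ∀ (C D : TensorCat k) (F : C ⥤ D) [F.Braided], IsTensorFunctor F →
    ∀ (S : (box C).cat ⥤ (box D).cat) [S.Braided],
      IsBoxOfTensorFunctor (box C) (box D) F S → MonoidalIso (Φ C ⋙ S) (F ⋙ Φ D)

/-- The composite of `X ↦ X^{⊗ n}`, of the restriction from the symmetric group to `G`, and
of a functor `T` on representations of `G` in `C`. -/
abbrev powerComposite {C : TensorCat k} {n : ℕ} (G : Subgroup (Equiv.Perm (Fin n)))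
    {E : TensorCat k} (T : Action C G ⥤ E) : C ⥤ E :=
  powerFunctor C n ⋙ Action.res C G.subtype ⋙ T

end OFunctors

end OFun

set_option linter.unusedSectionVars false
set_option linter.unusedVariables false

/-! Additivity. Put n = p^i and expand (f + g)^{⊗n} into mixed tensor products of f and g, indexed
by the 2-colourings S of the n positions. G permutes the colourings, and the sum over one orbit is a
G-equivariant morphism X^{⊗n} ⟶ Y^{⊗n}. If H is the stabilizer of S, this orbit sum is a relative
trace from H to G, so it factors through X^{⊗n} ⊗ Ind_H^G 𝟙 (`map_orbitSum`). A colouring that uses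
both colours has an intransitive stabilizer, so Θ kills Ind_H^G 𝟙 and C ⊠ Θ kills the orbit sum. The
two constant colourings remain and give f^{⊗n} + g^{⊗n} (`powerComposite_semilinear`). A scalar c
comes out of the n-th power as c^{p^i}.

Naturality. Tensor powers and restriction to G commute with F, so two functors on G-representations
in C have to be compared: (C ⊠ Θ) followed by F ⊠ V, and F on representations followed by D ⊠ Θ.
They agree on C and on Rep G, hence on the objects Y ⊠ U. Since Θ need not be exact, the comparison
cannot be extended to other objects by presentations. Instead, `exists_refinement` provides for
every M an epimorphism ε : W ⟶ 𝟙 in C such that ε ⊗ M : W ⊗ M ⟶ M factors through some Y ⊠ U. Both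
functors preserve epimorphisms coming from C, so ε stays epi, and this is enough to descend the
comparison from Y ⊠ U to M (`exists_extension_app`). The result is determined by its values on the
objects Y ⊠ U, which makes it natural, monoidal and invertible (`exists_extension`,
`MonoidalIso.of_restrict`).

The refinement comes from the coevaluation 𝟙 ⟶ M ⊗ D of a dual D of M, which is G-invariant. An
element φ of Hom(X, X') ⊗ Hom(N, N') is a formal morphism X ⊠ N ⟶ X' ⊠ N'. By `hasExtKernel`,
whatever its realization X ⊗ N ⟶ X' ⊗ N' kills lifts, after an epimorphism, to a formal ψ with ψφ =
0; this expresses the exactness of C ⊠ C ⟶ C. Applied to the equations that express invariance, it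
gives ψ in Hom(Y, M) ⊗ Hom(N, D) with the same invariance, and U = Hom(Y, M) serves. That U is
finite-dimensional rests on the simplicity of 𝟙. -/

namespace OFun

/-! ### Tensor products of different morphisms and the binomial expansion. -/

section Mixed
variable {C : Type w} [Category.{v} C] [MonoidalCategory C]

/-- The morphism `f 0 ⊗ ⋯ ⊗ f (n - 1)` of tensor powers. -/
def mixMap {X Y : C} : {n : ℕ} → (Fin n → (X ⟶ Y)) → (tpow X n ⟶ tpow Y n)
  | 0, _ => 𝟙 _
  | _ + 1, f => f 0 ⊗ₘ mixMap fun i => f i.succ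

lemma mixMap_succ {X Y : C} {n : ℕ} (f : Fin (n + 1) → (X ⟶ Y)) :
    mixMap f = f 0 ⊗ₘ mixMap fun i => f i.succ := rfl

lemma mixMap_const {X Y : C} (f : X ⟶ Y) (n : ℕ) : mixMap (fun _ : Fin n => f) = tpowMap f n := by
  induction n with
  | zero => rfl
  | succ n ih => rw [mixMap_succ, ih]; rfl

section Braided
variable [SymmetricCategory C]

lemma swapFirst_naturality {X Y Z W : C} (f g : X ⟶ Y) (h : Z ⟶ W) :
    (f ⊗ₘ g ⊗ₘ h) ≫ swapFirst Y W = swapFirst X Z ≫ (g ⊗ₘ f ⊗ₘ h) := by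
  have e : ((f ⊗ₘ g) ⊗ₘ h) ≫ (β_ Y Y).hom ▷ W = (β_ X X).hom ▷ Z ≫ ((g ⊗ₘ f) ⊗ₘ h) := by
    rw [tensorHom_comp_whiskerRight, BraidedCategory.braiding_naturality,
      whiskerRight_comp_tensorHom]
  simp only [swapFirst, Category.assoc]
  rw [associator_inv_naturality_assoc, reassoc_of% e, associator_naturality]

lemma mixMap_toFront {X Y : C} : ∀ {n : ℕ} (f : Fin (n + 1) → (X ⟶ Y)) (j : Fin (n + 1)),
    mixMap f ≫ toFront Y j = toFront X j ≫ (f j ⊗ₘ mixMap fun i => f (j.succAbove i)) := by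
  intro n
  induction n with
  | zero =>
    intro f j
    obtain rfl : j = 0 := Fin.fin_one_eq_zero j
    simp [toFront, mixMap]
  | succ n ih =>
    intro f j
    cases j using Fin.cases with
    | zero => simp [toFront_zero, mixMap_succ]
    | succ j =>
      have h1 : mixMap f ≫ Y ◁ toFront Y j = X ◁ toFront X j ≫
          (f 0 ⊗ₘ f j.succ ⊗ₘ mixMap fun i => f (j.succAbove i).succ) := by
        rw [mixMap_succ, tensorHom_comp_whiskerLeft, ih, whiskerLeft_comp_tensorHom]
      have h2 := swapFirst_naturality (f 0) (f j.succ) (mixMap fun i => f (j.succAbove i).succ)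
      rw [toFront_succ, toFront_succ, reassoc_of% h1, h2, Category.assoc, mixMap_succ]
      simp

/-- The permutation action on tensor powers permutes the factors of a tensor product of morphisms. -/
lemma mixMap_permMap {X Y : C} : ∀ {n : ℕ} (f : Fin n → (X ⟶ Y)) (σ : Equiv.Perm (Fin n)),
    mixMap (fun i => f (σ i)) ≫ permMap Y σ = permMap X σ ≫ mixMap f := by
  intro n
  induction n with
  | zero => intro f σ; simp [permMap, mixMap]
  | succ n ih =>
    intro f σ
    rw [permMap_succ, permMap_succ, reassoc_of% mixMap_toFront, Category.assoc,
      tensorHom_comp_whiskerLeft, mixMap_succ, whiskerLeft_comp_tensorHom, ← ih]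
    congr 3
    · simp
    · congr 1
      ext i
      rw [← removeAt_apply]
      simp

end Braided

variable [Preadditive C] [MonoidalPreadditive C]

/-- The functions `S` are the 2-colourings of the positions; `true` marks a factor f and `false` a
factor g. -/
lemma mixMap_add {X Y : C} (f g : X ⟶ Y) : ∀ n : ℕ, tpowMap (f + g) n =
    ∑ S : Fin n → Bool, mixMap fun i => if S i then f else g := by
  intro n
  induction n with
  | zero => simp [mixMap, tpowMap]
  | succ n ih =>
    rw [← (Fin.consEquiv fun _ => Bool).sum_comp, Fintype.sum_prod_type]
    simp [tpowMap, ih, mixMap_succ, Fin.consEquiv, MonoidalPreadditive.add_tensor, tensor_sum,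
      Finset.sum_add_distrib]

lemma tpowMap_smul {k : Type*} [CommRing k] [Linear k C] [MonoidalLinear k C] {X Y : C} (c : k)
    (f : X ⟶ Y) (n : ℕ) : tpowMap (c • f) n = c ^ n • tpowMap f n := by
  induction n with
  | zero => simp [tpowMap]
  | succ n ih =>
    simp [tpowMap, ih, MonoidalCategory.tensorHom_def, smul_smul, pow_succ', mul_comm]

end Mixed

/-! ### Orbit sums factor through induced representations. -/

section Vanishing
variable {k : Type u} [Field k] {C : Type w} [Category.{v} C] [Preadditive C] [Linear k C]
  [MonoidalCategory C] [HasFiniteBiproducts C] [MonoidalPreadditive C] [MonoidalLinear k C]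
  {W : Type u} [AddCommGroup W] [Module k W] [Module.Finite k W]

/-- The morphism `A ⊗ (W ⊗ 𝟙) ⟶ B` determined by a linear map `W → Hom(A, B)`. -/
noncomputable def unitPairing {A B : C} (φ : W →ₗ[k] (A ⟶ B)) : A ⊗ unitObj C k W ⟶ B :=
  ∑ i, A ◁ unitπ k C W i ≫ (ρ_ A).hom ≫ φ (Module.finBasis k W i)

lemma elt_unitPairing {A B : C} (φ : W →ₗ[k] (A ⟶ B)) (x : W) :
    A ◁ elt C x ≫ unitPairing φ = (ρ_ A).hom ≫ φ x := by
  conv_rhs => rw [← (Module.finBasis k W).sum_repr x]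
  simp only [unitPairing, Preadditive.comp_sum, ← whiskerLeft_comp_assoc, elt_unitπ, map_sum,
    map_smul, MonoidalLinear.whiskerLeft_smul, Linear.smul_comp, whiskerLeft_id, Category.id_comp,
    Linear.comp_smul]

variable {G : Type} [Group G]

/-- An invariant element of a representation as a morphism from the unit. -/
noncomputable def invariantElt (W : FDRep k G) (x : W) (hx : ∀ g, W.ρ g x = x) :
    𝟙_ (Action C G) ⟶ ((unitFunctor C k).mapAction G).obj W where
  hom := elt (k := k) C (x : W.V)
  comm g := by
    change 𝟙 _ ≫ elt (k := k) C (x : W.V) = elt C (x : W.V) ≫ unitMap (W.ρ g)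
    rw [elt_unitMap, hx, Category.id_comp]

/-- The equivariant morphism `M ⊗ (W ⊗ 𝟙) ⟶ N` determined by an equivariant map
`W → Hom(M, N)`. -/
noncomputable def equivariantPairing {M N : Action C G} (W : FDRep k G)
    (φ : W →ₗ[k] (M.V ⟶ N.V)) (hφ : ∀ g x, M.ρ g ≫ φ (W.ρ g x) = φ x ≫ N.ρ g) :
    M ⊗ ((unitFunctor C k).mapAction G).obj W ⟶ N where
  hom := unitPairing (k := k) (W := W.V) φ
  comm g := by
    change (M.ρ g ⊗ₘ unitMap (W.ρ g)) ≫ unitPairing (k := k) (W := W.V) φ =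
      unitPairing (k := k) (W := W.V) φ ≫ N.ρ g
    refine unit_ext_left (k := k) (W := W.V) _ fun x => ?_
    rw [whiskerLeft_comp_tensorHom_assoc, elt_unitMap, reassoc_of% elt_unitPairing, ← hφ,
      MonoidalCategory.tensorHom_def, Category.assoc, elt_unitPairing,
      rightUnitor_naturality_assoc]

/-- A functor that kills a representation kills the morphisms that factor through it. -/
lemma map_eq_zero_of_invariant {E : Type*} [Category* E] [Preadditive E] [MonoidalCategory E]
    [MonoidalPreadditive E] (T : Action C G ⥤ E) [T.Monoidal] (W : FDRep k G)
    (hW : IsZero (T.obj (((unitFunctor C k).mapAction G).obj W))) {M N : Action C G}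
    (φ : W →ₗ[k] (M.V ⟶ N.V)) (hφ : ∀ g x, M.ρ g ≫ φ (W.ρ g x) = φ x ≫ N.ρ g)
    (x : W) (hx : ∀ g, W.ρ g x = x) (f : M ⟶ N) (hf : f.hom = φ x) : T.map f = 0 := by
  -- Insert the invariant element, then evaluate: f factors as M ⟶ M ⊗ W ⟶ N, and `T` kills the
  -- first arrow because `T` of the inserted object is zero.
  have e : f = (ρ_ M).inv ≫ M ◁ invariantElt W x hx ≫ equivariantPairing W φ hφ := by
    apply Action.Hom.ext
    simp only [Action.comp_hom, Action.whiskerLeft_hom, Action.rightUnitor_inv_hom]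
    change f.hom = (ρ_ M.V).inv ≫ M.V ◁ elt (k := k) (W := W.V) C x ≫
      unitPairing (k := k) (W := W.V) φ
    rw [elt_unitPairing, Iso.inv_hom_id_assoc, hf]
  have hz : T.map (M ◁ invariantElt W x hx) = 0 := by
    rw [Functor.Monoidal.map_whiskerLeft, hW.eq_zero_of_tgt (T.map (invariantElt W x hx))]
    simp
  rw [e, T.map_comp, T.map_comp, hz]
  simp

open Classical in
/-- The sum over an orbit of an equivariant family of morphisms. -/
noncomputable def orbitSum [Finite G] {Ω : Type} [Finite Ω] [MulAction G Ω] {M N : Action C G}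
    (h : Ω → (M.V ⟶ N.V)) (hh : ∀ g s, M.ρ g ≫ h (g • s) = h s ≫ N.ρ g) (s : Ω) : M ⟶ N :=
  letI := Fintype.ofFinite Ω
  { hom := ∑ t with t ∈ MulAction.orbit G s, h t
    comm := fun g => by
      rw [Preadditive.comp_sum, Preadditive.sum_comp]
      symm
      refine Finset.sum_equiv (MulAction.toPerm g) (fun t => ?_) fun t _ => (hh g t).symm
      simp only [Finset.mem_filter, Finset.mem_univ, true_and, MulAction.toPerm_apply]
      rw [← MulAction.orbit_eq_iff, ← MulAction.orbit_eq_iff, MulAction.orbit_smul] }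

lemma orbitSum_hom [Finite G] {Ω : Type} [Fintype Ω] [MulAction G Ω] {M N : Action C G}
    (h : Ω → (M.V ⟶ N.V)) (hh : ∀ g s, M.ρ g ≫ h (g • s) = h s ≫ N.ρ g) (s : Ω)
    [DecidablePred (· ∈ MulAction.orbit G s)] :
    (orbitSum h hh s).hom = ∑ t with t ∈ MulAction.orbit G s, h t := by
  dsimp only [orbitSum]
  congr!

/-- A monoidal functor that kills the representation induced from a stabilizer kills the sum over
the orbit. -/
lemma map_orbitSum [Finite G] {E : Type*} [Category* E] [Preadditive E] [MonoidalCategory E]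
    [MonoidalPreadditive E] (T : Action C G ⥤ E) [T.Monoidal] {Ω : Type} [Finite Ω] [MulAction G Ω]
    {M N : Action C G} (h : Ω → (M.V ⟶ N.V)) (hh : ∀ g s, M.ρ g ≫ h (g • s) = h s ≫ N.ρ g) (s : Ω)
    (hs : IsZero (T.obj (((unitFunctor C k).mapAction G).obj
      (indTrivial k (MulAction.stabilizer G s))))) :
    T.map (orbitSum h hh s) = 0 := by
  classical
  let := Fintype.ofFinite Ω
  let H := MulAction.stabilizer G s
  -- The induced module is the space of coinvariants of k[G] under left multiplication by H, so its
  -- spanning classes are the cosets Hg. The element g⁻¹ • s depends only on Hg, hence g ↦ h (g⁻¹ •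
  -- s) descends.
  let φ₁ : TensorProduct k (MonoidAlgebra k G) k →ₗ[k] (M.V ⟶ N.V) :=
    ((Finsupp.linearCombination k fun g : G => h (g⁻¹ • s)) ∘ₗ
      (MonoidAlgebra.coeffLinearEquiv k).toLinearMap) ∘ₗ (TensorProduct.rid k _).toLinearMap
  have hφ₁ (g : G) : φ₁ (TensorProduct.mk k _ _ (.single g 1) 1) = h (g⁻¹ • s) := by
    simp [φ₁]
  let φ : Representation.IndV H.subtype (Representation.trivial k H k) →ₗ[k] (M.V ⟶ N.V) :=
    Representation.Coinvariants.lift _ φ₁ (by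
      intro b
      ext a
      have e : (b : G)⁻¹ • s = s := (H.inv_mem b.2)
      have := hφ₁ (b * a)
      rw [mul_inv_rev, mul_smul, e, ← hφ₁] at this
      simpa using this)
  let mk (g : G) := Representation.IndV.mk H.subtype (Representation.trivial k H k) g 1
  have hφ (g : G) : φ (mk g) = h (g⁻¹ • s) := hφ₁ g
  have hmk (a b : G) (hab : a⁻¹ • s = b⁻¹ • s) : mk a = mk b := by
    have hb : b * a⁻¹ ∈ H := by
      change _ • s = s
      rw [mul_smul, hab, smul_inv_smul]
    have := Representation.Coinvariants.mk_self_apply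
      (Representation.tprod ((Representation.leftRegular k G).comp H.subtype)
        (Representation.trivial k H k)) ⟨_, hb⟩ (TensorProduct.mk k _ _ (.single a 1) 1)
    rw [← show _ = mk a from this]
    simp [mk]
  choose! r hr using fun t (ht : t ∈ MulAction.orbit G s) => ht
  have hρ (g a : G) : Representation.ind H.subtype (Representation.trivial k H k) g (mk a) =
      mk (a * g⁻¹) :=
    Representation.ind_mk H.subtype (Representation.trivial k H k) g a 1
  -- The sum of all cosets, indexed by the orbit: (r t)⁻¹ represents the coset that φ sends to h t,
  -- because r t • s = t. The group permutes the cosets, so x is invariant.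
  let x := ∑ t with t ∈ MulAction.orbit G s, mk (r t)⁻¹
  have hx (g : G) : Representation.ind H.subtype (Representation.trivial k H k) g x = x := by
    rw [map_sum]
    refine Finset.sum_equiv (MulAction.toPerm g) (fun t => ?_) fun t ht => ?_
    · simp only [Finset.mem_filter, Finset.mem_univ, true_and, MulAction.toPerm_apply]
      rw [← MulAction.orbit_eq_iff, ← MulAction.orbit_eq_iff, MulAction.orbit_smul]
    · have ht' : t ∈ MulAction.orbit G s := by simpa using ht
      have ht2 : g • t ∈ MulAction.orbit G s := by
        rwa [← MulAction.orbit_eq_iff, MulAction.orbit_smul, MulAction.orbit_eq_iff]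
      rw [hρ]
      refine hmk _ _ ?_
      have h1 : r t • s = t := hr t ht'
      have h2 : r (g • t) • s = g • t := hr _ ht2
      simp [mul_smul, h1, h2]
  have hφx : φ x = ∑ t with t ∈ MulAction.orbit G s, h t := by
    rw [map_sum]
    refine Finset.sum_congr rfl fun t ht => ?_
    rw [hφ, inv_inv]
    exact congrArg h (hr t (by simpa using ht))
  refine map_eq_zero_of_invariant T (indTrivial k H) hs φ (fun g x => ?_) x hx _ hφx.symm
  have : (Linear.leftComp k N.V (M.ρ g) ∘ₗ φ ∘ₗ
      Representation.ind H.subtype (Representation.trivial k H k) g) =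
      (Linear.rightComp k M.V (N.ρ g)) ∘ₗ φ := by
    refine Representation.IndV.hom_ext _ _ fun a => LinearMap.ext_ring ?_
    change M.ρ g ≫ φ (Representation.ind _ _ g (mk a)) = φ (mk a) ≫ N.ρ g
    rw [hρ, hφ, hφ, mul_inv_rev, inv_inv, mul_smul, hh]
  exact LinearMap.congr_fun this x

end Vanishing

/-! ### Additivity and Frobenius-linearity. -/

section Semilinear
variable {k : Type u} [Field k]

/-- The composite of the tensor power with a linear monoidal functor that kills the modules induced
from intransitive subgroups is additive and semilinear. -/
lemma powerComposite_semilinear (p i : ℕ) [ExpChar k p] {C V : TensorCat k}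
    (G : Subgroup (Equiv.Perm (Fin (p ^ i)))) (Θ : FDRep k G ⥤ V) [Θ.Braided]
    (hΘ : IsVFunctor G Θ) (P : DeligneProduct C V) (T : Action C G ⥤ P.cat) [T.Braided]
    (hT : IsBoxOfLSMFunctor Θ P T) :
    IsSemilinear (iterateFrobenius k p i) (powerComposite G T) := by
  classical
  have : T.Additive := ⟨hT.linear.map_add _ _⟩
  have : P.inr.Additive := ⟨P.isTensorFunctor_inr.linear.map_add _ _⟩
  have hpos : 0 < p ^ i := pow_pos (expChar_pos k p) i
  constructor
  · intro X Y f g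
    have hP (f : X ⟶ Y) : (powerComposite G T).map f =
      T.map ((powerFunctor C (p ^ i) ⋙ Action.res C G.subtype).map f) := rfl
    rw [hP, hP, hP]
    set Q := powerFunctor C (p ^ i) ⋙ Action.res C G.subtype
    let : MulAction G (Fin (p ^ i) → Bool) := arrowAction
    let h (S : Fin (p ^ i) → Bool) : (Q.obj X).V ⟶ (Q.obj Y).V :=
      mixMap fun i => if S i then f else g
    have hh (σ : G) (S) : (Q.obj X).ρ σ ≫ h (σ • S) = h S ≫ (Q.obj Y).ρ σ := by
      refine (mixMap_permMap (fun i => if (σ • S) i then f else g) σ.1).symm.trans ?_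
      congr 2
      ext i
      change (if S ((σ⁻¹).1 (σ.1 i)) then f else g) = _
      simp
    let v (S : Fin (p ^ i) → Bool) := orbitSum h hh S
    -- A permutation that fixes S preserves colours, so it cannot move b to a. The stabilizer is
    -- therefore intransitive and the defining property of a V-functor applies.
    have hv0 (S : Fin (p ^ i) → Bool) (a b : Fin (p ^ i)) (ha : S a = true) (hb : S b = false) :
        T.map (v S) = 0 := by
      obtain ⟨e, -⟩ := hT.restrict_right
      refine map_orbitSum T h hh S (IsZero.of_iso ?_ (e.app _))
      refine P.inr.map_isZero (hΘ.isZero_obj _ fun ht => ?_)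
      obtain ⟨⟨σ, hσ⟩, hσ'⟩ := ht.exists_smul_eq b a
      have h1 : (σ • S) a = S a := by rw [show σ • S = S from hσ]
      have h2 : σ⁻¹ • a = b := by rw [← hσ']; exact inv_smul_smul σ b
      have h3 : (σ • S) a = S (σ⁻¹ • a) := rfl
      rw [h3, h2, ha, hb] at h1
      exact absurd h1 (by simp)
    have horb (c : Bool) (S : Fin (p ^ i) → Bool) :
        S ∈ MulAction.orbit G (fun _ : Fin (p ^ i) => c) ↔ S = fun _ => c :=
      ⟨fun ⟨σ, hσ⟩ => hσ.symm, fun h => h ▸ MulAction.mem_orbit_self _⟩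
    have hv (c : Bool) : v (fun _ => c) = Q.map (if c then f else g) := by
      apply Action.Hom.ext
      refine (orbitSum_hom h hh _).trans ?_
      change _ = tpowMap _ _
      simp only [horb]
      rw [Finset.filter_eq', if_pos (Finset.mem_univ _), Finset.sum_singleton, ← mixMap_const]
    -- The binomial expansion grouped by orbits, now an identity between equivariant morphisms, to
    -- which `T` can be applied.
    have htot : Q.map (f + g) = ∑ o : MulAction.orbitRel.Quotient G (Fin (p ^ i) → Bool),
        v o.out := by
      apply Action.Hom.ext
      have hsum : (∑ o : MulAction.orbitRel.Quotient G (Fin (p ^ i) → Bool), v o.out).hom =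
          ∑ o : MulAction.orbitRel.Quotient G (Fin (p ^ i) → Bool), (v o.out).hom :=
        map_sum (Action.forget C G).mapAddHom _ _
      rw [hsum]
      refine (mixMap_add f g _).trans ?_
      rw [← Finset.sum_fiberwise _ (fun S =>
        (Quotient.mk'' S : MulAction.orbitRel.Quotient G (Fin (p ^ i) → Bool)))]
      refine Finset.sum_congr rfl fun o _ => ?_
      refine Eq.trans ?_ (orbitSum_hom h hh _).symm
      refine Finset.sum_congr ?_ fun _ _ => rfl
      ext S
      simp only [Finset.mem_filter, Finset.mem_univ, true_and]
      rw [← MulAction.orbitRel_apply, ← Quotient.eq'', Quotient.out_eq']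
    have hout (c : Bool) : (Quotient.mk'' (fun _ => c) :
        MulAction.orbitRel.Quotient G (Fin (p ^ i) → Bool)).out = fun _ => c := by
      rw [← horb, ← MulAction.orbitRel_apply, ← Quotient.eq'', Quotient.out_eq']
    rw [htot, T.map_sum, Finset.sum_eq_add (Quotient.mk'' fun _ => true)
      (Quotient.mk'' fun _ => false)]
    · rw [hout, hout, hv, hv]
      rfl
    -- The constant colourings are distinct because there is at least one position.
    · intro h0
      have := congrArg Quotient.out h0
      rw [hout, hout] at this
      exact absurd (congrFun this ⟨0, hpos⟩) (by simp)
    -- An orbit other than the two constant ones has a representative that takes both colours.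
    · rintro o - ⟨ho1, ho2⟩
      have hc (c : Bool) (hc : o ≠ Quotient.mk'' fun _ => c) : ∃ a, o.out a = !c := by
        by_contra! hne
        refine hc ?_
        rw [← Quotient.out_eq' o]
        congr 1
        ext a
        simpa using hne a
      obtain ⟨a, ha⟩ := hc false ho2
      obtain ⟨b, hb⟩ := hc true ho1
      exact hv0 _ a b ha hb
    · simp
    · simp
  · intro X Y c f
    have e : (Action.res C G.subtype).map ((powerFunctor C (p ^ i)).map (c • f)) =
        c ^ (p ^ i) • (Action.res C G.subtype).map ((powerFunctor C (p ^ i)).map f) :=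
      Action.Hom.ext (tpowMap_smul c f _)
    change T.map ((Action.res C G.subtype).map ((powerFunctor C _).map _)) = _
    rw [e, hT.linear.map_smul, iterateFrobenius_def]
    rfl

end Semilinear

/-! ### Induction on length. -/

section Length
open ZeroObject
variable {C : Type w} [Category.{v} C] [Abelian C]

/-- Induction along the length of objects in an abelian category of objects of finite length. -/
lemma finiteLength_induction (hN : ∀ X : C, IsNoetherianObject X)
    (hA : ∀ X : C, IsArtinianObject X) {P : C → Prop} (h0 : ∀ X, IsZero X → P X)
    (hs : ∀ X, Simple X → P X)
    (hext : ∀ S : ShortComplex C, S.ShortExact → P S.X₁ → P S.X₃ → P S.X₂) (X : C) : P X := by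
  have := hN X
  -- A maximal subobject with property P. If it were proper, the preimage of a simple subobject of
  -- X/A would be a larger one.
  obtain ⟨A, hA1, hA2⟩ := wellFounded_gt.has_min {A : Subobject X | P (A : C)}
    ⟨⊥, h0 _ ((isZero_zero C).of_iso Subobject.botCoeIsoZero)⟩
  by_cases hQ : IsZero (cokernel A.arrow)
  · have : Epi A.arrow := by
      rw [Preadditive.epi_iff_cancel_zero]
      intro Z g hg
      rw [← cokernel.π_desc A.arrow g hg, hQ.eq_zero_of_src (cokernel.desc _ _ _), comp_zero]
    have : IsIso A.arrow := isIso_of_mono_of_epi _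
    -- P is not assumed invariant under isomorphism; an extension by a zero object transports it.
    refine hext (ShortComplex.mk A.arrow (0 : X ⟶ 0) comp_zero) ?_ hA1 (h0 _ (isZero_zero C))
    exact { exact := by rw [ShortComplex.exact_iff_epi _ rfl]; infer_instance
            mono_f := inferInstance
            epi_g := inferInstance }
  · exfalso
    have := hA (cokernel A.arrow)
    obtain ⟨S, hS⟩ := exists_simple_subobject hQ
    let q := pullback.snd S.arrow (cokernel.π A.arrow)
    have hq : q ≫ cokernel.π A.arrow = pullback.fst _ _ ≫ S.arrow := pullback.condition.symm
    let l : (A : C) ⟶ pullback S.arrow (cokernel.π A.arrow) := pullback.lift 0 A.arrow (by simp)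
    have hl : l ≫ q = A.arrow := pullback.lift_snd _ _ _
    have hl0 : l ≫ pullback.fst S.arrow (cokernel.π A.arrow) = 0 := pullback.lift_fst _ _ _
    have hmono : Mono l := mono_of_mono_fac hl
    have hmq : Mono q := inferInstance
    have hse : (ShortComplex.mk l (pullback.fst S.arrow (cokernel.π A.arrow)) hl0).ShortExact := by
      refine { exact := ?_, mono_f := hmono, epi_g := inferInstance }
      rw [ShortComplex.exact_iff_exact_up_to_refinements]
      intro T x hx
      dsimp at x hx
      have hx' : (x ≫ q) ≫ cokernel.π A.arrow = 0 := by
        rw [Category.assoc, hq, reassoc_of% hx, zero_comp]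
      have hex := (ShortComplex.exact_cokernel A.arrow)
      refine ⟨T, 𝟙 _, inferInstance, hex.lift (x ≫ q) hx', ?_⟩
      dsimp
      rw [← cancel_mono q, Category.assoc, Category.assoc, Category.id_comp]
      erw [hl]
      exact (hex.lift_f _ _).symm
    have hP : P (pullback S.arrow (cokernel.π A.arrow)) := hext _ hse hA1 (hs _ hS)
    let B := Subobject.mk q
    have hB : P (B : C) := by
      let e := Subobject.underlyingIso q
      refine hext (ShortComplex.mk e.inv (0 : (B : C) ⟶ 0) comp_zero) ?_ hP (h0 _ (isZero_zero C))
      exact { exact := by rw [ShortComplex.exact_iff_epi _ rfl]; infer_instance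
              mono_f := inferInstance
              epi_g := inferInstance }
    -- If the preimage of S were A itself, its epimorphism onto S would vanish, although S is
    -- simple.
    refine hA2 B hB (lt_of_le_of_ne (Subobject.le_mk_of_comm l hl) fun hAB => ?_)
    have h1 : q ≫ cokernel.π A.arrow = 0 := by
      have : B.arrow ≫ cokernel.π A.arrow = 0 := by rw [← hAB]; simp
      rw [← Subobject.underlyingIso_arrow q, Category.assoc, this, comp_zero]
    rw [hq] at h1
    have h2 : pullback.fst S.arrow (cokernel.π A.arrow) = 0 := by
      rw [← cancel_mono S.arrow, h1, zero_comp]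
    have h3 : Epi (pullback.fst S.arrow (cokernel.π A.arrow)) := inferInstance
    exact Simple.not_isZero (S : C) (IsZero.of_epi_eq_zero _ h2)

end Length

/-! ### Exactness of tensoring with a dualizable object. -/

section Exactness
variable {C : Type w} [Category.{v} C] [MonoidalCategory C] [SymmetricCategory C]

lemma preservesLimitsColimits_tensorLeft (X Y : C) [ExactPairing X Y] :
    (tensorLeft X).IsLeftAdjoint ∧ (tensorLeft X).IsRightAdjoint := by
  have := BraidedCategory.exactPairing_swap X Y
  exact ⟨(tensorLeftAdjunction Y X).isLeftAdjoint, (tensorLeftAdjunction X Y).isRightAdjoint⟩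

end Exactness

/-! ### Simplicity of the unit and finite-dimensionality of Hom spaces. -/

section TensorCategory
variable {k : Type u} [Field k]

instance (C : TensorCat k) (X : C) : (tensorLeft X).IsLeftAdjoint := by
  obtain ⟨Y, ⟨_⟩⟩ := C.exists_dual X
  exact (preservesLimitsColimits_tensorLeft X Y).1

instance (C : TensorCat k) (X : C) : (tensorLeft X).IsRightAdjoint := by
  obtain ⟨Y, ⟨_⟩⟩ := C.exists_dual X
  exact (preservesLimitsColimits_tensorLeft X Y).2

variable {C : TensorCat k}

instance (X : C) {Y Z : C} (f : Y ⟶ Z) [Mono f] : Mono (X ◁ f) :=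
  inferInstanceAs (Mono ((tensorLeft X).map f))

instance (X : C) {Y Z : C} (f : Y ⟶ Z) [Epi f] : Epi (X ◁ f) :=
  inferInstanceAs (Epi ((tensorLeft X).map f))

instance (X : C) {Y Z : C} (f : Y ⟶ Z) [Mono f] : Mono (f ▷ X) := by
  have : f ▷ X = (β_ Y X).hom ≫ X ◁ f ≫ (β_ X Z).hom := by simp
  rw [this]; infer_instance

instance (X : C) {Y Z : C} (f : Y ⟶ Z) [Epi f] : Epi (f ▷ X) := by
  have : f ▷ X = (β_ Y X).hom ≫ X ◁ f ≫ (β_ X Z).hom := by simp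
  rw [this]; infer_instance

instance {W X Y Z : C} (f : W ⟶ X) (g : Y ⟶ Z) [Epi f] [Epi g] : Epi (f ⊗ₘ g) := by
  rw [MonoidalCategory.tensorHom_def]; infer_instance

/-- By duality End(D ⊗ Q) ≅ Hom(Q, S ⊗ D ⊗ Q), and the target is D ⊗ (S ⊗ Q) up to the braiding,
which is zero. -/
lemma isZero_tensor_dual {S D Q : C} [ExactPairing S D] (h : IsZero (S ⊗ Q)) : IsZero (D ⊗ Q) := by
  have h2 : IsZero (S ⊗ D ⊗ Q) := by
    have e : S ⊗ D ⊗ Q ≅ D ⊗ S ⊗ Q := (α_ _ _ _).symm ≪≫ whiskerRightIso (β_ S D) Q ≪≫ α_ _ _ _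
    exact ((tensorLeft D).map_isZero h).of_iso e
  rw [IsZero.iff_id_eq_zero]
  apply (tensorLeftHomEquiv Q S D (D ⊗ Q)).injective
  exact h2.eq_of_tgt _ _

instance : Nontrivial (𝟙_ C ⟶ 𝟙_ C) := C.bijective_unit.injective.nontrivial

/-- The inclusion ι splits: S ⊗ S ⟶ S is an isomorphism, so S, and hence its dual D, annihilates the
cokernel of ι. Thus D ⊗ S ≅ D, the evaluation extends to a morphism D ⟶ 𝟙, and its transpose is a
retraction f of ι. The idempotent f ≫ ι of End(𝟙) = k is nonzero, so it is 1. -/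
lemma isIso_of_mono_unit {S : C} [Simple S] (ι : S ⟶ 𝟙_ C) [Mono ι] : IsIso ι := by
  obtain ⟨D, ⟨_⟩⟩ := C.exists_dual S
  have hS : ¬ IsZero S := Simple.not_isZero S
  -- This morphism is mono, so if it vanished then S ⊗ S = 0 and D ⊗ S = 0. Then Hom(S, S ⊗ 𝟙) ≅
  -- Hom(D ⊗ S, 𝟙) = 0, which forces S = 0.
  have hSS : S ◁ ι ≫ (ρ_ S).hom ≠ 0 := by
    intro h
    have h1 : IsZero (S ⊗ S) := IsZero.of_mono_eq_zero _ h
    apply hS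
    have h2 : IsZero (D ⊗ S) := isZero_tensor_dual h1
    have : (ρ_ S).inv = 0 := (tensorLeftHomEquiv S S D (𝟙_ C)).symm.injective (h2.eq_of_src _ _)
    exact IsZero.of_mono_eq_zero _ this
  have h1 : IsIso (S ◁ ι ≫ (ρ_ S).hom) := isIso_of_mono_of_nonzero hSS
  have h2 : IsIso (S ◁ ι) := IsIso.of_isIso_comp_right _ (ρ_ S).hom
  have h3 : IsZero (S ⊗ cokernel ι) := by
    have : S ◁ cokernel.π ι = 0 := by
      rw [← cancel_epi (S ◁ ι), ← whiskerLeft_comp, cokernel.condition]; simp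
    exact IsZero.of_epi_eq_zero (S ◁ cokernel.π ι) this
  have h4 : IsZero (D ⊗ cokernel ι) := isZero_tensor_dual h3
  have h5 : Epi (D ◁ ι) := by
    refine Abelian.epi_of_cokernel_π_eq_zero _ ?_
    exact (h4.of_iso (PreservesCokernel.iso (tensorLeft D) ι).symm).eq_of_tgt _ _
  have h6 : IsIso (D ◁ ι) := isIso_of_mono_of_epi _
  let h : D ⟶ 𝟙_ C := (ρ_ D).inv ≫ inv (D ◁ ι) ≫ ε_ S D
  let f : 𝟙_ C ⟶ S := η_ S D ≫ S ◁ h ≫ (ρ_ S).hom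
  -- Restricted to D ⊗ S, `h` is the evaluation, so this is a zigzag identity for S and D.
  have hf : ι ≫ f = 𝟙 S := by
    have e1 : D ◁ ι ≫ (ρ_ D).hom ≫ h = ε_ S D := by simp [h]
    have e2 : ι ≫ η_ S D = (λ_ S).inv ≫ η_ S D ▷ S ≫ (S ⊗ D) ◁ ι ≫ (ρ_ _).hom := by
      rw [← whisker_exchange_assoc]
      simp [← unitors_equal]
    have e3 : (S ⊗ D) ◁ ι ≫ (ρ_ (S ⊗ D)).hom ≫ S ◁ h = (α_ S D S).hom ≫ S ◁ ε_ S D := by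
      rw [← e1]
      simp
    rw [reassoc_of% e2, reassoc_of% e3, ExactPairing.evaluation_coevaluation_assoc]
    simp
  obtain ⟨c, hc⟩ := C.bijective_unit.surjective (f ≫ ι)
  dsimp at hc
  have h7 : (c * c) • 𝟙 (𝟙_ C) = c • 𝟙 (𝟙_ C) := by
    have : (f ≫ ι) ≫ f ≫ ι = f ≫ ι := by rw [Category.assoc, reassoc_of% hf]
    rw [← hc] at this
    simpa [smul_smul] using this
  have h8 : c * c = c := C.bijective_unit.injective h7
  have hc0 : c ≠ 0 := by
    rintro rfl
    apply hS
    rw [IsZero.iff_id_eq_zero]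
    have : ι ≫ (f ≫ ι) ≫ f = 𝟙 S := by rw [Category.assoc, reassoc_of% hf, hf]
    rw [← this, ← hc]; simp
  have h9 : f ≫ ι = 𝟙 _ := by
    rw [← hc, mul_left_cancel₀ hc0 (h8.trans (mul_one c).symm), one_smul]
  exact ⟨f, hf, h9⟩

instance simple_unit : Simple (𝟙_ C) := by
  have h : ¬ IsZero (𝟙_ C) := fun h => by
    obtain ⟨f, g, hfg⟩ := exists_pair_ne (𝟙_ C ⟶ 𝟙_ C)
    exact hfg (h.eq_of_src f g)
  have := C.isArtinianObject (𝟙_ C)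
  obtain ⟨S, hS⟩ := exists_simple_subobject h
  have := isIso_of_mono_unit S.arrow
  exact Simple.of_iso (asIso S.arrow).symm

/-- Induction on the length of X. Since 𝟙 is simple, a nonzero morphism from 𝟙 to a simple object is
an isomorphism, and End(𝟙) = k bounds the dimension by 1. -/
instance finiteDimensional_hom_unit (X : C) : FiniteDimensional k (𝟙_ C ⟶ X) := by
  induction X using finiteLength_induction C.isNoetherianObject C.isArtinianObject with
  | h0 X hX =>
    have : Subsingleton (𝟙_ C ⟶ X) := ⟨fun f g => hX.eq_of_tgt f g⟩
    infer_instance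
  | hs X hX =>
    by_cases h : ∀ f : 𝟙_ C ⟶ X, f = 0
    · have : Subsingleton (𝟙_ C ⟶ X) := ⟨fun f g => (h f).trans (h g).symm⟩
      infer_instance
    · push Not at h
      obtain ⟨f, hf⟩ := h
      have := isIso_of_hom_simple hf
      refine Module.Finite.of_surjective (LinearMap.toSpanSingleton k _ f) fun g => ?_
      obtain ⟨c, hc⟩ := C.bijective_unit.surjective (g ≫ inv f)
      refine ⟨c, ?_⟩
      rw [← cancel_mono (inv f), ← hc]
      simp
  | hext S hS h1 h2 =>
    have := hS.mono_f
    have hex : Function.Exact (Linear.rightComp k (𝟙_ C) S.f) (Linear.rightComp k (𝟙_ C) S.g) := by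
      intro x
      constructor
      · intro hx
        exact ⟨hS.exact.lift x hx, hS.exact.lift_f _ _⟩
      · rintro ⟨y, rfl⟩
        simp
    have : FiniteDimensional k (𝟙_ C ⟶ S.X₁) := h1
    have : FiniteDimensional k (𝟙_ C ⟶ S.X₃) := h2
    -- Hom(𝟙, -) is only left exact, so the last map is replaced by its corestriction to its range.
    refine Module.Finite.of_exact (f := Linear.rightComp k (𝟙_ C) S.f) (g := (Linear.rightComp k (𝟙_ C) S.g).rangeRestrict) ?_
      (LinearMap.surjective_rangeRestrict _)
    rw [LinearMap.exact_iff] at hex ⊢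
    rw [LinearMap.ker_rangeRestrict, hex]

instance finiteDimensional_hom (X Y : C) : FiniteDimensional k (X ⟶ Y) := by
  obtain ⟨D, ⟨_⟩⟩ := C.exists_dual X
  let F : (X ⟶ Y) →ₗ[k] (𝟙_ C ⟶ Y ⊗ D) :=
    { toFun f := η_ X D ≫ f ▷ D
      map_add' f g := by simp
      map_smul' c f := by simp }
  refine FiniteDimensional.of_injective F fun f g hfg => ?_
  have h (f : X ⟶ Y) : (tensorRightHomEquiv (𝟙_ C) X D Y) ((λ_ X).hom ≫ f) = F f := by
    change (ρ_ _).inv ≫ _ ◁ η_ X D ≫ (α_ _ _ _).inv ≫ ((λ_ X).hom ≫ f) ▷ _ = η_ X D ≫ f ▷ D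
    rw [comp_whiskerRight, leftUnitor_whiskerRight]
    simp [unitors_equal]
  have := (tensorRightHomEquiv (𝟙_ C) X D Y).injective ((h f).trans (hfg.trans (h g).symm))
  simpa using this

end TensorCategory

/-! ### Formal tensors of morphisms and their kernels. -/

section External
open scoped TensorProduct
variable {k : Type u} [Field k] {C : TensorCat k}

variable (k) in
/-- The morphism of tensor products determined by a tensor of morphisms. -/
noncomputable def extHom {X X' N N' : C} : (X ⟶ X') ⊗[k] (N ⟶ N') →ₗ[k] (X ⊗ N ⟶ X' ⊗ N') :=
  TensorProduct.lift (LinearMap.mk₂ k (fun f g => f ⊗ₘ g)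
    (by simp [MonoidalPreadditive.add_tensor]) (by simp [MonoidalCategory.tensorHom_def])
    (by simp [MonoidalPreadditive.tensor_add]) (by simp [MonoidalCategory.tensorHom_def]))

lemma extHom_tmul {X X' N N' : C} (f : X ⟶ X') (g : N ⟶ N') :
    extHom k (f ⊗ₜ[k] g) = f ⊗ₘ g := rfl

variable (k) in
/-- The composition of tensors of morphisms. -/
noncomputable def extComp {X X' X'' N N' N'' : C} : (X ⟶ X') ⊗[k] (N ⟶ N') →ₗ[k]
    (X' ⟶ X'') ⊗[k] (N' ⟶ N'') →ₗ[k] (X ⟶ X'') ⊗[k] (N ⟶ N'') :=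
  TensorProduct.map₂ (Linear.comp X X' X'') (Linear.comp N N' N'')

lemma extComp_tmul {X X' X'' N N' N'' : C} (f : X ⟶ X') (g : N ⟶ N') (f' : X' ⟶ X'')
    (g' : N' ⟶ N'') : extComp k (f ⊗ₜ g) (f' ⊗ₜ g') = (f ≫ f') ⊗ₜ (g ≫ g') := rfl

lemma extHom_extComp {X X' X'' N N' N'' : C} (a : (X ⟶ X') ⊗[k] (N ⟶ N'))
    (b : (X' ⟶ X'') ⊗[k] (N' ⟶ N'')) : extHom k (extComp k a b) = extHom k a ≫ extHom k b := by
  induction a with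
  | zero => simp
  | add x y hx hy => simp [hx, hy]
  | tmul f g =>
    induction b with
    | zero => simp
    | add x y hx hy => simp [hx, hy]
    | tmul f' g' => rw [extComp_tmul, extHom_tmul, extHom_tmul, extHom_tmul, tensorHom_comp_tensorHom]

lemma extComp_assoc {X X' X'' X''' N N' N'' N''' : C} (a : (X ⟶ X') ⊗[k] (N ⟶ N'))
    (b : (X' ⟶ X'') ⊗[k] (N' ⟶ N'')) (c : (X'' ⟶ X''') ⊗[k] (N'' ⟶ N''')) :
    extComp k (extComp k a b) c = extComp k a (extComp k b c) := by
  induction a with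
  | zero => simp
  | add x y hx hy => simp [hx, hy]
  | tmul f g =>
    induction b with
    | zero => simp
    | add x y hx hy => simp [hx, hy]
    | tmul f' g' =>
      induction c with
      | zero => simp
      | add x y hx hy => simp [hx, hy]
      | tmul f'' g'' => simp [extComp_tmul]

lemma lTensor_rightComp {X X' N N' N'' : C} (a : (X ⟶ X') ⊗[k] (N ⟶ N')) (f : N' ⟶ N'') :
    (Linear.rightComp k N f).lTensor (X ⟶ X') a = extComp k a (𝟙 X' ⊗ₜ f) := by
  induction a with
  | zero => simp
  | add x y hx hy => simp [hx, hy]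
  | tmul f g => simp [extComp_tmul]

lemma exists_lift_kernel_whiskerRight {A B Z : C} (S : C) (f : A ⟶ B) (t : Z ⟶ A ⊗ S)
    (ht : t ≫ f ▷ S = 0) : ∃ t' : Z ⟶ kernel f ⊗ S, t' ≫ kernel.ι f ▷ S = t := by
  have h := (ShortComplex.exact_kernel f).map_of_mono_of_preservesKernel (tensorRight S)
    (inferInstanceAs (Mono (kernel.ι f))) inferInstance
  have : Mono (((ShortComplex.mk _ _ (kernel.condition f)).map (tensorRight S)).f) :=
    inferInstanceAs (Mono (kernel.ι f ▷ S))
  exact ⟨h.lift t ht, h.lift_f t ht⟩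

lemma exists_lift_kernel_whiskerLeft {A B Z : C} (S : C) (f : A ⟶ B) (t : Z ⟶ S ⊗ A)
    (ht : t ≫ S ◁ f = 0) : ∃ t' : Z ⟶ S ⊗ kernel f, t' ≫ S ◁ kernel.ι f = t := by
  have h := (ShortComplex.exact_kernel f).map_of_mono_of_preservesKernel (tensorLeft S)
    (inferInstanceAs (Mono (kernel.ι f))) inferInstance
  have : Mono (((ShortComplex.mk _ _ (kernel.condition f)).map (tensorLeft S)).f) :=
    inferInstanceAs (Mono (S ◁ kernel.ι f))
  exact ⟨h.lift t ht, h.lift_f t ht⟩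

/-- The tensor `φ` of morphisms has approximate kernels by tensors of morphisms: every `t` which is
killed by `φ` factors, after a refinement of its source, through a tensor of morphisms that is
formally killed by `φ`. -/
def HasExtKernel {X X' N N' : C} (φ : (X ⟶ X') ⊗[k] (N ⟶ N')) : Prop :=
  ∀ (Z : C) (t : Z ⟶ X ⊗ N), t ≫ extHom k φ = 0 → ∃ (W : C) (ε : W ⟶ Z) (_ : Epi ε) (Y N₀ : C)
    (ψ : (Y ⟶ X) ⊗[k] (N₀ ⟶ N)) (w : W ⟶ Y ⊗ N₀), extComp k ψ φ = 0 ∧ w ≫ extHom k ψ = ε ≫ t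

lemma hasExtKernel_zero {X X' N N' : C} : HasExtKernel (0 : (X ⟶ X') ⊗[k] (N ⟶ N')) := fun Z t _ =>
  ⟨Z, 𝟙 Z, inferInstance, X, N, 𝟙 X ⊗ₜ 𝟙 N, t, map_zero _, by simp [extHom_tmul]⟩

/-- First lift so that the composite of φ with S.X₂ ⟶ S.X₃ is killed formally. By left exactness of
Hom and flatness over k, what remains of φ is a tensor φ₂ with values in S.X₁, and a second lift
kills it. -/
lemma hasExtKernel_extension (S : ShortComplex C) (hS : S.ShortExact)
    (h₁ : ∀ {X X' N : C} (φ : (X ⟶ X') ⊗[k] (N ⟶ S.X₁)), HasExtKernel φ)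
    (h₃ : ∀ {X X' N : C} (φ : (X ⟶ X') ⊗[k] (N ⟶ S.X₃)), HasExtKernel φ)
    {X X' N : C} (φ : (X ⟶ X') ⊗[k] (N ⟶ S.X₂)) : HasExtKernel φ := by
  intro Z t ht
  have := hS.mono_f
  obtain ⟨W₁, ε₁, _, Y₁, N₁, ψ₁, w₁, hψ₁, hw₁⟩ := h₃ (extComp k φ (𝟙 X' ⊗ₜ S.g)) Z t (by
    rw [extHom_extComp, reassoc_of% ht, zero_comp])
  have hex : Function.Exact (Linear.rightComp k N₁ S.f) (Linear.rightComp k N₁ S.g) := by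
    intro x
    constructor
    · intro hx
      exact ⟨hS.exact.lift x hx, hS.exact.lift_f _ _⟩
    · rintro ⟨y, rfl⟩
      simp
  obtain ⟨φ₂, hφ₂⟩ := (Module.Flat.lTensor_exact (Y₁ ⟶ X') hex (extComp k ψ₁ φ)).1 (by
    rw [lTensor_rightComp, extComp_assoc, hψ₁])
  rw [lTensor_rightComp] at hφ₂
  obtain ⟨W₂, ε₂, _, Y₂, N₂, ψ₂, w₂, hψ₂, hw₂⟩ := h₁ φ₂ W₁ w₁ (by
    rw [← cancel_mono (X' ◁ S.f), zero_comp, Category.assoc, ← id_tensorHom,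
      ← extHom_tmul (k := k), ← extHom_extComp, hφ₂, extHom_extComp, reassoc_of% hw₁, ht, comp_zero])
  refine ⟨W₂, ε₂ ≫ ε₁, epi_comp _ _, Y₂, N₂, extComp k ψ₂ ψ₁, w₂, ?_, ?_⟩
  · rw [extComp_assoc, ← hφ₂, ← extComp_assoc, hψ₂]
    simp
  · rw [extHom_extComp, reassoc_of% hw₂, hw₁, Category.assoc]

/-- As for linear forms: a morphism to S that vanishes on the common kernel of the n_j is a
combination of them. On ker n_0 induction applies; the remaining difference kills ker n_0, so it is
n_0 followed by an endomorphism of S, a scalar by Schur's lemma. -/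
lemma mem_span_of_comp_eq_zero [IsAlgClosed k] {S : C} [Simple S] : ∀ (r : ℕ) {N : C}
    (n : Fin r → (N ⟶ S)) (g : N ⟶ S),
    (∀ (Z : C) (x : Z ⟶ N), (∀ j, x ≫ n j = 0) → x ≫ g = 0) → g ∈ Submodule.span k (Set.range n) := by
  intro r
  induction r with
  | zero =>
    intro N n g h
    have := h N (𝟙 N) (fun j => j.elim0)
    rw [Category.id_comp] at this
    rw [this]
    exact zero_mem _
  | succ r ih =>
    intro N n g h
    have h1 := ih (fun j => kernel.ι (n 0) ≫ n j.succ) (kernel.ι (n 0) ≫ g) (fun Z x hx => by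
      rw [← Category.assoc]
      refine h Z _ fun j => ?_
      cases j using Fin.cases with
      | zero => simp
      | succ j => simpa using hx j)
    have h2 : Submodule.span k (Set.range fun j : Fin r => kernel.ι (n 0) ≫ n j.succ) =
        (Submodule.span k (Set.range fun j : Fin r => n j.succ)).map
          (Linear.leftComp k S (kernel.ι (n 0))) := by
      rw [Submodule.map_span, ← Set.range_comp]
      rfl
    rw [h2] at h1
    obtain ⟨g', hg', he⟩ := h1
    have h3 : Submodule.span k (Set.range fun j : Fin r => n j.succ) ≤
        Submodule.span k (Set.range n) :=
      Submodule.span_mono (by rintro _ ⟨j, rfl⟩; exact ⟨_, rfl⟩)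
    have he' : kernel.ι (n 0) ≫ (g - g') = 0 := by
      rw [Preadditive.comp_sub, sub_eq_zero]
      exact he.symm
    suffices g - g' ∈ Submodule.span k (Set.range n) by
      have := add_mem this (h3 hg')
      simpa using this
    by_cases h0 : n 0 = 0
    · have : g - g' = 0 := by
        rw [← Category.id_comp (g - g'), ← kernel.lift_ι (n 0) (𝟙 N) (by simp [h0]),
          Category.assoc, he', comp_zero]
      rw [this]
      exact zero_mem _
    · have : Epi (n 0) := epi_of_nonzero_to_simple h0
      obtain ⟨c, hc⟩ : ∃ c, n 0 ≫ c = g - g' :=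
        ⟨Abelian.epiDesc (n 0) _ he', Abelian.comp_epiDesc _ _ _⟩
      obtain ⟨a, ha⟩ := endomorphism_simple_eq_smul_id k c
      rw [← hc, ← ha]
      simp only [Linear.comp_smul, Category.comp_id]
      exact Submodule.smul_mem _ _ (Submodule.subset_span ⟨0, rfl⟩)

lemma exists_common_refinement {S : C} : ∀ (r : ℕ) (Z : Fin r → C) (e : ∀ i, Z i ⟶ S)
    (_ : ∀ i, Epi (e i)), ∃ (N : C) (q : N ⟶ S) (_ : Epi q) (y : ∀ i, N ⟶ Z i), ∀ i, y i ≫ e i = q := by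
  intro r
  induction r with
  | zero => exact fun Z e _ => ⟨S, 𝟙 S, inferInstance, fun i => i.elim0, fun i => i.elim0⟩
  | succ r ih =>
    intro Z e he
    obtain ⟨N, q, hq, y, hy⟩ := ih (fun i => Z i.succ) (fun i => e i.succ) (fun i => he i.succ)
    have := he 0
    refine ⟨pullback (e 0) q, pullback.fst _ _ ≫ e 0, epi_comp _ _,
      fun i => Fin.cases (pullback.fst _ _) (fun i => pullback.snd _ _ ≫ y i) i, fun i => ?_⟩
    cases i using Fin.cases with
    | zero => rfl
    | succ i => simp [hy, pullback.condition]

/-- Write φ = ∑ f_i ⊗ n_i with (n_i) a basis of Hom(N, S). If the n_i have local dual elements m_i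
of N, then the kernel of φ is generated by ∑ x_i ⊗ m_i, for (x_i) the universal solution of ∑ x_i
f_i = 0, and by X ⊗ ⋂ ker n_i. -/
lemma hasExtKernel_simple [IsAlgClosed k] {X X' N S : C} [Simple S] (φ : (X ⟶ X') ⊗[k] (N ⟶ S)) :
    HasExtKernel φ := by
  classical
  intro Z t ht
  set r := Module.finrank k (N ⟶ S)
  let n := Module.finBasis k (N ⟶ S)
  obtain ⟨f, hf⟩ : ∃ f : Fin r → (X ⟶ X'), φ = ∑ i, f i ⊗ₜ n i := by
    clear ht
    induction φ with
    | zero => exact ⟨0, by simp⟩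
    | add a b ha hb =>
      obtain ⟨f, rfl⟩ := ha
      obtain ⟨g, rfl⟩ := hb
      exact ⟨f + g, by simp [TensorProduct.add_tmul, Finset.sum_add_distrib]⟩
    | tmul a b =>
      refine ⟨fun i => n.repr b i • a, ?_⟩
      conv_lhs => rw [← n.sum_repr b, TensorProduct.tmul_sum]
      simp only [TensorProduct.smul_tmul]
      rfl
  -- Otherwise n_i would vanish on the common kernel of the other n_j, hence lie in their span,
  -- against linear independence.
  have hx (i : Fin r) : ∃ (Z : C) (x : Z ⟶ N), (∀ j, j ≠ i → x ≫ n j = 0) ∧ Epi (x ≫ n i) := by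
    by_contra! h
    refine (linearIndependent_iff_notMem_span.1 n.linearIndependent) i ?_
    refine Submodule.span_le.2 ?_ (mem_span_of_comp_eq_zero r (fun j => if j = i then 0 else n j)
      (n i) fun Z x hx => ?_)
    · rintro _ ⟨j, rfl⟩
      dsimp only
      split_ifs with hj
      · exact zero_mem _
      · exact Submodule.subset_span ⟨j, by simpa using hj, rfl⟩
    · by_contra h0
      refine h Z x (fun j hj => ?_) (epi_of_nonzero_to_simple h0)
      simpa [hj] using hx j
  choose Z' x hx0 hxe using hx
  obtain ⟨N₁, q, _, y, hy⟩ := exists_common_refinement r Z' (fun i => x i ≫ n i) hxe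
  let m (i) := y i ≫ x i
  have hm (i j) : m i ≫ n j = if i = j then q else 0 := by
    split_ifs with h
    · subst h; simpa [m] using hy i
    · simp [m, hx0 i j (Ne.symm h)]
  let F : (⨁ fun _ : Fin r => X) ⟶ X' := biproduct.desc f
  let x₁ (i : Fin r) : kernel F ⟶ X := kernel.ι F ≫ biproduct.π _ i
  have hx₁ : ∑ i, x₁ i ≫ f i = 0 := by
    have hF : F = ∑ i, biproduct.π _ i ≫ f i := biproduct.desc_eq
    have := congrArg (kernel.ι F ≫ ·) hF
    simp only [Preadditive.comp_sum, kernel.condition] at this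
    simpa only [x₁, Category.assoc] using this.symm
  -- The family (t ≫ X ◁ n_i) is a morphism to X^r ⊗ S; that φ kills t says that it lands in ker F ⊗
  -- S.
  obtain ⟨t', ht'⟩ := exists_lift_kernel_whiskerRight S F
    (∑ i, t ≫ X ◁ n i ≫ biproduct.ι (fun _ : Fin r => X) i ▷ S) (by
      rw [hf] at ht
      simp only [map_sum, extHom_tmul, Preadditive.comp_sum] at ht
      simp only [Preadditive.sum_comp, Category.assoc, ← comp_whiskerRight, F, biproduct.ι_desc]
      rw [← ht]
      simp only [MonoidalCategory.tensorHom_def']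
      rfl)
  have ht'2 (j) : t' ≫ x₁ j ▷ S = t ≫ X ◁ n j := by
    simp only [x₁, comp_whiskerRight, reassoc_of% ht', Preadditive.sum_comp, Category.assoc]
    rw [Finset.sum_eq_single j]
    · simp [← comp_whiskerRight]
    · intro i _ hij
      simp [← comp_whiskerRight, biproduct.ι_π_ne _ hij]
    · simp
  obtain ⟨W, ε, _, t'', ht''⟩ := surjective_up_to_refinements_of_epi (kernel F ◁ q) t'
  -- This part has the same composites with all n_j as t, so the difference lies in X ⊗ ker ν.
  let s := t'' ≫ ∑ i, (x₁ i ⊗ₘ m i)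
  let ν : N ⟶ ⨁ fun _ : Fin r => S := biproduct.lift n
  have hs (j) : s ≫ X ◁ n j = ε ≫ t ≫ X ◁ n j := by
    rw [← ht'2, reassoc_of% ht'']
    simp only [s, Preadditive.sum_comp, Category.assoc, tensorHom_comp_whiskerLeft, hm]
    rw [Finset.sum_eq_single j]
    · simp [MonoidalCategory.tensorHom_def']
    · intro i _ hij
      simp [hij]
    · simp
  obtain ⟨d, hd⟩ := exists_lift_kernel_whiskerLeft X ν (ε ≫ t - s) (by
    rw [show ν = ∑ i, n i ≫ biproduct.ι (fun _ : Fin r => S) i from biproduct.lift_eq,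
      whiskerLeft_sum, Preadditive.comp_sum]
    refine Finset.sum_eq_zero fun i _ => ?_
    rw [whiskerLeft_comp, ← Category.assoc, Preadditive.sub_comp, hs, Category.assoc, sub_self,
      zero_comp])
  have hν (j) : kernel.ι ν ≫ n j = 0 := by
    have : ν ≫ biproduct.π (fun _ : Fin r => S) j = n j := biproduct.lift_π _ _
    rw [← this, kernel.condition_assoc, zero_comp]
  -- Direct sums in both variables merge the two kinds of generators into one tensor; `inl ⊗ inl`
  -- and `inr ⊗ inr` select the two diagonal blocks.
  refine ⟨W, ε, inferInstance, kernel F ⊞ X, N₁ ⊞ kernel ν,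
    ∑ i, (biprod.fst ≫ x₁ i) ⊗ₜ (biprod.fst ≫ m i) + biprod.snd ⊗ₜ (biprod.snd ≫ kernel.ι ν),
    t'' ≫ (biprod.inl ⊗ₘ biprod.inl) + d ≫ (biprod.inr ⊗ₘ biprod.inr), ?_, ?_⟩
  · have h1 : extComp k (∑ i, (biprod.fst ≫ x₁ i) ⊗ₜ (biprod.fst ≫ m i) :
        (kernel F ⊞ X ⟶ X) ⊗[k] (N₁ ⊞ kernel ν ⟶ N)) φ = 0 := by
      have : extComp k (∑ i, (biprod.fst ≫ x₁ i) ⊗ₜ (biprod.fst ≫ m i) :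
        (kernel F ⊞ X ⟶ X) ⊗[k] (N₁ ⊞ kernel ν ⟶ N)) φ =
          (biprod.fst ≫ ∑ i, x₁ i ≫ f i) ⊗ₜ (biprod.fst ≫ q) := by
        rw [hf, map_sum, Preadditive.comp_sum, TensorProduct.sum_tmul]
        refine Finset.sum_congr rfl fun i _ => ?_
        rw [map_sum, LinearMap.sum_apply, Finset.sum_eq_single i]
        · rw [extComp_tmul, Category.assoc biprod.fst (x₁ i), Category.assoc biprod.fst (m i), hm,
            if_pos rfl]
        · intro j _ hij
          rw [extComp_tmul, Category.assoc (biprod.fst) (m j), hm, if_neg hij]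
          simp
        · simp
      rw [this, hx₁, comp_zero, TensorProduct.zero_tmul]
    have h2 : extComp k ((biprod.snd ⊗ₜ (biprod.snd ≫ kernel.ι ν) :
        (kernel F ⊞ X ⟶ X) ⊗[k] (N₁ ⊞ kernel ν ⟶ N))) φ = 0 := by
      rw [hf, map_sum]
      refine Finset.sum_eq_zero fun i _ => ?_
      rw [extComp_tmul, Category.assoc biprod.snd (kernel.ι ν), hν, comp_zero,
        TensorProduct.tmul_zero]
    rw [map_add, LinearMap.add_apply, h1, h2, add_zero]
  · have h1 : (biprod.inl ⊗ₘ biprod.inl) ≫ extHom k (∑ i, (biprod.fst ≫ x₁ i) ⊗ₜ (biprod.fst ≫ m i) :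
        (kernel F ⊞ X ⟶ X) ⊗[k] (N₁ ⊞ kernel ν ⟶ N)) = ∑ i, (x₁ i ⊗ₘ m i) := by
      simp [extHom_tmul, Preadditive.comp_sum, tensorHom_comp_tensorHom]
    have h2 : (biprod.inr ⊗ₘ biprod.inr) ≫ extHom k (∑ i, (biprod.fst ≫ x₁ i) ⊗ₜ (biprod.fst ≫ m i) :
        (kernel F ⊞ X ⟶ X) ⊗[k] (N₁ ⊞ kernel ν ⟶ N)) = 0 := by
      simp [extHom_tmul, Preadditive.comp_sum, tensorHom_comp_tensorHom]
    have h3 : (biprod.inl ⊗ₘ biprod.inl) ≫ extHom k (biprod.snd ⊗ₜ (biprod.snd ≫ kernel.ι ν) :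
        (kernel F ⊞ X ⟶ X) ⊗[k] (N₁ ⊞ kernel ν ⟶ N)) = 0 := by
      simp [extHom_tmul, tensorHom_comp_tensorHom]
    have h4 : (biprod.inr ⊗ₘ biprod.inr) ≫ extHom k (biprod.snd ⊗ₜ (biprod.snd ≫ kernel.ι ν) :
        (kernel F ⊞ X ⟶ X) ⊗[k] (N₁ ⊞ kernel ν ⟶ N)) = X ◁ kernel.ι ν := by
      simp [extHom_tmul, tensorHom_comp_tensorHom]
    rw [map_add, Preadditive.comp_add, Preadditive.add_comp, Preadditive.add_comp, Category.assoc,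
      Category.assoc, Category.assoc, Category.assoc, h1, h2, h3, h4, hd]
    simp [s]

/-- Over an algebraically closed field, every tensor of morphisms has approximate kernels. -/
lemma hasExtKernel [IsAlgClosed k] {X X' N N' : C} (φ : (X ⟶ X') ⊗[k] (N ⟶ N')) :
    HasExtKernel φ := by
  induction N' using finiteLength_induction C.isNoetherianObject C.isArtinianObject
    generalizing X X' N with
  | h0 N' hN =>
    have : φ = 0 := by
      induction φ with
      | zero => rfl
      | add a b ha hb => rw [ha, hb, add_zero]
      | tmul a b => rw [hN.eq_of_tgt b 0, TensorProduct.tmul_zero]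
    rw [this]
    exact hasExtKernel_zero
  | hs N' hN => exact hasExtKernel_simple φ
  | hext S hS h1 h2 => exact hasExtKernel_extension S hS h1 h2 φ

end External

/-! ### Every representation is locally a retract of some Y ⊠ U. -/

section Refinement
open scoped TensorProduct
variable {k : Type u} [Field k] {C : TensorCat k} {G : Type} [Group G]

/-- The representation of `G` on `Hom(Y, M)` for a representation `M` of `G` in `C`. -/
noncomputable def homRep (Y : C) (M : Action C G) : Representation k G (Y ⟶ M.V) where
  toFun g := Linear.rightComp k Y (M.ρ g)
  map_one' := by
    ext f
    change f ≫ M.ρ 1 = f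
    rw [map_one]
    exact Category.comp_id f
  map_mul' g h := by
    ext f
    change f ≫ M.ρ (g * h) = (f ≫ M.ρ h) ≫ M.ρ g
    rw [map_mul, Category.assoc]
    rfl

variable (G) in
/-- The morphism to the unit of the representations of `G` in `C` given by a morphism to the unit
of `C`. -/
noncomputable def trivAug {W : C} (ε : W ⟶ 𝟙_ C) :
    (trivFunctor C G).obj W ⟶ 𝟙_ (Action C G) :=
  (trivFunctor C G).map ε ≫ Functor.OplaxMonoidal.η (trivFunctor C G)

lemma trivAug_hom {W : C} (ε : W ⟶ 𝟙_ C) : (trivAug G ε).hom = ε := Category.comp_id ε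

/-- The morphism `N ⊗ X ⟶ Hom(Y, X) ⊗ 𝟙` determined by an element of `Hom(Y, X) ⊗ Hom(N, Xᘁ)`. -/
noncomputable def tensorCurry {X D Y N : C} [ExactPairing X D] :
    (Y ⟶ X) ⊗[k] (N ⟶ D) →ₗ[k] (N ⊗ X ⟶ unitObj C k (Y ⟶ X)) :=
  TensorProduct.lift (LinearMap.mk₂ k (fun y n => n ▷ X ≫ ε_ X D ≫ elt C y)
    (by simp) (by simp) (by simp) (by simp))

lemma tensorCurry_tmul {X D Y N : C} [ExactPairing X D] (y : Y ⟶ X) (n : N ⟶ D) :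
    tensorCurry (y ⊗ₜ[k] n) = n ▷ X ≫ ε_ X D ≫ elt C y := rfl

/-- Currying by ψ and then evaluating Hom(Y, X) on Y is the same as applying ψ and contracting D
with X. When ψ lifts the coevaluation, a zigzag identity finishes the computation. -/
lemma tensorCurry_unitPairing {X D Y N : C} [ExactPairing X D] (ψ : (Y ⟶ X) ⊗[k] (N ⟶ D)) :
    (α_ Y N X).hom ≫ Y ◁ tensorCurry ψ ≫ unitPairing (k := k) LinearMap.id =
      extHom k ψ ▷ X ≫ (α_ X D X).hom ≫ X ◁ ε_ X D ≫ (ρ_ X).hom := by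
  induction ψ with
  | zero => simp
  | add a b ha hb => simp [ha, hb]
  | tmul y n =>
    rw [tensorCurry_tmul, extHom_tmul]
    rw [whiskerLeft_comp, whiskerLeft_comp, Category.assoc, Category.assoc, elt_unitPairing,
      MonoidalCategory.tensorHom_def', comp_whiskerRight, Category.assoc,
      associator_naturality_left_assoc, ← whisker_exchange_assoc, rightUnitor_naturality,
      associator_naturality_middle_assoc]
    rfl

lemma tensorCurry_unitMap {X D Y N : C} [ExactPairing X D] (ψ : (Y ⟶ X) ⊗[k] (N ⟶ D)) (f : X ⟶ X) :
    tensorCurry ψ ≫ unitMap (Linear.rightComp k Y f) = tensorCurry (extComp k ψ (f ⊗ₜ 𝟙 D)) := by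
  induction ψ with
  | zero => simp
  | add a b ha hb => simp [ha, hb]
  | tmul y n =>
    rw [extComp_tmul, tensorCurry_tmul, tensorCurry_tmul, Category.assoc, Category.assoc,
      elt_unitMap, Category.comp_id]
    rfl

lemma whiskerLeft_tensorCurry {X D Y N : C} [ExactPairing X D] (ψ : (Y ⟶ X) ⊗[k] (N ⟶ D))
    (f : X ⟶ X) (f' : D ⟶ D) (h : f' ▷ X ≫ ε_ X D = D ◁ f ≫ ε_ X D) :
    N ◁ f ≫ tensorCurry ψ = tensorCurry (extComp k ψ (𝟙 X ⊗ₜ f')) := by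
  induction ψ with
  | zero => simp
  | add a b ha hb => simp [ha, hb]
  | tmul y n =>
    rw [extComp_tmul, tensorCurry_tmul, tensorCurry_tmul, Category.comp_id, comp_whiskerRight,
      Category.assoc, reassoc_of% h, whisker_exchange_assoc]

/-- Every representation of a finite group in a tensor category is, up to an epimorphism onto the
unit with trivial action, a retract of a representation `Y ⊠ U`. -/
lemma exists_refinement [IsAlgClosed k] [Finite G] (M : Action C G) : ∃ (W Y : C) (ε : W ⟶ 𝟙_ C)
    (_ : Epi ε) (U : FDRep k G)
    (a : (trivFunctor C G).obj W ⊗ M ⟶ (trivFunctor C G).obj Y ⊗ (unitRep C G).obj U)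
    (π : (trivFunctor C G).obj Y ⊗ (unitRep C G).obj U ⟶ M),
    a ≫ π = trivAug G ε ▷ M ≫ (λ_ M).hom := by
  classical
  have := Fintype.ofFinite G
  obtain ⟨D, ⟨hD⟩⟩ := C.exists_dual M.V
  let : HasRightDual M.V := ⟨D⟩
  let ρ' (g : G) : D ⟶ D := (show M.V ⟶ M.V from M.ρ g)ᘁ
  have h1 (g : G) : η_ M.V D ≫ M.V ◁ ρ' g = η_ M.V D ≫ M.ρ g ▷ D :=
    coevaluation_comp_rightAdjointMate _
  have h2 (g : G) : ρ' g ▷ M.V ≫ ε_ M.V D = D ◁ M.ρ g ≫ ε_ M.V D :=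
    rightAdjointMate_comp_evaluation _
  -- The sum of copies of D packs the equations ρ(g) ⊗ 1 = 1 ⊗ ρ(g)ᘁ, one for each g, into one
  -- tensor. The coevaluation satisfies them all.
  let φ : (M.V ⟶ M.V) ⊗[k] (D ⟶ ⨁ fun _ : G => D) := ∑ g : G,
    ((show M.V ⟶ M.V from M.ρ g) ⊗ₜ biproduct.ι (fun _ : G => D) g -
      𝟙 M.V ⊗ₜ (ρ' g ≫ biproduct.ι (fun _ : G => D) g))
  obtain ⟨W, ε, hε, Y, N, ψ, w, hψ, hw⟩ := hasExtKernel φ _ (η_ M.V D) (by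
    simp only [φ, map_sum, map_sub, extHom_tmul, Preadditive.comp_sum, Preadditive.comp_sub]
    refine Finset.sum_eq_zero fun g _ => ?_
    rw [sub_eq_zero, MonoidalCategory.tensorHom_def, id_tensorHom, whiskerLeft_comp,
      reassoc_of% h1])
  -- Projecting to the summand at g recovers each equation, now for the formal tensor ψ.
  have hψg (g : G) : extComp k ψ ((show M.V ⟶ M.V from M.ρ g) ⊗ₜ 𝟙 D) =
      extComp k ψ (𝟙 M.V ⊗ₜ ρ' g) := by
    have : extComp k φ (𝟙 M.V ⊗ₜ biproduct.π (fun _ : G => D) g) =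
        (show M.V ⟶ M.V from M.ρ g) ⊗ₜ 𝟙 D - 𝟙 M.V ⊗ₜ ρ' g := by
      simp only [φ, map_sum, map_sub, LinearMap.sum_apply, LinearMap.sub_apply, extComp_tmul]
      rw [Finset.sum_eq_single g]
      · simp
      · intro h _ hg
        simp [biproduct.ι_π_ne _ hg]
      · simp
    rw [← sub_eq_zero, ← map_sub, ← this, ← extComp_assoc, hψ]
    simp
  let U : FDRep k G := FDRep.of (homRep Y M)
  let a₀ : W ⊗ M.V ⟶ Y ⊗ unitObj C k (Y ⟶ M.V) :=
    w ▷ M.V ≫ (α_ Y N M.V).hom ≫ Y ◁ tensorCurry ψ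
  -- The action on M dualizes to one on D, and the invariance of ψ moves it to Hom(Y, M). W, Y and N
  -- carry the trivial action.
  have ha₀ (g : G) : W ◁ M.ρ g ≫ a₀ = a₀ ≫ Y ◁ unitMap (homRep Y M g) := by
    have e : N ◁ M.ρ g ≫ tensorCurry ψ = tensorCurry ψ ≫ unitMap (homRep Y M g) := by
      rw [whiskerLeft_tensorCurry ψ _ (ρ' g) (h2 g), ← hψg]
      exact (tensorCurry_unitMap ψ _).symm
    simp only [a₀, Category.assoc, ← whiskerLeft_comp]
    rw [← e]
    simp [whisker_exchange_assoc]
  let a : (trivFunctor C G).obj W ⊗ M ⟶ (trivFunctor C G).obj Y ⊗ (unitRep C G).obj U :=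
    ⟨a₀, fun g => by
      change (𝟙 W ⊗ₘ M.ρ g) ≫ a₀ = a₀ ≫ (𝟙 Y ⊗ₘ unitMap (homRep Y M g))
      rw [id_tensorHom, id_tensorHom, ha₀]⟩
  let π : (trivFunctor C G).obj Y ⊗ (unitRep C G).obj U ⟶ M :=
    equivariantPairing U (LinearMap.id : (Y ⟶ M.V) →ₗ[k] (Y ⟶ M.V)) fun g x => by
      exact Category.id_comp _
  refine ⟨W, Y, ε, hε, U, a, π, Action.Hom.ext ?_⟩
  simp only [Action.comp_hom, Action.whiskerRight_hom, Action.leftUnitor_hom_hom, trivAug_hom]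
  change (w ▷ M.V ≫ (α_ Y N M.V).hom ≫ Y ◁ tensorCurry ψ) ≫
    unitPairing (k := k) (LinearMap.id : (Y ⟶ M.V) →ₗ[k] (Y ⟶ M.V)) = ε ▷ M.V ≫ (λ_ M.V).hom
  rw [Category.assoc, Category.assoc, tensorCurry_unitPairing, ← comp_whiskerRight_assoc, hw,
    comp_whiskerRight_assoc, ExactPairing.evaluation_coevaluation_assoc]
  simp

end Refinement

/-! ### Comparison of two monoidal functors on objects L Y ⊗ R U. -/

section BoxComparison
open Functor.LaxMonoidal
variable {C B A E : Type*} [Category* C] [MonoidalCategory C] [Category* B] [MonoidalCategory B]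
  [Category* A] [MonoidalCategory A] [Category* E] [MonoidalCategory E]
  {L : C ⥤ A} {R : B ⥤ A} {T₁ T₂ : A ⥤ E} [T₁.Monoidal] [T₂.Monoidal]

/-- The component at `F.obj X` of a natural transformation between composites with `F`. -/
def compApp {C A E : Type*} [Category* C] [Category* A] [Category* E] {F : C ⥤ A} {T₁ T₂ : A ⥤ E}
    (l : F ⋙ T₁ ⟶ F ⋙ T₂) (X : C) : T₁.obj (F.obj X) ⟶ T₂.obj (F.obj X) := l.app X

/-- The comparison morphism of two monoidal functors on `L Y ⊗ R U` determined by comparison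
morphisms on `L Y` and `R U`. -/
def boxComparison (l : L ⋙ T₁ ⟶ L ⋙ T₂) (r : R ⋙ T₁ ⟶ R ⋙ T₂) (Y : C) (U : B) :
    T₁.obj (L.obj Y ⊗ R.obj U) ⟶ T₂.obj (L.obj Y ⊗ R.obj U) :=
  Functor.OplaxMonoidal.δ T₁ _ _ ≫ (compApp l Y ⊗ₘ compApp r U) ≫ μ T₂ _ _

lemma μ_boxComparison (l : L ⋙ T₁ ⟶ L ⋙ T₂) (r : R ⋙ T₁ ⟶ R ⋙ T₂) (Y : C) (U : B) :
    μ T₁ (L.obj Y) (R.obj U) ≫ boxComparison l r Y U =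
      (compApp l Y ⊗ₘ compApp r U) ≫ μ T₂ (L.obj Y) (R.obj U) := by
  rw [boxComparison]
  exact Functor.Monoidal.μ_δ_assoc _ _ _ _

lemma boxComparison_comp {T₃ : A ⥤ E} [T₃.Monoidal] (l : L ⋙ T₁ ⟶ L ⋙ T₂) (r : R ⋙ T₁ ⟶ R ⋙ T₂)
    (l' : L ⋙ T₂ ⟶ L ⋙ T₃) (r' : R ⋙ T₂ ⟶ R ⋙ T₃) (Y : C) (U : B) :
    boxComparison l r Y U ≫ boxComparison l' r' Y U =
      boxComparison (l ≫ l') (r ≫ r') Y U := by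
  rw [← cancel_epi (μ T₁ _ _), reassoc_of% μ_boxComparison, μ_boxComparison, μ_boxComparison,
    tensorHom_comp_tensorHom_assoc]
  rfl

lemma boxComparison_id (Y : C) (U : B) :
    boxComparison (𝟙 (L ⋙ T₁)) (𝟙 (R ⋙ T₁)) Y U = 𝟙 _ := by
  rw [← cancel_epi (μ T₁ _ _), μ_boxComparison]
  exact (congrArg (· ≫ _) (id_tensorHom_id _ _)).trans
    ((Category.id_comp _).trans (Category.comp_id _).symm)

lemma boxComparison_map_tensor (l : L ⋙ T₁ ⟶ L ⋙ T₂) (r : R ⋙ T₁ ⟶ R ⋙ T₂) {Y Y' : C} {U U' : B}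
    (y : Y ⟶ Y') (x : U ⟶ U') :
    T₁.map (L.map y ⊗ₘ R.map x) ≫ boxComparison l r Y' U' =
      boxComparison l r Y U ≫ T₂.map (L.map y ⊗ₘ R.map x) := by
  have hl : T₁.map (L.map y) ≫ compApp l Y' = compApp l Y ≫ T₂.map (L.map y) := l.naturality y
  have hr : T₁.map (R.map x) ≫ compApp r U' = compApp r U ≫ T₂.map (R.map x) := r.naturality x
  rw [← cancel_epi (μ T₁ _ _), reassoc_of% μ_boxComparison, ← μ_natural_assoc, μ_boxComparison,
    ← μ_natural, tensorHom_comp_tensorHom_assoc, tensorHom_comp_tensorHom_assoc, hl, hr]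

lemma boxComparison_whiskerLeft [L.Monoidal] (l : L ⋙ T₁ ⟶ L ⋙ T₂) [NatTrans.IsMonoidal l]
    (r : R ⋙ T₁ ⟶ R ⋙ T₂) (W Y : C) (U : B) :
    μ T₁ (L.obj W) (L.obj Y ⊗ R.obj U) ≫ T₁.map ((α_ _ _ _).inv ≫ μ L W Y ▷ R.obj U) ≫
        boxComparison l r (W ⊗ Y) U =
      (compApp l W ⊗ₘ boxComparison l r Y U) ≫ μ T₂ (L.obj W) (L.obj Y ⊗ R.obj U) ≫
        T₂.map ((α_ _ _ _).inv ≫ μ L W Y ▷ R.obj U) := by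
  have hl : (μ T₁ (L.obj W) (L.obj Y) ≫ T₁.map (μ L W Y)) ≫ compApp l (W ⊗ Y) =
      (compApp l W ⊗ₘ compApp l Y) ≫ μ T₂ (L.obj W) (L.obj Y) ≫ T₂.map (μ L W Y) :=
    NatTrans.IsMonoidal.tensor (τ := l) W Y
  rw [← cancel_epi (T₁.obj (L.obj W) ◁ μ T₁ (L.obj Y) (R.obj U)), whiskerLeft_comp_tensorHom_assoc,
    μ_boxComparison, T₁.map_comp, T₂.map_comp, Category.assoc, associativity_inv_assoc,
    ← μ_natural_left_assoc, μ_boxComparison, ← tensorHom_comp_whiskerLeft_assoc,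
    associativity_inv_assoc, associator_inv_naturality_assoc, ← μ_natural_left,
    ← comp_whiskerRight_assoc, whiskerRight_comp_tensorHom_assoc, hl,
    ← comp_whiskerRight_assoc, tensorHom_comp_whiskerRight_assoc]

lemma boxComparison_tensor [BraidedCategory A] [BraidedCategory E] {T₁ T₂ : A ⥤ E} [T₁.Braided]
    [T₂.Braided] [L.Monoidal] [R.Monoidal] (l : L ⋙ T₁ ⟶ L ⋙ T₂)
    [NatTrans.IsMonoidal l] (r : R ⋙ T₁ ⟶ R ⋙ T₂) [NatTrans.IsMonoidal r] (Y Y' : C) (U U' : B) :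
    μ T₁ (L.obj Y ⊗ R.obj U) (L.obj Y' ⊗ R.obj U') ≫
        T₁.map (tensorμ _ _ _ _ ≫ (μ L Y Y' ⊗ₘ μ R U U')) ≫ boxComparison l r (Y ⊗ Y') (U ⊗ U') =
      (boxComparison l r Y U ⊗ₘ boxComparison l r Y' U') ≫
        μ T₂ (L.obj Y ⊗ R.obj U) (L.obj Y' ⊗ R.obj U') ≫
          T₂.map (tensorμ _ _ _ _ ≫ (μ L Y Y' ⊗ₘ μ R U U')) := by
  have hl : (μ T₁ (L.obj Y) (L.obj Y') ≫ T₁.map (μ L Y Y')) ≫ compApp l (Y ⊗ Y') =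
      (compApp l Y ⊗ₘ compApp l Y') ≫ μ T₂ (L.obj Y) (L.obj Y') ≫ T₂.map (μ L Y Y') :=
    NatTrans.IsMonoidal.tensor (τ := l) Y Y'
  have hr : (μ T₁ (R.obj U) (R.obj U') ≫ T₁.map (μ R U U')) ≫ compApp r (U ⊗ U') =
      (compApp r U ⊗ₘ compApp r U') ≫ μ T₂ (R.obj U) (R.obj U') ≫ T₂.map (μ R U U') :=
    NatTrans.IsMonoidal.tensor (τ := r) U U'
  -- A tensor product of epimorphisms need not be epi in a general monoidal category; this one is an
  -- isomorphism.
  rw [← cancel_epi (Functor.Monoidal.μIso T₁ (L.obj Y) (R.obj U) ⊗ᵢ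
      Functor.Monoidal.μIso T₁ (L.obj Y') (R.obj U')).hom]
  change (μ T₁ _ _ ⊗ₘ μ T₁ _ _) ≫ _ = (μ T₁ _ _ ⊗ₘ μ T₁ _ _) ≫ _
  rw [
    tensorHom_comp_tensorHom_assoc, μ_boxComparison, μ_boxComparison, T₁.map_comp, T₂.map_comp,
    Category.assoc, ← tensorμ_comp_μ_tensorHom_μ_comp_μ_assoc, ← tensorHom_comp_tensorHom_assoc,
    ← tensorμ_comp_μ_tensorHom_μ_comp_μ_assoc, ← μ_natural, ← μ_natural_assoc, μ_boxComparison,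
    tensorHom_comp_tensorHom_assoc, tensorHom_comp_tensorHom_assoc, hl, hr,
    tensorμ_natural_assoc, tensorHom_comp_tensorHom_assoc, tensorHom_comp_tensorHom_assoc]
  simp only [Category.assoc]

end BoxComparison

/-! ### Descent of the comparison to all objects. -/

section Extension
open Functor.LaxMonoidal
variable {C B A : Type*} [Category* C] [MonoidalCategory C] [Category* B] [MonoidalCategory B]
  [Category* A] [MonoidalCategory A] [SymmetricCategory A] [Preadditive A] {k : Type u} [Field k]
  {E : TensorCat k}

/-- The morphisms between the objects `L Y ⊗ R U` are sums of tensor products of morphisms. -/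
def IsBoxSpanned (L : C ⥤ A) (R : B ⥤ A) : Prop :=
  ∀ (Y Y' : C) (U U' : B) (f : L.obj Y ⊗ R.obj U ⟶ L.obj Y' ⊗ R.obj U'),
    f ∈ AddSubgroup.closure {f | ∃ (y : Y ⟶ Y') (x : U ⟶ U'), L.map y ⊗ₘ R.map x = f}

/-- Up to morphisms `L W ⟶ 𝟙` that become epimorphisms after `T`, every object is a retract of
an object of the form `L Y ⊗ R U`. -/
def IsBoxRefinable (L : C ⥤ A) (R : B ⥤ A) (T : A ⥤ E) : Prop :=
  ∀ M : A, ∃ (W Y : C) (e : L.obj W ⟶ 𝟙_ A) (_ : Epi (T.map e)) (U : B)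
    (a : L.obj W ⊗ M ⟶ L.obj Y ⊗ R.obj U) (π : L.obj Y ⊗ R.obj U ⟶ M), a ≫ π = e ▷ M ≫ (λ_ M).hom

lemma epi_map_whiskerRight (T : A ⥤ E) [T.Monoidal] {W : A} (e : W ⟶ 𝟙_ A) [Epi (T.map e)] (M : A) :
    Epi (T.map (e ▷ M ≫ (λ_ M).hom)) := by
  rw [T.map_comp, Functor.Monoidal.map_whiskerRight]
  infer_instance

lemma IsBoxRefinable.exists_epi {L : C ⥤ A} {R : B ⥤ A} {T : A ⥤ E} [T.Monoidal]
    (h : IsBoxRefinable L R T) (M : A) :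
    ∃ (Y : C) (U : B) (π : L.obj Y ⊗ R.obj U ⟶ M), Epi (T.map π) := by
  obtain ⟨W, Y, e, he, U, a, π, hπ⟩ := h M
  have := epi_map_whiskerRight T e M
  rw [← hπ, T.map_comp] at this
  exact ⟨Y, U, π, epi_of_epi (T.map a) _⟩

lemma IsBoxRefinable.natTrans_ext {L : C ⥤ A} {R : B ⥤ A} {T T' : A ⥤ E} [T.Monoidal]
    (h : IsBoxRefinable L R T) {α β : T ⟶ T'}
    (hαβ : ∀ Y U, α.app (L.obj Y ⊗ R.obj U) = β.app (L.obj Y ⊗ R.obj U)) : α = β := by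
  ext M
  obtain ⟨Y, U, π, hπ⟩ := h.exists_epi M
  rw [← cancel_epi (T.map π), α.naturality, β.naturality, hαβ]

variable {L : C ⥤ A} {R : B ⥤ A} {T₁ T₂ : A ⥤ E}

lemma IsBoxSpanned.boxComparison_natural [T₁.Monoidal] [T₂.Monoidal] [T₁.Additive] [T₂.Additive]
    (h : IsBoxSpanned L R) (l : L ⋙ T₁ ⟶ L ⋙ T₂) (r : R ⋙ T₁ ⟶ R ⋙ T₂) {Y Y' : C} {U U' : B}
    (f : L.obj Y ⊗ R.obj U ⟶ L.obj Y' ⊗ R.obj U') :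
    T₁.map f ≫ boxComparison l r Y' U' = boxComparison l r Y U ≫ T₂.map f := by
  induction h _ _ _ _ f using AddSubgroup.closure_induction with
  | mem f hf =>
    obtain ⟨y, x, rfl⟩ := hf
    exact boxComparison_map_tensor l r y x
  | zero => simp
  | add f g _ _ hf hg => simp [T₁.map_add, T₂.map_add, hf, hg]
  | neg f _ hf => simp [T₁.map_neg, T₂.map_neg, hf]

/-- The source is isomorphic to L(W ⊗ Y) ⊗ R U, again of the form covered by naturality; monoidality
of `l` identifies the comparison there. -/
lemma IsBoxSpanned.boxComparison_natural_whiskerLeft [T₁.Monoidal] [T₂.Monoidal] [T₁.Additive]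
    [T₂.Additive] [L.Monoidal] (h : IsBoxSpanned L R) (l : L ⋙ T₁ ⟶ L ⋙ T₂) [NatTrans.IsMonoidal l]
    (r : R ⋙ T₁ ⟶ R ⋙ T₂) {W Y Y' : C} {U U' : B}
    (f : L.obj W ⊗ (L.obj Y ⊗ R.obj U) ⟶ L.obj Y' ⊗ R.obj U') :
    μ T₁ _ _ ≫ T₁.map f ≫ boxComparison l r Y' U' =
      (compApp l W ⊗ₘ boxComparison l r Y U) ≫ μ T₂ _ _ ≫ T₂.map f := by
  obtain ⟨f, rfl⟩ : ∃ f', f = ((α_ _ _ _).inv ≫ μ L W Y ▷ R.obj U) ≫ f' :=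
    ⟨Functor.OplaxMonoidal.δ L W Y ▷ R.obj U ≫ (α_ _ _ _).hom ≫ f, by
      simp [← comp_whiskerRight_assoc]⟩
  rw [T₁.map_comp, Category.assoc, h.boxComparison_natural, reassoc_of% boxComparison_whiskerLeft]
  simp only [T₂.map_comp, Category.assoc]

/-- The comparison morphisms on the objects `L Y ⊗ R U` extend to every object. -/
lemma exists_extension_app [T₁.Monoidal] [T₂.Monoidal] [T₁.Additive]
    [T₂.Additive] [L.Monoidal] (hs : IsBoxSpanned L R) (hr : IsBoxRefinable L R T₁)
    (l : L ⋙ T₁ ⟶ L ⋙ T₂) [NatTrans.IsMonoidal l] (r : R ⋙ T₁ ⟶ R ⋙ T₂) (M : A) :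
    ∃ α : T₁.obj M ⟶ T₂.obj M, ∀ (Y : C) (U : B) (f : L.obj Y ⊗ R.obj U ⟶ M),
      T₁.map f ≫ α = boxComparison l r Y U ≫ T₂.map f := by
  obtain ⟨W, Y, e, he, U, a, π, hπ⟩ := hr M
  have hM := epi_map_whiskerRight T₁ e M
  rw [← hπ, T₁.map_comp] at hM
  have hepi : Epi (T₁.map π) := epi_of_epi (T₁.map a) _
  have hb {Y' : C} {U' : B} (f : L.obj Y' ⊗ R.obj U' ⟶ M) :
      (L.obj W ◁ f ≫ a) ≫ π = (e ▷ _ ≫ (λ_ _).hom) ≫ f := by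
    rw [Category.assoc, hπ, whisker_exchange_assoc, leftUnitor_naturality, Category.assoc]
  -- The square `hb` replaces f by a morphism from L W ⊗ (L Y' ⊗ R U') to L Y ⊗ R U, where
  -- naturality is known.
  have key {Y' : C} {U' : B} (f : L.obj Y' ⊗ R.obj U' ⟶ M) :
      T₁.map (L.obj W ◁ f ≫ a) ≫ boxComparison l r Y U ≫ T₂.map π =
        T₁.map (e ▷ _ ≫ (λ_ _).hom) ≫ boxComparison l r Y' U' ≫ T₂.map f := by
    rw [← cancel_epi (μ T₁ _ _), reassoc_of% hs.boxComparison_natural_whiskerLeft l r,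
      reassoc_of% hs.boxComparison_natural_whiskerLeft l r, ← T₂.map_comp, ← T₂.map_comp, hb]
  -- It suffices to check this after tensoring the kernel with the epimorphism T₁ e. There `key` for
  -- f = π rewrites it as a composite that starts with T₁ π on its own kernel. No exactness of `T₁`
  -- enters.
  have hker : kernel.ι (T₁.map π) ≫ boxComparison l r Y U ≫ T₂.map π = 0 := by
    rw [← cancel_epi (T₁.map e ▷ kernel (T₁.map π) ≫
      Functor.OplaxMonoidal.η T₁ ▷ _ ≫ (λ_ _).hom), comp_zero]
    have h1 := congrArg (T₁.obj (L.obj W) ◁ kernel.ι (T₁.map π) ≫ μ T₁ _ _ ≫ ·) (key π)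
    have h2 : T₁.obj (L.obj W) ◁ kernel.ι (T₁.map π) ≫ μ T₁ _ _ ≫
        T₁.map (L.obj W ◁ π ≫ a) = 0 := by
      rw [T₁.map_comp, ← μ_natural_right_assoc, ← whiskerLeft_comp_assoc, kernel.condition]
      simp
    rw [reassoc_of% h2, zero_comp, T₁.map_comp, Category.assoc, ← μ_natural_left_assoc,
      whisker_exchange_assoc, Functor.Monoidal.map_leftUnitor] at h1
    rw [h1]
    simp only [Category.assoc, Functor.Monoidal.μ_δ_assoc, whisker_exchange_assoc,
      leftUnitor_naturality_assoc]
  obtain ⟨α, hα⟩ : ∃ α, T₁.map π ≫ α = boxComparison l r Y U ≫ T₂.map π :=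
    ⟨Abelian.epiDesc _ _ hker, Abelian.comp_epiDesc _ _ hker⟩
  refine ⟨α, fun Y' U' f => ?_⟩
  have := epi_map_whiskerRight T₁ e (L.obj Y' ⊗ R.obj U')
  rw [← cancel_epi (T₁.map (e ▷ (L.obj Y' ⊗ R.obj U') ≫ (λ_ _).hom)), ← T₁.map_comp_assoc, ← hb,
    ← key, ← hα, T₁.map_comp, Category.assoc]

lemma ε_map_tensorUnit (T : A ⥤ E) [T.Monoidal] (L : C ⥤ A) (R : B ⥤ A) [L.Monoidal] [R.Monoidal] :
    (λ_ (𝟙_ E)).inv ≫ ((ε T ≫ T.map (ε L)) ⊗ₘ (ε T ≫ T.map (ε R))) ≫ μ T _ _ ≫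
      T.map ((Functor.OplaxMonoidal.η L ⊗ₘ Functor.OplaxMonoidal.η R) ≫ (λ_ _).hom) = ε T := by
  rw [← tensorHom_comp_tensorHom, Category.assoc, μ_natural_assoc, ← T.map_comp,
    tensorHom_comp_tensorHom_assoc, Functor.Monoidal.ε_η, Functor.Monoidal.ε_η, id_tensorHom_id,
    Category.id_comp, MonoidalCategory.tensorHom_def', Category.assoc,
    ← Functor.LaxMonoidal.left_unitality, leftUnitor_naturality, Iso.inv_hom_id_assoc]

/-- Monoidal natural transformations on two jointly generating subcategories extend to a monoidal
natural transformation. -/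
lemma exists_extension [T₁.Braided] [T₂.Braided] [T₁.Additive]
    [T₂.Additive] [L.Monoidal] [R.Monoidal] (hs : IsBoxSpanned L R) (hr : IsBoxRefinable L R T₁)
    (l : L ⋙ T₁ ⟶ L ⋙ T₂) [NatTrans.IsMonoidal l] (r : R ⋙ T₁ ⟶ R ⋙ T₂) [NatTrans.IsMonoidal r] :
    ∃ α : T₁ ⟶ T₂, NatTrans.IsMonoidal α ∧
      ∀ (Y : C) (U : B), α.app (L.obj Y ⊗ R.obj U) = boxComparison l r Y U := by
  choose α hα using exists_extension_app hs hr l r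
  have hα' (Y : C) (U : B) : α (L.obj Y ⊗ R.obj U) = boxComparison l r Y U := by
    simpa using hα _ Y U (𝟙 _)
  let τ : T₁ ⟶ T₂ :=
    { app := α
      naturality := fun M N f => by
        obtain ⟨Y, U, π, hπ⟩ := hr.exists_epi M
        rw [← cancel_epi (T₁.map π), ← T₁.map_comp_assoc, hα, reassoc_of% hα, T₂.map_comp] }
  refine ⟨τ, ⟨?_, fun M N => ?_⟩, hα'⟩
  · change ε T₁ ≫ α _ = ε T₂
    have h1 := hα (𝟙_ A) (𝟙_ C) (𝟙_ B)
      ((Functor.OplaxMonoidal.η L ⊗ₘ Functor.OplaxMonoidal.η R) ≫ (λ_ _).hom)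
    have hl : (ε T₁ ≫ T₁.map (ε L)) ≫ compApp l (𝟙_ C) = ε T₂ ≫ T₂.map (ε L) :=
      NatTrans.IsMonoidal.unit (τ := l)
    have hr : (ε T₁ ≫ T₁.map (ε R)) ≫ compApp r (𝟙_ B) = ε T₂ ≫ T₂.map (ε R) :=
      NatTrans.IsMonoidal.unit (τ := r)
    rw [← ε_map_tensorUnit T₁ L R, Category.assoc, Category.assoc, Category.assoc, h1,
      reassoc_of% μ_boxComparison, tensorHom_comp_tensorHom_assoc, hl, hr, ε_map_tensorUnit]
  · change μ T₁ M N ≫ α _ = (α _ ⊗ₘ α _) ≫ μ T₂ M N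
    obtain ⟨Y, U, π, hπ⟩ := hr.exists_epi M
    obtain ⟨Y', U', π', hπ'⟩ := hr.exists_epi N
    let t := tensorμ (L.obj Y) (R.obj U) (L.obj Y') (R.obj U') ≫ (μ L Y Y' ⊗ₘ μ R U U')
    -- The isomorphism t identifies the product of two box objects with L(Y ⊗ Y') ⊗ R(U ⊗ U'), so π
    -- ⊗ π' becomes a morphism f covered by `hα`.
    obtain ⟨f, hf⟩ : ∃ f, π ⊗ₘ π' = t ≫ f :=
      ⟨(Functor.OplaxMonoidal.δ L Y Y' ⊗ₘ Functor.OplaxMonoidal.δ R U U') ≫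
        tensorδ _ _ _ _ ≫ (π ⊗ₘ π'), by
          simp [t]⟩
    rw [← cancel_epi (T₁.map π ⊗ₘ T₁.map π'), μ_natural_assoc, tensorHom_comp_tensorHom_assoc,
      hα, hα, hf, T₁.map_comp, Category.assoc, hα, reassoc_of% boxComparison_tensor l r,
      ← T₂.map_comp, ← hf, ← tensorHom_comp_tensorHom_assoc, μ_natural]

/-- Two monoidal functors are isomorphic if their restrictions to two jointly generating
subcategories are. -/
lemma MonoidalIso.of_restrict [T₁.Braided] [T₂.Braided] [T₁.Additive]
    [T₂.Additive] [L.Monoidal] [R.Monoidal] (hs : IsBoxSpanned L R) (hr₁ : IsBoxRefinable L R T₁)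
    (hr₂ : IsBoxRefinable L R T₂) (hl : MonoidalIso (L ⋙ T₁) (L ⋙ T₂))
    (hr : MonoidalIso (R ⋙ T₁) (R ⋙ T₂)) : MonoidalIso T₁ T₂ := by
  obtain ⟨l, _⟩ := hl
  obtain ⟨r, _⟩ := hr
  obtain ⟨α, hα, hα'⟩ := exists_extension hs hr₁ l.hom r.hom
  obtain ⟨β, hβ, hβ'⟩ := exists_extension hs hr₂ l.inv r.inv
  -- The extensions of the two inverse comparisons are mutually inverse because it is enough to test
  -- on box objects.
  refine ⟨⟨α, β, hr₁.natTrans_ext fun Y U => ?_, hr₂.natTrans_ext fun Y U => ?_⟩, hα⟩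
  · rw [NatTrans.comp_app, hα', hβ', boxComparison_comp, l.hom_inv_id, r.hom_inv_id,
      boxComparison_id]
    rfl
  · rw [NatTrans.comp_app, hα', hβ', boxComparison_comp, l.inv_hom_id, r.inv_hom_id,
      boxComparison_id]
    rfl

end Extension

/-! ### Box objects among the representations of G in C. -/

section Spanned
variable {k : Type u} [Field k] {C : TensorCat k} {G : Type} [Group G]

/-- The contraction of `Hom(Y, Y' ⊗ W)` with a linear form on `Hom(Y, Y')`. -/
noncomputable def contractHom {Y Y' : C} {W : Type u} [AddCommGroup W] [Module k W]
    [Module.Finite k W] (φ : (Y ⟶ Y') →ₗ[k] k) : (Y ⟶ Y' ⊗ unitObj C k W) →ₗ[k] W :=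
  ∑ j, (φ ∘ₗ Linear.rightComp k Y (Y' ◁ unitπ k C W j ≫ (ρ_ Y').hom)).smulRight
    (Module.finBasis k W j)

lemma contractHom_apply {Y Y' : C} {W : Type u} [AddCommGroup W] [Module k W]
    [Module.Finite k W] (φ : (Y ⟶ Y') →ₗ[k] k) (h : Y ⟶ Y' ⊗ unitObj C k W) :
    contractHom φ h = ∑ j, φ (h ≫ Y' ◁ unitπ k C W j ≫ (ρ_ Y').hom) • Module.finBasis k W j := by
  simp only [contractHom, LinearMap.sum_apply]
  rfl

lemma contractHom_elt {Y Y' : C} {W : Type u} [AddCommGroup W] [Module k W]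
    [Module.Finite k W] (φ : (Y ⟶ Y') →ₗ[k] k) (y : Y ⟶ Y') (x : W) :
    contractHom φ (y ≫ (ρ_ Y').inv ≫ Y' ◁ elt C x) = φ y • x := by
  rw [contractHom_apply]
  conv_rhs => rw [← (Module.finBasis k W).sum_repr x, Finset.smul_sum]
  refine Finset.sum_congr rfl fun j _ => ?_
  rw [smul_smul, Category.assoc, Category.assoc, ← whiskerLeft_comp_assoc, elt_unitπ]
  simp [mul_comm]

lemma sum_rightUnitor_elt {Y Y' : C} {W : Type u} [AddCommGroup W] [Module k W]
    [Module.Finite k W] (h : Y ⟶ Y' ⊗ unitObj C k W) :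
    h = ∑ j, (h ≫ Y' ◁ unitπ k C W j ≫ (ρ_ Y').hom) ≫ (ρ_ Y').inv ≫
      Y' ◁ elt C (Module.finBasis k W j) := by
  simp only [Category.assoc, Iso.hom_inv_id_assoc, elt_basis, ← whiskerLeft_comp]
  rw [← Preadditive.comp_sum, ← whiskerLeft_sum, sum_unitπ_unitι, whiskerLeft_id, Category.comp_id]

lemma contractHom_unitMap {Y Y' : C} {W W' : Type u} [AddCommGroup W] [Module k W]
    [Module.Finite k W] [AddCommGroup W'] [Module k W'] [Module.Finite k W']
    (φ : (Y ⟶ Y') →ₗ[k] k) (h : Y ⟶ Y' ⊗ unitObj C k W) (f : W →ₗ[k] W') :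
    contractHom φ (h ≫ Y' ◁ unitMap f) = f (contractHom φ h) := by
  conv_lhs => rw [sum_rightUnitor_elt h]
  rw [contractHom_apply φ h]
  simp only [Preadditive.sum_comp, map_sum, map_smul]
  refine Finset.sum_congr rfl fun j _ => ?_
  rw [Category.assoc, Category.assoc (ρ_ Y').inv, ← whiskerLeft_comp, elt_unitMap, contractHom_elt]

lemma sum_contractHom {Y Y' : C} {W : Type u} [AddCommGroup W] [Module k W]
    [Module.Finite k W] {ι : Type*} [Fintype ι] (b : Module.Basis ι k (Y ⟶ Y'))
    (h : Y ⟶ Y' ⊗ unitObj C k W) :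
    ∑ m, b m ≫ (ρ_ Y').inv ≫ Y' ◁ elt C (contractHom (b.coord m) h) = h := by
  conv_rhs => rw [sum_rightUnitor_elt h]
  simp only [contractHom_apply, map_sum, map_smul, whiskerLeft_sum, MonoidalLinear.whiskerLeft_smul,
    Preadditive.comp_sum, Linear.comp_smul]
  rw [Finset.sum_comm]
  refine Finset.sum_congr rfl fun j _ => ?_
  conv_rhs => rw [← b.sum_repr (h ≫ Y' ◁ unitπ k C W j ≫ (ρ_ Y').hom), Preadditive.sum_comp]
  simp

/-- Hom(Y ⊠ U, Y' ⊠ U') = Hom(Y, Y') ⊗ Hom_G(U, U'): expand f in a basis of Hom(Y, Y'). The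
coefficients are linear maps U → U', and they are equivariant because contraction commutes with
linear maps in the second factor. -/
lemma isBoxSpanned_action : IsBoxSpanned (trivFunctor C G) (unitRep C G) := by
  intro Y Y' U U' f
  have := finiteDimensional_hom Y Y'
  let b := Module.finBasis k (Y ⟶ Y')
  let f₀ : Y ⊗ unitObj C k U.V ⟶ Y' ⊗ unitObj C k U'.V := f.hom
  have hf₀ (g : G) : Y ◁ unitMap (U.ρ g) ≫ f₀ = f₀ ≫ Y' ◁ unitMap (U'.ρ g) := by
    have := f.comm g
    change (𝟙 Y ⊗ₘ unitMap (U.ρ g)) ≫ f₀ = f₀ ≫ (𝟙 Y' ⊗ₘ unitMap (U'.ρ g)) at this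
    rwa [id_tensorHom, id_tensorHom] at this
  let u₀ (m) : U.V →ₗ[k] U'.V :=
    { toFun := fun x => contractHom (b.coord m) ((ρ_ Y).inv ≫ Y ◁ elt C x ≫ f₀)
      map_add' := by simp
      map_smul' := by simp }
  have hu₀ (m) (g : G) (x : U.V) : u₀ m (U.ρ g x) = U'.ρ g (u₀ m x) := by
    refine Eq.trans ?_ (contractHom_unitMap (b.coord m) _ (U'.ρ g))
    change contractHom _ _ = _
    rw [Category.assoc, Category.assoc, ← hf₀, ← whiskerLeft_comp_assoc, elt_unitMap]
  let u (m) : U ⟶ U' := ⟨FGModuleCat.ofHom (u₀ m), fun g => by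
    ext x
    exact hu₀ m g x⟩
  have : f = ∑ m, ((trivFunctor C G).map (b m) ⊗ₘ (unitRep C G).map (u m)) := by
    apply Action.Hom.ext
    have hsum : (∑ m, ((trivFunctor C G).map (b m) ⊗ₘ (unitRep C G).map (u m))).hom =
        ∑ m, ((trivFunctor C G).map (b m) ⊗ₘ (unitRep C G).map (u m)).hom :=
      map_sum (Action.forget C G).mapAddHom _ _
    rw [hsum]
    change f₀ = ∑ m, (b m ⊗ₘ unitMap (u₀ m))
    refine unit_ext_left (k := k) (W := U.V) _ fun x => (cancel_epi (ρ_ _).inv).1 ?_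
    rw [← sum_contractHom b ((ρ_ Y).inv ≫ Y ◁ elt C x ≫ f₀), Preadditive.comp_sum,
      Preadditive.comp_sum]
    refine Finset.sum_congr rfl fun m _ => ?_
    rw [whiskerLeft_comp_tensorHom, elt_unitMap, MonoidalCategory.tensorHom_def,
      rightUnitor_inv_naturality_assoc]
    rfl
  rw [this]
  exact sum_mem fun m _ => AddSubgroup.subset_closure ⟨_, _, rfl⟩

lemma isBoxRefinable_action [IsAlgClosed k] [Finite G] {E : TensorCat k} (T : Action C G ⥤ E)
    (hT : (trivFunctor C G ⋙ T).PreservesEpimorphisms) :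
    IsBoxRefinable (trivFunctor C G) (unitRep C G) T := by
  intro M
  obtain ⟨W, Y, ε, hε, U, a, π, h⟩ := exists_refinement M
  have : Epi (T.map ((trivFunctor C G).map ε)) := hT.preserves ε
  refine ⟨W, Y, trivAug G ε, ?_, U, a, π, h⟩
  rw [trivAug, T.map_comp]
  infer_instance

/-- Two linear symmetric monoidal functors on the representations of a finite group in a tensor
category that are exact on the tensor category are isomorphic if their restrictions to the tensor
category and to the representations over the ground field are. -/
lemma MonoidalIso.of_restrict_action [IsAlgClosed k] [Finite G] {E : TensorCat k}
    (T₁ T₂ : Action C G ⥤ E) [T₁.Braided] [T₂.Braided] [T₁.Additive] [T₂.Additive]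
    (hT₁ : (trivFunctor C G ⋙ T₁).PreservesEpimorphisms)
    (hl : MonoidalIso (trivFunctor C G ⋙ T₁) (trivFunctor C G ⋙ T₂))
    (hr : MonoidalIso (unitRep C G ⋙ T₁) (unitRep C G ⋙ T₂)) : MonoidalIso T₁ T₂ := by
  refine .of_restrict isBoxSpanned_action (isBoxRefinable_action T₁ hT₁)
    (isBoxRefinable_action T₂ ?_) hl hr
  obtain ⟨e, -⟩ := hl
  exact Functor.PreservesEpimorphisms.of_iso e

end Spanned

/-! ### Calculus of monoidal isomorphisms. -/

section MonoidalIso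
variable {C D E E' : Type*} [Category* C] [MonoidalCategory C] [Category* D] [MonoidalCategory D]
  [Category* E] [MonoidalCategory E] [Category* E'] [MonoidalCategory E']

lemma MonoidalIso.symm {F F' : C ⥤ D} [F.Monoidal] [F'.Monoidal] (h : MonoidalIso F F') :
    MonoidalIso F' F := by
  obtain ⟨e, _⟩ := h
  exact ⟨e.symm, inferInstanceAs (NatTrans.IsMonoidal e.inv)⟩

lemma MonoidalIso.trans {F F' F'' : C ⥤ D} [F.Monoidal] [F'.Monoidal] [F''.Monoidal]
    (h : MonoidalIso F F') (h' : MonoidalIso F' F'') : MonoidalIso F F'' := by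
  obtain ⟨e, _⟩ := h
  obtain ⟨e', _⟩ := h'
  exact ⟨e ≪≫ e', inferInstanceAs (NatTrans.IsMonoidal (e.hom ≫ e'.hom))⟩

lemma MonoidalIso.whiskerRight {F F' : C ⥤ D} [F.Monoidal] [F'.Monoidal] (h : MonoidalIso F F')
    (H : D ⥤ E) [H.Monoidal] : MonoidalIso (F ⋙ H) (F' ⋙ H) := by
  obtain ⟨e, _⟩ := h
  exact ⟨Functor.isoWhiskerRight e H,
    inferInstanceAs (NatTrans.IsMonoidal (Functor.whiskerRight e.hom H))⟩

lemma MonoidalIso.whiskerLeft (F : C ⥤ D) [F.Monoidal] {H H' : D ⥤ E} [H.Monoidal] [H'.Monoidal]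
    (h : MonoidalIso H H') : MonoidalIso (F ⋙ H) (F ⋙ H') := by
  obtain ⟨e, _⟩ := h
  exact ⟨Functor.isoWhiskerLeft F e,
    inferInstanceAs (NatTrans.IsMonoidal (Functor.whiskerLeft F e.hom))⟩

lemma MonoidalIso.assoc (F : C ⥤ D) (F' : D ⥤ E) (F'' : E ⥤ E') [F.Monoidal] [F'.Monoidal]
    [F''.Monoidal] : MonoidalIso ((F ⋙ F') ⋙ F'') (F ⋙ F' ⋙ F'') :=
  ⟨F.associator F' F'', inferInstance⟩

end MonoidalIso

/-! ### Applying a monoidal functor to representations. -/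

section MapAction
open Functor.LaxMonoidal
variable {C D : Type*} [Category* C] [MonoidalCategory C] [Category* D]
  [MonoidalCategory D]

instance mapActionBraided [BraidedCategory C] [BraidedCategory D] (F : C ⥤ D) [F.Braided]
    (G : Type*) [Monoid G] : (F.mapAction G).Braided where
  braided X Y := Action.Hom.ext (Functor.LaxBraided.braided (F := F) X.V Y.V)

/-- Equivariant isomorphisms of underlying functors that are monoidal. -/
lemma MonoidalIso.of_hom {A : Type*} [Category* A] [MonoidalCategory A] {G : Type*} [Monoid G]
    {F F' : A ⥤ Action C G} [F.Monoidal] [F'.Monoidal] (e : ∀ X, (F.obj X).V ≅ (F'.obj X).V)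
    (comm : ∀ X g, (F.obj X).ρ g ≫ (e X).hom = (e X).hom ≫ (F'.obj X).ρ g)
    (natural : ∀ {X Y} (f : X ⟶ Y), (F.map f).hom ≫ (e Y).hom = (e X).hom ≫ (F'.map f).hom)
    (unit : (ε F).hom ≫ (e (𝟙_ A)).hom = (ε F').hom)
    (tensor : ∀ X Y, (μ F X Y).hom ≫ (e (X ⊗ Y)).hom =
      ((e X).hom ⊗ₘ (e Y).hom) ≫ (μ F' X Y).hom) : MonoidalIso F F' :=
  ⟨NatIso.ofComponents (fun X => Action.mkIso (e X) (comm X)) fun f => Action.Hom.ext (natural f),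
    ⟨Action.Hom.ext unit, fun X Y => Action.Hom.ext (tensor X Y)⟩⟩

lemma MonoidalIso.mapAction {F F' : C ⥤ D} [F.Monoidal] [F'.Monoidal] (h : MonoidalIso F F')
    (G : Type*) [Monoid G] : MonoidalIso (F.mapAction G) (F'.mapAction G) := by
  obtain ⟨e, he⟩ := h
  exact .of_hom (fun X => e.app X.V) (fun X g => e.hom.naturality (X.ρ g))
    (fun f => e.hom.naturality f.hom) he.unit fun X Y => he.tensor X.V Y.V

lemma MonoidalIso.mapAction_comp {E : Type*} [Category* E] [MonoidalCategory E] (F : C ⥤ D)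
    (F' : D ⥤ E) [F.Monoidal] [F'.Monoidal] (G : Type*) [Monoid G] :
    MonoidalIso (F.mapAction G ⋙ F'.mapAction G) ((F ⋙ F').mapAction G) :=
  .of_hom (fun X => Iso.refl (F'.obj (F.obj X.V)))
    (fun _ _ => (Category.comp_id (F'.map (F.map _))).trans (Category.id_comp _).symm)
    (fun _ => (Category.comp_id (F'.map (F.map _))).trans (Category.id_comp _).symm)
    (Category.comp_id (ε F' ≫ F'.map (ε F)))
    fun X Y => (Category.comp_id (μ F' _ _ ≫ F'.map (μ F X.V Y.V))).trans
      ((congrArg (· ≫ _) (id_tensorHom_id _ _)).trans (Category.id_comp _)).symm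

variable [SymmetricCategory C] [SymmetricCategory D] (F : C ⥤ D) [F.Monoidal]

lemma MonoidalIso.trivFunctor_mapAction (G : Type*) [Monoid G] :
    MonoidalIso (trivFunctor C G ⋙ F.mapAction G) (F ⋙ trivFunctor D G) :=
  .of_hom (fun X => Iso.refl (F.obj X))
    (fun X _ => congrArg (· ≫ 𝟙 (F.obj X)) (F.map_id X))
    (fun f => (Category.comp_id (F.map f)).trans (Category.id_comp _).symm)
    (by
      change (ε F ≫ F.map (𝟙 _)) ≫ 𝟙 _ = 𝟙 _ ≫ ε F
      simp)
    fun X Y => by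
      change (μ F X Y ≫ F.map (𝟙 _)) ≫ 𝟙 _ = (𝟙 (F.obj X) ⊗ₘ 𝟙 (F.obj Y)) ≫ 𝟙 _ ≫ μ F X Y
      simp

lemma MonoidalIso.res_mapAction {G H : Type*} [Monoid G] [Monoid H] (f : G →* H) :
    MonoidalIso (F.mapAction H ⋙ Action.res D f) (Action.res C f ⋙ F.mapAction G) :=
  .of_hom (fun X => Iso.refl (F.obj X.V))
    (fun X _ => (Category.comp_id (F.map _)).trans (Category.id_comp _).symm)
    (fun _ => (Category.comp_id (F.map _)).trans (Category.id_comp _).symm)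
    (by
      change (𝟙 _ ≫ ε F) ≫ 𝟙 _ = ε F ≫ F.map (𝟙 _)
      simp)
    fun X Y => by
      change (𝟙 _ ≫ μ F X.V Y.V) ≫ 𝟙 _ =
        (𝟙 (F.obj X.V) ⊗ₘ 𝟙 (F.obj Y.V)) ≫ μ F X.V Y.V ≫ F.map (𝟙 _)
      simp

end MapAction

/-! ### Linear monoidal functors preserve W ⊗ 𝟙. -/

section UnitFunctor
open Functor.LaxMonoidal
variable {k : Type u} [Field k] {C D : Type*} [Category* C] [Preadditive C] [Linear k C]
  [MonoidalCategory C] [HasFiniteBiproducts C] [MonoidalPreadditive C] [MonoidalLinear k C]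
  [Category* D] [Preadditive D] [Linear k D]
  [MonoidalCategory D] [HasFiniteBiproducts D] [MonoidalPreadditive D] [MonoidalLinear k D]
  (F : C ⥤ D) [F.Monoidal] [F.Additive] [F.Linear k]
  (W : Type u) [AddCommGroup W] [Module k W] [Module.Finite k W]

/-- The comparison `W ⊗ 𝟙 ⟶ F (W ⊗ 𝟙)`. -/
noncomputable def unitObjComparison : unitObj D k W ⟶ F.obj (unitObj C k W) :=
  eltDesc D _ (Linear.leftComp k _ (ε F) ∘ₗ F.mapLinearMap k ∘ₗ elt C)

variable {W} in
lemma elt_unitObjComparison (x : W) :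
    elt D x ≫ unitObjComparison F W = ε F ≫ F.map (elt (k := k) C x) := by
  rw [unitObjComparison, elt_eltDesc]
  rfl

/-- A linear monoidal functor commutes with the functors `W ↦ W ⊗ 𝟙`. -/
noncomputable def unitObjIso : unitObj D k W ≅ F.obj (unitObj C k W) where
  hom := unitObjComparison F W
  inv := ∑ i, F.map (unitπ k C W i) ≫ Functor.OplaxMonoidal.η F ≫ unitι k D W i
  hom_inv_id := unit_ext fun x => by
    rw [← Category.assoc, elt_unitObjComparison, Preadditive.comp_sum]
    conv_rhs => rw [Category.comp_id, ← (Module.finBasis k W).sum_repr x, map_sum]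
    refine Finset.sum_congr rfl fun i _ => ?_
    rw [Category.assoc, ← F.map_comp_assoc, elt_unitπ, F.map_smul, F.map_id, map_smul, elt_basis]
    simp
  inv_hom_id := by
    rw [Preadditive.sum_comp, ← F.map_id, ← sum_unitπ_unitι, F.map_sum]
    refine Finset.sum_congr rfl fun i _ => ?_
    rw [Category.assoc, Category.assoc, ← elt_basis, elt_unitObjComparison, elt_basis,
      Functor.Monoidal.η_ε_assoc, F.map_comp]

lemma MonoidalIso.unitFunctor_comp : MonoidalIso (unitFunctor C k ⋙ F) (unitFunctor D k) := by
  refine .symm ⟨NatIso.ofComponents (fun W => unitObjIso F W) fun {W W'} f => ?_, ?_, fun W W' => ?_⟩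
  · change unitMap f.hom.hom ≫ unitObjComparison F W' =
      unitObjComparison F W ≫ F.map (unitMap f.hom.hom)
    refine unit_ext (k := k) fun x => ?_
    rw [← Category.assoc, elt_unitMap, elt_unitObjComparison, ← Category.assoc,
      elt_unitObjComparison, Category.assoc, ← F.map_comp, elt_unitMap]
  · exact elt_unitObjComparison F (1 : k)
  · change unitμ (k := k) ≫ unitObjComparison F _ =
      (unitObjComparison F W ⊗ₘ unitObjComparison F W') ≫ μ F _ _ ≫ F.map unitμ
    refine unit_ext₂ (k := k) fun x y => ?_
    rw [← Category.assoc, elt_unitμ, Category.assoc, elt_unitObjComparison,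
      tensorHom_comp_tensorHom_assoc, elt_unitObjComparison, elt_unitObjComparison,
      ← tensorHom_comp_tensorHom_assoc, μ_natural_assoc, ← F.map_comp, elt_unitμ, F.map_comp,
      MonoidalCategory.tensorHom_def', Category.assoc, ← Functor.LaxMonoidal.left_unitality_assoc,
      leftUnitor_naturality_assoc]

end UnitFunctor

/-! ### Braided functors commute with tensor powers. -/

section PowerComparison
open Functor.LaxMonoidal
variable {C D : Type*} [Category* C] [MonoidalCategory C] [SymmetricCategory C] [Category* D]
  [MonoidalCategory D] [SymmetricCategory D] (F : C ⥤ D) [F.Braided]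

/-- The isomorphism of the tensor powers of `F X` with the images of the tensor powers of `X`. -/
def tpowComparison (X : C) : (n : ℕ) → (tpow (F.obj X) n ≅ F.obj (tpow X n))
  | 0 => Functor.Monoidal.εIso F
  | n + 1 => whiskerLeftIso (F.obj X) (tpowComparison X n) ≪≫ Functor.Monoidal.μIso F X (tpow X n)

lemma tpowComparison_zero (X : C) : (tpowComparison F X 0).hom = ε F := rfl

lemma tpowComparison_succ (X : C) (n : ℕ) : (tpowComparison F X (n + 1)).hom =
    F.obj X ◁ (tpowComparison F X n).hom ≫ μ F X (tpow X n) := rfl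

lemma tpowComparison_natural {X Y : C} (f : X ⟶ Y) (n : ℕ) :
    tpowMap (F.map f) n ≫ (tpowComparison F Y n).hom =
      (tpowComparison F X n).hom ≫ F.map (tpowMap f n) := by
  induction n with
  | zero => simp [tpowMap, tpowComparison_zero]
  | succ n ih =>
    simp only [tpowComparison_succ, tpowMap, Category.assoc]
    rw [← μ_natural, tensorHom_comp_whiskerLeft_assoc, ih, whiskerLeft_comp_tensorHom_assoc]

lemma whiskerLeft_tpowComparison (X : C) {n : ℕ} {f : tpow X n ⟶ tpow X n}
    {f' : tpow (F.obj X) n ⟶ tpow (F.obj X) n}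
    (h : f' ≫ (tpowComparison F X n).hom = (tpowComparison F X n).hom ≫ F.map f) :
    F.obj X ◁ f' ≫ (tpowComparison F X (n + 1)).hom =
      (tpowComparison F X (n + 1)).hom ≫ F.map (X ◁ f) := by
  rw [tpowComparison_succ, ← whiskerLeft_comp_assoc, h, whiskerLeft_comp_assoc, Category.assoc,
    μ_natural_right]

/-- This is where the braiding of F enters: adjacent transpositions, and through them the whole
symmetric group action, are compatible with the comparison of tensor powers. -/
lemma swapFirst_μ (X Z : C) :
    swapFirst (F.obj X) (F.obj Z) ≫ F.obj X ◁ μ F X Z ≫ μ F X (X ⊗ Z) =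
      F.obj X ◁ μ F X Z ≫ μ F X (X ⊗ Z) ≫ F.map (swapFirst X Z) := by
  simp only [swapFirst, F.map_comp, Category.assoc]
  rw [Functor.LaxMonoidal.associativity_inv_assoc, ← μ_natural_left_assoc,
    ← comp_whiskerRight_assoc, Functor.LaxBraided.braided, comp_whiskerRight_assoc,
    Functor.LaxMonoidal.associativity]

lemma swapFirst_tpowComparison (X : C) (n : ℕ) :
    swapFirst (F.obj X) (tpow (F.obj X) n) ≫ (tpowComparison F X (n + 2)).hom =
      (tpowComparison F X (n + 2)).hom ≫ F.map (swapFirst X (tpow X n)) := by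
  rw [tpowComparison_succ, tpowComparison_succ, whiskerLeft_comp, Category.assoc,
    ← reassoc_of% swapFirst_natural, Category.assoc]
  exact congrArg (_ ≫ ·) ((swapFirst_μ F X (tpow X n)).trans (Category.assoc _ _ _).symm)

lemma toFront_tpowComparison (X : C) : ∀ {n : ℕ} (j : Fin (n + 1)),
    toFront (F.obj X) j ≫ (tpowComparison F X (n + 1)).hom =
      (tpowComparison F X (n + 1)).hom ≫ F.map (toFront X j) := by
  intro n
  induction n with
  | zero => intro j; simp [toFront]
  | succ n ih =>
    intro j
    cases j using Fin.cases with
    | zero => simp [toFront_zero]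
    | succ j =>
      rw [toFront_succ, toFront_succ, Category.assoc, swapFirst_tpowComparison, F.map_comp,
        ← reassoc_of% whiskerLeft_tpowComparison F X (ih j)]

lemma permMap_tpowComparison (X : C) : ∀ {n : ℕ} (σ : Equiv.Perm (Fin n)),
    permMap (F.obj X) σ ≫ (tpowComparison F X n).hom =
      (tpowComparison F X n).hom ≫ F.map (permMap X σ) := by
  intro n
  induction n with
  | zero => intro σ; simp [permMap]
  | succ n ih =>
    intro σ
    rw [permMap_succ, permMap_succ, Category.assoc, whiskerLeft_tpowComparison F X (ih _),
      reassoc_of% toFront_tpowComparison, F.map_comp]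

lemma tpowμ_tpowComparison (X Y : C) (n : ℕ) :
    (tpowμ (F.obj X) (F.obj Y) n).hom ≫ tpowMap (μ F X Y) n ≫ (tpowComparison F (X ⊗ Y) n).hom =
      ((tpowComparison F X n).hom ⊗ₘ (tpowComparison F Y n).hom) ≫ μ F (tpow X n) (tpow Y n) ≫
        F.map (tpowμ X Y n).hom := by
  induction n with
  | zero =>
    simp only [tpowMap, tpowμ, tpowComparison_zero, Category.id_comp]
    rw [MonoidalCategory.tensorHom_def', Category.assoc, ← Functor.LaxMonoidal.left_unitality,
      leftUnitor_naturality]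
  | succ n ih =>
    simp only [tpowμ_succ, tpowComparison_succ, tpowMap, Category.assoc, F.map_comp]
    rw [← tensorHom_comp_tensorHom, Category.assoc, ← tensorμ_comp_μ_tensorHom_μ_comp_μ_assoc,
      ← μ_natural_right, tensorHom_comp_whiskerLeft_assoc, whiskerLeft_comp_tensorHom_assoc,
      ih]
    have e : (F.obj X ◁ (tpowComparison F X n).hom ⊗ₘ F.obj Y ◁ (tpowComparison F Y n).hom) ≫
        tensorμ _ _ _ _ = tensorμ _ _ _ _ ≫ (F.obj X ⊗ F.obj Y) ◁
          ((tpowComparison F X n).hom ⊗ₘ (tpowComparison F Y n).hom) := by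
      simpa using tensorμ_natural (𝟙 (F.obj X)) (tpowComparison F X n).hom (𝟙 (F.obj Y))
        (tpowComparison F Y n).hom
    rw [reassoc_of% e, whiskerLeft_comp_tensorHom_assoc, tensorHom_comp_whiskerLeft_assoc,
      Category.assoc]

lemma tpowε_tpowComparison (n : ℕ) :
    (tpowε n).hom ≫ tpowMap (ε F) n ≫ (tpowComparison F (𝟙_ C) n).hom =
      ε F ≫ F.map (tpowε n).hom := by
  induction n with
  | zero => simp [tpowMap, tpowε, tpowComparison_zero]
  | succ n ih =>
    simp only [tpowε, tpowMap, tpowComparison_succ, Iso.trans_hom, Iso.symm_hom, whiskerLeftIso_hom,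
      Category.assoc, F.map_comp]
    rw [tensorHom_comp_whiskerLeft_assoc, whiskerLeft_comp_tensorHom_assoc, ih, ← F.map_comp,
      ← leftUnitor_inv_naturality, F.map_comp, Functor.Monoidal.map_leftUnitor_inv,
      MonoidalCategory.tensorHom_def', Category.assoc, ← leftUnitor_inv_naturality_assoc,
      Category.assoc]

lemma MonoidalIso.powerFunctor_comp (n : ℕ) : MonoidalIso (F ⋙ powerFunctor D n)
    (powerFunctor C n ⋙ F.mapAction (Equiv.Perm (Fin n))) :=
  .of_hom (fun X => tpowComparison F X n) (fun X σ => permMap_tpowComparison F X σ)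
    (fun f => tpowComparison_natural F f n)
    (by
      change ((tpowε n).hom ≫ tpowMap (ε F) n) ≫ _ = ε F ≫ F.map (tpowε n).hom
      rw [Category.assoc, tpowε_tpowComparison])
    (fun X Y => by
      change ((tpowμ (F.obj X) (F.obj Y) n).hom ≫ tpowMap (μ F X Y) n) ≫ _ =
        _ ≫ μ F (tpow X n) (tpow Y n) ≫ F.map (tpowμ X Y n).hom
      rw [Category.assoc, tpowμ_tpowComparison]
      rfl)

end PowerComparison

/-! ### Naturality in the tensor category. -/

section Naturality
variable {k : Type u} [Field k]

lemma IsSemilinear.additive {C D : TensorCat k} {F : C ⥤ D}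
    (h : IsSemilinear (RingHom.id k) F) : F.Additive := ⟨h.map_add _ _⟩

lemma IsTensorFunctor.preservesEpimorphisms {C D : TensorCat k} {F : C ⥤ D} [F.Braided]
    (h : IsTensorFunctor F) : F.PreservesEpimorphisms := by
  have := h.preservesFiniteColimits
  infer_instance

lemma MonoidalIso.unitRep_mapAction {C D : TensorCat k} {F : C ⥤ D} [F.Braided]
    (h : IsSemilinear (RingHom.id k) F) (G : Type) [Group G] :
    MonoidalIso (unitRep C G ⋙ F.mapAction G) (unitRep D G) := by
  have : F.Additive := h.additive
  have : F.Linear k := ⟨fun f c => h.map_smul c f⟩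
  exact (MonoidalIso.mapAction_comp (unitFunctor C k) F G).trans
    ((MonoidalIso.unitFunctor_comp F).mapAction G)

/-- The functors `C ⊠ Θ` are natural in the tensor category `C`. -/
lemma IsBoxOfLSMFunctor.natural [IsAlgClosed k] {C D V : TensorCat k} {G : Type} [Group G]
    [Finite G] {Θ : FDRep k G ⥤ V} [Θ.Braided] {P : DeligneProduct C V} {Q : DeligneProduct D V}
    {T : Action C G ⥤ P.cat} [T.Braided] {T' : Action D G ⥤ Q.cat} [T'.Braided]
    (hT : IsBoxOfLSMFunctor Θ P T) (hT' : IsBoxOfLSMFunctor Θ Q T') (F : C ⥤ D) [F.Braided]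
    (hF : IsTensorFunctor F) (S : P.cat ⥤ Q.cat) [S.Braided] (hS : IsBoxOfTensorFunctor P Q F S) :
    MonoidalIso (T ⋙ S) (F.mapAction G ⋙ T') := by
  have : F.Additive := hF.linear.additive
  have : S.Additive := hS.isTensorFunctor.linear.additive
  have : T.Additive := ⟨hT.linear.map_add _ _⟩
  have : T'.Additive := ⟨hT'.linear.map_add _ _⟩
  have : (F.mapAction G).Additive := ⟨Action.Hom.ext F.map_add⟩
  refine .of_restrict_action _ _ ?_ ?_ ?_
  · have := P.isTensorFunctor_inl.preservesEpimorphisms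
    have := hS.isTensorFunctor.preservesEpimorphisms
    obtain ⟨e, -⟩ := hT.restrict_left
    exact Functor.PreservesEpimorphisms.of_iso (F := P.inl ⋙ S)
      (Functor.isoWhiskerRight e.symm S ≪≫ Functor.associator _ _ _)
  -- On C both composites are X ↦ F(X) ⊠ 𝟙.
  · refine (MonoidalIso.assoc _ _ _).symm.trans ((hT.restrict_left.whiskerRight S).trans
      (hS.restrict_left.trans (.trans ?_ (MonoidalIso.assoc _ _ _))))
    exact .symm (.trans ((MonoidalIso.trivFunctor_mapAction F G).whiskerRight T')
      ((MonoidalIso.assoc _ _ _).trans (hT'.restrict_left.whiskerLeft F)))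
  -- On Rep G both composites are U ↦ 𝟙 ⊠ Θ(U).
  · refine (MonoidalIso.assoc _ _ _).symm.trans ((hT.restrict_right.whiskerRight S).trans
      ((MonoidalIso.assoc _ _ _).trans ((hS.restrict_right.whiskerLeft Θ).trans
        (.trans ?_ (MonoidalIso.assoc _ _ _)))))
    exact hT'.restrict_right.symm.trans
      ((MonoidalIso.unitRep_mapAction hF.linear G).symm.whiskerRight T')

/-- The composites of the tensor power and `C ⊠ Θ` are natural in the tensor category `C`. -/
lemma powerComposite_natural [IsAlgClosed k] {C D V : TensorCat k} {n : ℕ}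
    (G : Subgroup (Equiv.Perm (Fin n))) {Θ : FDRep k G ⥤ V} [Θ.Braided] {P : DeligneProduct C V}
    {Q : DeligneProduct D V} {T : Action C G ⥤ P.cat} [T.Braided] {T' : Action D G ⥤ Q.cat}
    [T'.Braided] (hT : IsBoxOfLSMFunctor Θ P T) (hT' : IsBoxOfLSMFunctor Θ Q T') (F : C ⥤ D)
    [F.Braided] (hF : IsTensorFunctor F) (S : P.cat ⥤ Q.cat) [S.Braided]
    (hS : IsBoxOfTensorFunctor P Q F S) :
    MonoidalIso (powerComposite G T ⋙ S) (F ⋙ powerComposite G T') := by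
  have h1 : MonoidalIso (Action.res C G.subtype ⋙ T ⋙ S)
      (F.mapAction _ ⋙ Action.res D G.subtype ⋙ T') :=
    ((hT.natural hT' F hF S hS).whiskerLeft _).trans <| (MonoidalIso.assoc _ _ _).symm.trans <|
      ((MonoidalIso.res_mapAction F G.subtype).symm.whiskerRight T').trans (MonoidalIso.assoc _ _ _)
  have h2 : MonoidalIso (powerFunctor C n ⋙ F.mapAction _ ⋙ Action.res D G.subtype ⋙ T')
      (F ⋙ powerComposite G T') :=
    (MonoidalIso.assoc _ _ _).symm.trans <|
      ((MonoidalIso.powerFunctor_comp F n).symm.whiskerRight _).trans (MonoidalIso.assoc _ _ _)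
  exact (MonoidalIso.assoc _ _ _).trans <|
    (((MonoidalIso.assoc _ _ _).trans h1).whiskerLeft (powerFunctor C n)).trans h2

end Naturality

end OFun

theorem theorem5p5 {k : Type u} [Field k] [IsAlgClosed k] (p : ℕ) [Fact p.Prime] [CharP k p]
    (i : ℕ) (hi : 0 < i) (G : Subgroup (Equiv.Perm (Fin (p ^ i))))
    (V : OFun.TensorCat k) (Θ : FDRep k G ⥤ V) [Θ.Braided] (hΘ : OFun.IsVFunctor G Θ)
    (box : ∀ C : OFun.TensorCat k, OFun.DeligneProduct C V)
    (T : ∀ C : OFun.TensorCat k, Action C G ⥤ (box C).cat) [∀ C, (T C).Braided]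
    (hT : ∀ C, OFun.IsBoxOfLSMFunctor Θ (box C) (T C)) :
    OFun.IsOFunctor p i box fun C => OFun.powerComposite G (T C) where
  semilinear C := OFun.powerComposite_semilinear p i G Θ hΘ (box C) (T C) (hT C)
  natural C D F _ hF S _ hS := OFun.powerComposite_natural G (hT C) (hT D) F hF S hS
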